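/- Let $0\le D\le 4$, $\Omega>0$, $m\in\mathbb R$, $M>1$, and consider the commutative $\phi^4$ theory with harmonic term on $\mathbb R^D$, with action $$S(\phi)=\int d^Dx\,\Big(\tfrac12(\partial_\mu\phi)^2+\tfrac{\Omega^2}{2}x^2\phi^2+\tfrac{m^2}{2}\phi^2+\lambda\phi^4\Big).$$ Its propagator in momentum space is cut into slices $\hat C^i(p,q)=(2\pi/\Omega)^{D/2}\int_{I_i}\frac{e^{-m^2t}}{\sinh^{D/2}(2\Omega t)}\exp\!\big(-\tfrac{1}{4\Omega}\coth(\Omega t)(p+q)^2-\tfrac1{4\Omega}\tanh(\Omega t)(p-q)^2\big)\,dt$ with $I_0=[1,\infty)$ and $I_i=[M^{-2i},M^{-2(i-1)}]$ for $i\ge1$. Let $G$ be a connected amputated Feynman graph of this theory (every vertex has valence $4$, loops and multiple lines are allowed) with at least one external leg. For an attribution $\mu$ of an index $i_\ell\in\mathbb N$ to every internal line $\ell$, the quasilocal subgraphs of $G$ at scale $i$ are the connected components of the subgraph formed by the lines with $i_\ell\ge i$ and the vertices hooked to them; $G$ itself is also one, at $i=0$. The external legs of a subgraph are all the other half-lines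 hooked to its vertices. For a graph with $n$ vertices and $N$ external legs put $\omega=(4-D)n+\tfrac12(D-2)N-D$. The amplitude of a graph $H$ with attribution $\mu$ is $$A_H^\mu(k_1,\dots,k_N)=\int\prod_\ell d^Dp_\ell\,d^Dq_\ell\,\hat C^{i_\ell}(p_\ell,q_\ell)\prod_v\delta_v=\int\prod_\ell d^Du_\ell\,B_H^\mu(k_1,\dots,k_{N-1},u)\,\delta\Big(\sum_jk_j-\sum_\ell u_\ell\Big),\qquad u_\ell=p_\ell+q_\ell ,$$ where $\delta_v$ expresses momentum conservation at the vertex $v$, and $B_H^\mu$ is obtained by using the delta functions of all vertices except the one of the leg $k_N$ to eliminate one momentum for each line of a spanning tree $T$ of $H$. For a real Schwartz function $\phi$ and $t\in\mathbb R$ let $$F_H^\mu(t)=\int\prod_j d^Dk_j\,\hat\phi(k_j)\int\prod_\ell d^Du_\ell\,B_H^\mu(tk_1,\dots,tk_{N-1},u)\,\delta\Big(\sum_jk_j-t\sum_\ell u_\ell\Big).$$ Then $\mathcal A_H^\mu(\phi)=F_H^\mu(1)$ and, if $\omega(H)\le0$, $\tau\mathcal A_H^\mu(\phi)=\sum_{j=0}^{-\omega(H)}\frac1{j!}\frac{d^jF_H^\mu}{dt^j}(0)$.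 Let $H$ be a subgraph of $G$ with $\omega(H)\le0$, with any choice of the leg $k_N$ and of the spanning tree $T$. 1. Whenever $H$ is a quasilocal subgraph of $(G,\mu)$ at some scale $i$, all the integrals above converge absolutely, $F_H^\mu$ is smooth, and the counterterm is local and of the form of the action: either $N(H)=4$ and $\tau\mathcal A_H^\mu(\phi)=c\int\phi^4$ for all $\phi$, or $N(H)=2$ and $\tau\mathcal A_H^\mu(\phi)=\int\big(c_1\phi^2+c_2(\partial\phi)^2+c_3x^2\phi^2\big)$ for all $\phi$, with real constants $c,c_1,c_2,c_3$ independent of $\phi$. If $H$ is quasilocal at scale $i$ for some attribution and has an internal line, the counterterms are divergent when summed over the scales: for some $\phi$ the sums $\sum_{\nu\in\{i,\dots,\rho\}^{I(H)}}\tau\mathcal A_H^\nu(\phi)$ over the attributions $\nu$ of $H$ are unbounded as $\rho\to\infty$. 2. For every $\phi$ there is a constant $K$ such that, for all $\mu$ and $i$ for which $H$ is a quasilocal subgraph of $(G,\mu)$ at scale $i$, $$\big|(1-\tau)\mathcal A_H^\mu(\phi)\big|\le K\,M^{-i}\prod_{(j,k)}M^{-\omega(H^j_k)},$$ where the product is over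 the scales $j$ and the quasilocal subgraphs $H^j_k$ at scale $j$ of $H$ with the restricted attribution, other than $H$ itself. Consequently $(1-\tau)\mathcal A_H^\mu(\phi)\to0$ as $i\to\infty$, along all sequences of attributions for which this product stays bounded (for instance when no $H^j_k\ne H$ has $\omega(H^j_k)<0$, or when the differences between the indices of the lines of $H$ stay bounded). -/

import Mathlib

open MeasureTheory SchwartzMap

/-! ## Graphs -/

/-- A Feynman graph: finite sets of vertices, internal lines and external legs.  An internal line
joins `src ℓ` to `tgt ℓ` (possibly equal, parallel lines are allowed); the orientation only serves
to tell the two ends of the line apart.  An external leg `e` is hooked to the vertex `leg e`. -/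
structure FeynmanGraph where
  V : Type
  L : Type
  X : Type
  [fintypeV : Fintype V]
  [fintypeL : Fintype L]
  [fintypeX : Fintype X]
  [decEqV : DecidableEq V]
  [decEqL : DecidableEq L]
  [decEqX : DecidableEq X]
  src : L → V
  tgt : L → V
  leg : X → V

attribute [instance] FeynmanGraph.fintypeV FeynmanGraph.fintypeL FeynmanGraph.fintypeX
  FeynmanGraph.decEqV FeynmanGraph.decEqL FeynmanGraph.decEqX

namespace FeynmanGraph

/-- Half-lines: the two ends of each internal line (`false` at `src`, `true` at `tgt`), and the
external legs. -/
abbrev HalfLine (G : FeynmanGraph) : Type := (G.L × Bool) ⊕ G.X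

/-- The vertex to which a half-line is hooked. -/
def hook (G : FeynmanGraph) : G.HalfLine → G.V
  | Sum.inl (l, false) => G.src l
  | Sum.inl (l, true) => G.tgt l
  | Sum.inr e => G.leg e

/-- A graph of the `φ⁴` theory: exactly four half-lines are hooked to every vertex. -/
def IsPhi4 (G : FeynmanGraph) : Prop :=
  ∀ v : G.V, (Finset.univ.filter fun h : G.HalfLine => G.hook h = v).card = 4

/-- The simple graph on the vertices in which two distinct vertices are adjacent when some line
of `P` joins them. -/
def skeleton (G : FeynmanGraph) (P : Finset G.L) : SimpleGraph G.V :=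
  SimpleGraph.fromRel fun v w => ∃ l ∈ P, G.src l = v ∧ G.tgt l = w

/-- `G` is connected (in particular it has a vertex). -/
def IsConnected (G : FeynmanGraph) : Prop := (G.skeleton Finset.univ).Connected

/-- `T` is a spanning tree: its lines connect all the `n` vertices and there are `n - 1` of
them. -/
def IsSpanningTree (G : FeynmanGraph) (T : Finset G.L) : Prop :=
  (G.skeleton T).Connected ∧ T.card + 1 = Fintype.card G.V

open Classical in
/-- The subgraph with vertex set `S` and with those lines of `P` that have both ends in `S`, seen
as a Feynman graph: its external legs are all the other half-lines hooked to `S`, i.e. external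
legs of `G` or ends of internal lines of `G` which do not belong to the subgraph. -/
noncomputable def sub (G : FeynmanGraph) (P : Finset G.L) (S : Finset G.V) : FeynmanGraph where
  V := {v : G.V // v ∈ S}
  L := {l : G.L // l ∈ P ∧ G.src l ∈ S ∧ G.tgt l ∈ S}
  X := {h : G.HalfLine // G.hook h ∈ S ∧
    ∀ (l : G.L) (b : Bool), h = Sum.inl (l, b) → ¬ (l ∈ P ∧ G.src l ∈ S ∧ G.tgt l ∈ S)}
  src := fun l => ⟨G.src l.1, l.2.2.1⟩
  tgt := fun l => ⟨G.tgt l.1, l.2.2.2⟩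
  leg := fun h => ⟨G.hook h.1, h.2.1⟩

/-- The lines whose index is at least `i`, for the attribution `μ`. -/
def above (G : FeynmanGraph) (μ : G.L → ℕ) (i : ℕ) : Finset G.L :=
  Finset.univ.filter fun l => i ≤ μ l

/-- The lines `P` and vertices `S` are those of a quasilocal subgraph at scale `i` of the graph `G`
with attribution `μ`: a connected component of the subgraph formed by the lines of index at
least `i` and the vertices hooked to them.  At `i = 0` a component without lines is admitted too,
so that a connected graph is always a quasilocal subgraph of itself. -/
def IsQuasilocal (G : FeynmanGraph) (μ : G.L → ℕ) (i : ℕ) (P : Finset G.L) (S : Finset G.V) :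
    Prop :=
  (∃ v, ∀ w, w ∈ S ↔ (G.skeleton (G.above μ i)).Reachable v w) ∧
  (∀ l, l ∈ P ↔ i ≤ μ l ∧ G.src l ∈ S) ∧
  (P.Nonempty ∨ i = 0)

/-- The superficial degree of divergence `(4 - D) n + (D - 2) N / 2 - D` in dimension `D`; the
number `N` of external legs of a graph of the `φ⁴` theory is even, so the division is exact. -/
def omega (D : ℕ) (G : FeynmanGraph) : ℤ :=
  (4 - (D : ℤ)) * (Fintype.card G.V : ℤ) + ((D : ℤ) - 2) * (Fintype.card G.X : ℤ) / 2 - (D : ℤ)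

open Classical in
/-- The product of the power counting factors `M ^ (-ω)` over the pairs formed by a scale `j` and
a quasilocal subgraph of `(G, μ)` at scale `j`, for all scales `j` at which some line of `G` has
dropped out.  (For `G` connected, `G` itself is the only quasilocal subgraph at the other scales, so
this is the product over all quasilocal subgraphs which are smaller than `G`.) -/
noncomputable def innerFactor (D : ℕ) (M : ℝ) (G : FeynmanGraph) (μ : G.L → ℕ) : ℝ :=
  ∏ j ∈ (Finset.range (Finset.univ.sup μ + 1)).filter (fun j => G.above μ j ≠ Finset.univ),
    ∏ PS ∈ (Finset.univ : Finset (Finset G.L × Finset G.V)).filter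
        (fun PS => G.IsQuasilocal μ j PS.1 PS.2),
      M ^ (-(omega D (G.sub PS.1 PS.2)))

end FeynmanGraph

/-! ## The propagator and its slices -/

/-- The integrand, at parameter `t`, of the propagator in momentum space. -/
noncomputable def propKernel {D : ℕ} (Ω m t : ℝ) (p q : EuclideanSpace ℝ (Fin D)) : ℝ :=
  Real.exp (-m ^ 2 * t) / Real.sinh (2 * Ω * t) ^ ((D : ℝ) / 2) *
    Real.exp (-(1 / (4 * Ω)) * (Real.cosh (Ω * t) / Real.sinh (Ω * t)) * ‖p + q‖ ^ 2
      - (1 / (4 * Ω)) * Real.tanh (Ω * t) * ‖p - q‖ ^ 2)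

/-- The range of the parameter in the slice of scale `i`. -/
def sliceSet (M : ℝ) : ℕ → Set ℝ
  | 0 => Set.Ioi 1
  | i + 1 => Set.Ioc (M ^ (-2 * ((i : ℤ) + 1))) (M ^ (-2 * (i : ℤ)))

/-- The propagator of scale `i` in momentum space. -/
noncomputable def propSlice {D : ℕ} (Ω m M : ℝ) (i : ℕ) (p q : EuclideanSpace ℝ (Fin D)) : ℝ :=
  (2 * Real.pi / Ω) ^ ((D : ℝ) / 2) * ∫ t in sliceSet M i, propKernel Ω m t p q

/-- The Fourier transform `φ̂(p) = ∫ φ(x) e^{-ipx} dx`. -/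
noncomputable def fieldHat {D : ℕ} (φ : 𝓢(EuclideanSpace ℝ (Fin D), ℝ))
    (p : EuclideanSpace ℝ (Fin D)) : ℂ :=
  ∫ x, (φ x : ℂ) * Complex.exp (-(Complex.I * ((inner ℝ p x : ℝ) : ℂ)))

/-! ## Amplitudes

An internal line `ℓ` carries the momentum `p ℓ` at `src ℓ` and `q ℓ` at `tgt ℓ`; the integration
variables are `u = p + q` and `q` (Jacobian one).  The leg `e₀` is the one whose momentum is
eliminated with the overall delta function; the vertex of `e₀` is the root.  Up to this overall delta
function, the product of the delta functions of all the vertices is the product over the vertices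
other than the root, which fixes `q ℓ` on the lines of a spanning tree (again with Jacobian one).
-/

namespace FeynmanGraph

/-- Momentum conservation at the vertex `v`, different from the root: the momenta brought by the
external legs balance those carried away by the internal lines. -/
def Conserves {D : ℕ} (G : FeynmanGraph) (e₀ : G.X)
    (k : {e : G.X // e ≠ e₀} → EuclideanSpace ℝ (Fin D)) (u q : G.L → EuclideanSpace ℝ (Fin D))
    (v : G.V) : Prop :=
  ∑ e ∈ Finset.univ.filter (fun e : {e : G.X // e ≠ e₀} => G.leg e.1 = v), k e =
    ∑ l ∈ Finset.univ.filter (fun l => G.src l = v), (u l - q l) +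
    ∑ l ∈ Finset.univ.filter (fun l => G.tgt l = v), q l

open Classical in
/-- The solution `q` of momentum conservation with prescribed values `w` on the lines outside the
spanning tree `T` (it exists and is unique when `T` is a spanning tree). -/
noncomputable def route {D : ℕ} (G : FeynmanGraph) (e₀ : G.X) (T : Finset G.L)
    (k : {e : G.X // e ≠ e₀} → EuclideanSpace ℝ (Fin D)) (u : G.L → EuclideanSpace ℝ (Fin D))
    (w : {l : G.L // l ∉ T} → EuclideanSpace ℝ (Fin D)) : G.L → EuclideanSpace ℝ (Fin D) :=
  if h : ∃ q : G.L → EuclideanSpace ℝ (Fin D),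
      (∀ l : {l : G.L // l ∉ T}, q l.1 = w l) ∧ ∀ v, v ≠ G.leg e₀ → G.Conserves e₀ k u q v
  then h.choose else 0

/-- The product of the sliced propagators, as a function of the momenta that remain after the
delta functions have been used. -/
noncomputable def lineProduct {D : ℕ} (Ω m M : ℝ) (G : FeynmanGraph) (μ : G.L → ℕ) (e₀ : G.X)
    (T : Finset G.L) (k : {e : G.X // e ≠ e₀} → EuclideanSpace ℝ (Fin D))
    (u : G.L → EuclideanSpace ℝ (Fin D)) (w : {l : G.L // l ∉ T} → EuclideanSpace ℝ (Fin D)) : ℝ :=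
  ∏ l, propSlice Ω m M (μ l) (u l - G.route e₀ T k u w l) (G.route e₀ T k u w l)

/-- The function `B(k, u)` which remains of the amplitude when the overall delta function and the
integration over the variables `u` are stripped off. -/
noncomputable def reducedAmp {D : ℕ} (Ω m M : ℝ) (G : FeynmanGraph) (μ : G.L → ℕ) (e₀ : G.X)
    (T : Finset G.L) (k : {e : G.X // e ≠ e₀} → EuclideanSpace ℝ (Fin D))
    (u : G.L → EuclideanSpace ℝ (Fin D)) : ℝ :=
  ∫ w : {l : G.L // l ∉ T} → EuclideanSpace ℝ (Fin D), lineProduct Ω m M G μ e₀ T k u w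

/-- The integrand of the amplitude evaluated on `φ`, when `B(k, u) δ(∑ k - ∑ u)` is replaced by
`B(t k, u) δ(∑ k - t ∑ u)`; the delta function has been used to express the momentum of the
leg `e₀`. -/
noncomputable def scaledIntegrand {D : ℕ} (Ω m M : ℝ) (G : FeynmanGraph) (μ : G.L → ℕ) (e₀ : G.X)
    (T : Finset G.L) (φ : 𝓢(EuclideanSpace ℝ (Fin D), ℝ)) (t : ℝ)
    (z : ({e : G.X // e ≠ e₀} → EuclideanSpace ℝ (Fin D)) × (G.L → EuclideanSpace ℝ (Fin D))) : ℂ :=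
  (reducedAmp Ω m M G μ e₀ T (t • z.1) z.2 : ℂ) * (∏ e, fieldHat φ (z.1 e)) *
    fieldHat φ (t • ∑ l, z.2 l - ∑ e, z.1 e)

/-- The scaled amplitude evaluated on `φ`, as a function of the scaling parameter `t`. -/
noncomputable def scaledAmp {D : ℕ} (Ω m M : ℝ) (G : FeynmanGraph) (μ : G.L → ℕ) (e₀ : G.X)
    (T : Finset G.L) (φ : 𝓢(EuclideanSpace ℝ (Fin D), ℝ)) (t : ℝ) : ℂ :=
  ∫ z, scaledIntegrand Ω m M G μ e₀ T φ t z

/-- The amplitude of `(G, μ)` evaluated on `φ`. -/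
noncomputable def amp {D : ℕ} (Ω m M : ℝ) (G : FeynmanGraph) (μ : G.L → ℕ) (e₀ : G.X)
    (T : Finset G.L) (φ : 𝓢(EuclideanSpace ℝ (Fin D), ℝ)) : ℂ :=
  scaledAmp Ω m M G μ e₀ T φ 1

/-- The counterterm: the Taylor operator of order `-ω`, applied to the amplitude and evaluated
on `φ`. -/
noncomputable def counterterm {D : ℕ} (Ω m M : ℝ) (G : FeynmanGraph) (μ : G.L → ℕ) (e₀ : G.X)
    (T : Finset G.L) (φ : 𝓢(EuclideanSpace ℝ (Fin D), ℝ)) : ℂ :=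
  ∑ j ∈ Finset.range ((-(omega D G)).toNat + 1),
    (1 / (j.factorial : ℂ)) * iteratedDeriv j (scaledAmp Ω m M G μ e₀ T φ) 0

/-- All the integrals which define the scaled amplitudes converge absolutely, and the scaled
amplitude is a smooth function of the scaling parameter. -/
def AmpWellDefined (D : ℕ) (Ω m M : ℝ) (G : FeynmanGraph) (μ : G.L → ℕ) (e₀ : G.X)
    (T : Finset G.L) : Prop :=
  (∀ (l : G.L) (p q : EuclideanSpace ℝ (Fin D)),
    IntegrableOn (fun t => propKernel Ω m t p q) (sliceSet M (μ l))) ∧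
  (∀ (k : {e : G.X // e ≠ e₀} → EuclideanSpace ℝ (Fin D)) (u : G.L → EuclideanSpace ℝ (Fin D)),
    Integrable (fun w => lineProduct Ω m M G μ e₀ T k u w)) ∧
  (∀ (φ : 𝓢(EuclideanSpace ℝ (Fin D), ℝ)) (t : ℝ),
    Integrable (scaledIntegrand Ω m M G μ e₀ T φ t)) ∧
  (∀ φ : 𝓢(EuclideanSpace ℝ (Fin D), ℝ),
    ContDiff ℝ ((⊤ : ℕ∞) : WithTop ℕ∞) (scaledAmp Ω m M G μ e₀ T φ))

end FeynmanGraph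

/-! ## Momentum conservation on a spanning tree has exactly one solution -/

namespace FeynmanGraph

/-- The momenta carried by the lines towards the vertex `v`, when `q` is carried from `src`
to `tgt`. -/
def inflow {D : ℕ} (G : FeynmanGraph) (q : G.L → EuclideanSpace ℝ (Fin D)) (v : G.V) :
    EuclideanSpace ℝ (Fin D) :=
  ∑ l ∈ Finset.univ.filter (fun l => G.tgt l = v), q l -
    ∑ l ∈ Finset.univ.filter (fun l => G.src l = v), q l

theorem inflow_add {D : ℕ} (G : FeynmanGraph) (q q' : G.L → EuclideanSpace ℝ (Fin D)) :
    G.inflow (q + q') = G.inflow q + G.inflow q' := by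
  funext v
  simp only [inflow, Pi.add_apply, Finset.sum_add_distrib]
  abel

theorem inflow_smul {D : ℕ} (G : FeynmanGraph) (c : ℝ) (q : G.L → EuclideanSpace ℝ (Fin D)) :
    G.inflow (c • q) = c • G.inflow q := by
  funext v
  simp only [inflow, Pi.smul_apply, ← Finset.smul_sum, smul_sub]

theorem inflow_single {D : ℕ} (G : FeynmanGraph) (l : G.L) (x : EuclideanSpace ℝ (Fin D)) :
    G.inflow (Pi.single l x) = Pi.single (G.tgt l) x - Pi.single (G.src l) x := by
  funext v
  simp only [inflow, Pi.sub_apply, Pi.single_apply, Finset.sum_filter, eq_comm (a := v)]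
  congr 1
  · rw [Finset.sum_eq_single l] <;> simp +contextual
  · rw [Finset.sum_eq_single l] <;> simp +contextual

theorem exists_inflow_of_reachable {D : ℕ} (G : FeynmanGraph) (T : Finset G.L) {v r : G.V}
    (h : (G.skeleton T).Reachable v r) (x : EuclideanSpace ℝ (Fin D)) :
    ∃ q : G.L → EuclideanSpace ℝ (Fin D), (∀ l, l ∉ T → q l = 0) ∧
      G.inflow q = Pi.single v x - Pi.single r x := by
  obtain ⟨p⟩ := h
  induction p with
  | nil => exact ⟨0, fun _ _ => rfl, by funext v; simp [inflow]⟩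
  | @cons a b c hab _ ih =>
    obtain ⟨q, hq, hq'⟩ := ih
    simp only [skeleton, SimpleGraph.fromRel_adj] at hab
    rcases hab with ⟨_, ⟨l, hl, h1, h2⟩ | ⟨l, hl, h1, h2⟩⟩
    · refine ⟨q + Pi.single l (-x), fun l' hl' => ?_, ?_⟩
      · have : l' ≠ l := fun h => hl' (h ▸ hl)
        simp [hq l' hl', this]
      · rw [inflow_add, inflow_single, hq', h1, h2, Pi.single_neg, Pi.single_neg]
        abel
    · refine ⟨q + Pi.single l x, fun l' hl' => ?_, ?_⟩
      · have : l' ≠ l := fun h => hl' (h ▸ hl)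
        simp [hq l' hl', this]
      · rw [inflow_add, inflow_single, hq', h1, h2]
        abel

/-- On a spanning tree there is exactly one flow with a prescribed inflow at every vertex but one. -/
theorem existsUnique_tree_flow {D : ℕ} (G : FeynmanGraph) (T : Finset G.L)
    (hT : G.IsSpanningTree T) (r : G.V) (d : G.V → EuclideanSpace ℝ (Fin D)) :
    ∃! q : G.L → EuclideanSpace ℝ (Fin D), (∀ l, l ∉ T → q l = 0) ∧
      ∀ v, v ≠ r → G.inflow q v = d v := by
  classical
  let ext : ({l : G.L // l ∈ T} → EuclideanSpace ℝ (Fin D)) → G.L → EuclideanSpace ℝ (Fin D) :=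
    fun f l => if h : l ∈ T then f ⟨l, h⟩ else 0
  have ext_out : ∀ f l, l ∉ T → ext f l = 0 := fun f l h => by simp [ext, h]
  have ext_of : ∀ q : G.L → EuclideanSpace ℝ (Fin D), (∀ l, l ∉ T → q l = 0) →
      ext (fun l => q l.1) = q := by
    intro q hq
    funext l
    by_cases h : l ∈ T
    · simp [ext, h]
    · simp [ext, h, hq l h]
  let A : ({l : G.L // l ∈ T} → EuclideanSpace ℝ (Fin D)) →ₗ[ℝ]
      ({v : G.V // v ≠ r} → EuclideanSpace ℝ (Fin D)) :=
    { toFun := fun f v => G.inflow (ext f) v.1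
      map_add' := fun f g => by
        have : ext (f + g) = ext f + ext g := by
          funext l
          by_cases h : l ∈ T <;> simp [ext, h]
        funext v
        simp [this, inflow_add]
      map_smul' := fun c f => by
        have : ext (c • f) = c • ext f := by
          funext l
          by_cases h : l ∈ T <;> simp [ext, h]
        funext v
        simp [this, inflow_smul] }
  have hsurj : Function.Surjective A := by
    intro d'
    have key : ∀ v : {v : G.V // v ≠ r}, ∃ q : G.L → EuclideanSpace ℝ (Fin D),
        (∀ l, l ∉ T → q l = 0) ∧ G.inflow q = Pi.single v.1 (d' v) - Pi.single r (d' v) :=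
      fun v => exists_inflow_of_reachable G T (hT.1.preconnected v.1 r) (d' v)
    choose Q hQ hQ' using key
    refine ⟨∑ v, fun l => Q v l.1, ?_⟩
    rw [map_sum]
    funext w
    rw [Finset.sum_apply]
    have : ∀ v : {v : G.V // v ≠ r}, A (fun l => Q v l.1) w = if w = v then d' v else 0 := by
      intro v
      change G.inflow (ext fun l => Q v l.1) w.1 = _
      rw [ext_of _ (hQ v), hQ' v]
      by_cases h : w = v
      · subst h
        simp [w.2]
      · have h' : w.1 ≠ v.1 := fun e => h (Subtype.ext e)
        simp [h, h', w.2]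
    simp [this]
  have hdim : Module.finrank ℝ ({l : G.L // l ∈ T} → EuclideanSpace ℝ (Fin D)) =
      Module.finrank ℝ ({v : G.V // v ≠ r} → EuclideanSpace ℝ (Fin D)) := by
    rw [Module.finrank_pi_fintype, Module.finrank_pi_fintype]
    have h1 : Fintype.card {v : G.V // v ≠ r} + 1 = Fintype.card G.V := by
      have := Fintype.card_pos_iff.2 ⟨r⟩
      simp
      omega
    have h2 := hT.2
    have h3 : T.card = Fintype.card {v : G.V // v ≠ r} := by omega
    simp only [finrank_euclideanSpace, Fintype.card_fin, Finset.sum_const, Finset.card_univ,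
      Fintype.card_coe, h3]
  have hinj : Function.Injective A :=
    (LinearMap.injective_iff_surjective_of_finrank_eq_finrank hdim).2 hsurj
  obtain ⟨f, hf⟩ := hsurj fun v => d v.1
  refine ⟨ext f, ⟨ext_out f, fun v hv => congrFun hf ⟨v, hv⟩⟩, ?_⟩
  rintro q ⟨hq, hq'⟩
  have hqf : (fun l : {l : G.L // l ∈ T} => q l.1) = f := by
    apply hinj
    rw [hf]
    funext v
    change G.inflow (ext fun l => q l.1) v.1 = _
    rw [ext_of q hq, hq' v.1 v.2]
  rw [← hqf]
  exact (ext_of q hq).symm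

/-- For a spanning tree, the momenta on the lines of the tree are determined by the other ones. -/
theorem existsUnique_route {D : ℕ} (G : FeynmanGraph) (e₀ : G.X) (T : Finset G.L)
    (hT : G.IsSpanningTree T) (k : {e : G.X // e ≠ e₀} → EuclideanSpace ℝ (Fin D))
    (u : G.L → EuclideanSpace ℝ (Fin D)) (w : {l : G.L // l ∉ T} → EuclideanSpace ℝ (Fin D)) :
    ∃! q : G.L → EuclideanSpace ℝ (Fin D),
      (∀ l : {l : G.L // l ∉ T}, q l.1 = w l) ∧
        ∀ v, v ≠ G.leg e₀ → G.Conserves e₀ k u q v := by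
  classical
  let w' : G.L → EuclideanSpace ℝ (Fin D) := fun l => if h : l ∉ T then w ⟨l, h⟩ else 0
  have hw' : ∀ l : {l : G.L // l ∉ T}, w' l.1 = w l := fun l => by simp [w', l.2]
  have hc : ∀ q v, G.Conserves e₀ k u q v ↔ G.inflow q v =
      ∑ e ∈ Finset.univ.filter (fun e : {e : G.X // e ≠ e₀} => G.leg e.1 = v), k e -
        ∑ l ∈ Finset.univ.filter (fun l => G.src l = v), u l := by
    intro q v
    simp only [Conserves, inflow, Finset.sum_sub_distrib]
    constructor
    · intro h
      rw [h]
      abel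
    · intro h
      rw [eq_sub_iff_add_eq] at h
      rw [← h]
      abel
  obtain ⟨f, ⟨hf, hf'⟩, hu⟩ := existsUnique_tree_flow G T hT (G.leg e₀) (fun v =>
    ∑ e ∈ Finset.univ.filter (fun e : {e : G.X // e ≠ e₀} => G.leg e.1 = v), k e -
      ∑ l ∈ Finset.univ.filter (fun l => G.src l = v), u l - G.inflow w' v)
  refine ⟨f + w', ⟨fun l => by simp [hf l.1 l.2, hw'], fun v hv => ?_⟩, ?_⟩
  · rw [hc, inflow_add, Pi.add_apply, hf' v hv]
    abel
  · rintro q ⟨hq, hq'⟩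
    have hqw : q + (-1 : ℝ) • w' = f := by
      refine hu _ ⟨fun l hl => ?_, fun v hv => ?_⟩
      · have h1 := hq ⟨l, hl⟩
        have h2 := hw' ⟨l, hl⟩
        simp only at h1 h2
        simp [h1, h2]
      · have := (hc q v).1 (hq' v hv)
        rw [inflow_add, Pi.add_apply, inflow_smul, this]
        simp [sub_eq_add_neg]
    rw [← hqw]
    simp

/-- The defining properties of `route`. -/
theorem route_spec {D : ℕ} (G : FeynmanGraph) (e₀ : G.X) (T : Finset G.L)
    (hT : G.IsSpanningTree T) (k : {e : G.X // e ≠ e₀} → EuclideanSpace ℝ (Fin D))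
    (u : G.L → EuclideanSpace ℝ (Fin D)) (w : {l : G.L // l ∉ T} → EuclideanSpace ℝ (Fin D)) :
    (∀ l : {l : G.L // l ∉ T}, G.route e₀ T k u w l.1 = w l) ∧
      ∀ v, v ≠ G.leg e₀ → G.Conserves e₀ k u (G.route e₀ T k u w) v := by
  have h := (existsUnique_route G e₀ T hT k u w).exists
  rw [route, dif_pos h]
  exact h.choose_spec

end FeynmanGraph

/-! Power counting. Put Λ = M^i. On the slice of scale i the coefficient of |p + q|² is of order Λ²,
that of |p - q|² is of order Λ⁻², and the remaining factor integrates to at most a constant times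
Λ^(D-2). Hence u is of size 1/Λ and a loop momentum of size Λ: a line of the tree counts Λ^(-D)
Λ^(D-2) = Λ⁻² and a line off the tree Λ^(D-2). These are the exponents `lineExp`, and
`exists_dominant_bound` integrates them. By `omega_eq` the degree is ω = 2L - D(L - n + 1), so that
the exponents add up to -ω.

The rest. As a function of t the integrand is the exponential of minus a quadratic polynomial, times
the field at an affine function of t. A derivative in t brings either the root of the leading
coefficient, which comes from the coefficients of order Λ⁻² and is O(M^(-i) |k|), or the sum of the
u, which is O(M^(-i)), where i is a lower bound of the indices. The lines off the tree do not see t,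
and the polynomial stays above their contribution (`expLin_sq_le`), so that
`exists_gaussian_derivBound` keeps the decay in the loop momenta uniformly in t. Taylor's remainder,
of order 1 - ω, therefore gains M^(-i(1-ω)), which is M^(-i) better than what the overall degree
costs.

When the scales differ, this count is sharp only for a tree built in decreasing order of the
indices, which spans every quasilocal component (`exists_adapted_tree`). The exponents then regroup,
scale by scale, into the degrees of the components (`prod_lineExp_le_innerFactor`). Another tree
multiplies the amplitude by a constant Jacobian (`exists_tree_change`), and there are finitely many
trees; so the constant of `exists_rest_bound` is uniform in the attribution.

Locality. At t = 0 the external and the internal integrals decouple. The value F(0) is a multiple of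
∫ φ^N, and F'(0) = 0 by parity. By `external_cases` the second derivative is needed only for two
legs. There the internal moments are invariant under rotations, hence scalar (`exists_isotropic`),
and give (∂φ)² and x²φ², while the mixed terms reduce to φ² by integration by parts.

Divergence. On attributions with all lines at one scale j, the kernels are bounded below for momenta
of the natural size, so a moment of degree d grows at least like M^(j(-ω-d))
(`exists_moment_lower_bound`). For ω = 0 or -1 this applies to the coefficient of φ^N. For ω = -2
the three local terms could compensate each other; a second difference under translations isolates
the harmonic term, whose coefficient has a sign and does not tend to zero along these attributions.
-/

/-! ## Smooth functions of one variable with controlled derivatives -/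

open scoped ContDiff in
/-- A smooth function whose derivative of order `r` is bounded by `B r`, for every `r`. -/
def DerivBound (f : ℝ → ℂ) (B : ℕ → ℝ) : Prop :=
  ContDiff ℝ ∞ f ∧ ∀ r t, ‖iteratedDeriv r f t‖ ≤ B r

namespace DerivBound

theorem mono {f : ℝ → ℂ} {B C : ℕ → ℝ} (h : DerivBound f B) (hBC : ∀ r, B r ≤ C r) :
    DerivBound f C :=
  ⟨h.1, fun r t => (h.2 r t).trans (hBC r)⟩

theorem const_mul {f : ℝ → ℂ} {B : ℕ → ℝ} (h : DerivBound f B) (c : ℂ) :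
    DerivBound (fun t => c * f t) (fun r => ‖c‖ * B r) := by
  refine ⟨contDiff_const.mul h.1, fun r t => ?_⟩
  rw [iteratedDeriv_const_mul_field, norm_mul]
  exact mul_le_mul_of_nonneg_left (h.2 r t) (norm_nonneg c)

/-- Leibniz' rule. Both factors carry the same scale ρ, so that ρ^j and ρ^(r-j) recombine and only
the combinatorial coefficient changes. -/
theorem mul {f g : ℝ → ℂ} {A B : ℕ → ℝ} {a b ρ : ℝ} (ha : 0 ≤ a) (hρ : 0 ≤ ρ)
    (hA : ∀ r, 0 ≤ A r)
    (hf : DerivBound f fun r => a * (A r * ρ ^ r)) (hg : DerivBound g fun r => b * (B r * ρ ^ r)) :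
    DerivBound (fun t => f t * g t) fun r =>
      a * b * ((∑ j ∈ Finset.range (r + 1), (r.choose j : ℝ) * A j * B (r - j)) * ρ ^ r) := by
  refine ⟨hf.1.mul hg.1, fun r t => ?_⟩
  have e : (fun t => f t * g t) = f * g := rfl
  rw [e, iteratedDeriv_mul ((hf.1.of_le (by exact_mod_cast le_top)).contDiffAt)
    ((hg.1.of_le (by exact_mod_cast le_top)).contDiffAt)]
  beta_reduce
  rw [Finset.sum_mul, Finset.mul_sum]
  refine (norm_sum_le _ _).trans (Finset.sum_le_sum fun j hj => ?_)
  rw [norm_mul, norm_mul, Complex.norm_natCast]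
  have hj' : j ≤ r := Nat.lt_succ_iff.1 (Finset.mem_range.1 hj)
  have h1 := hf.2 j t
  have h2 := hg.2 (r - j) t
  calc (r.choose j : ℝ) * ‖iteratedDeriv j f t‖ * ‖iteratedDeriv (r - j) g t‖
      ≤ (r.choose j : ℝ) * (a * (A j * ρ ^ j)) * (b * (B (r - j) * ρ ^ (r - j))) := by
        refine mul_le_mul (mul_le_mul_of_nonneg_left h1 (by positivity)) h2 (norm_nonneg _) ?_
        have := hA j
        positivity
    _ = a * b * ((r.choose j : ℝ) * A j * B (r - j) * ρ ^ r) := by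
        rw [← Nat.add_sub_cancel' hj', pow_add]
        simp only [Nat.add_sub_cancel_left]
        ring

end DerivBound

/-- The argument works for every polynomial: it is additive, and a monomial is absorbed through
|x|^m ≤ m! e^|x| and |x| - x²/2 ≤ 1/2. -/
theorem exists_hermite_bound (n : ℕ) :
    ∃ C : ℝ, ∀ x : ℝ, |Polynomial.aeval x (Polynomial.hermite n) * Real.exp (-(x ^ 2 / 2))| ≤ C := by
  have key : ∀ p : Polynomial ℤ,
      ∃ C : ℝ, ∀ x : ℝ, |Polynomial.aeval x p * Real.exp (-(x ^ 2 / 2))| ≤ C := by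
    intro p
    induction p using Polynomial.induction_on' with
    | add p q hp hq =>
      obtain ⟨C, hC⟩ := hp
      obtain ⟨C', hC'⟩ := hq
      refine ⟨C + C', fun x => ?_⟩
      rw [map_add, add_mul]
      exact (abs_add_le _ _).trans (add_le_add (hC x) (hC' x))
    | monomial m a =>
      refine ⟨|(a : ℝ)| * (m.factorial * Real.exp (1 / 2)), fun x => ?_⟩
      rw [Polynomial.aeval_monomial, mul_assoc, abs_mul]
      simp only [algebraMap_int_eq, eq_intCast]
      refine mul_le_mul_of_nonneg_left ?_ (abs_nonneg _)
      rw [abs_mul, abs_of_pos (Real.exp_pos _), abs_pow]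
      have h1 := Real.pow_div_factorial_le_exp |x| (abs_nonneg x) m
      have h2 : |x| ^ m ≤ m.factorial * Real.exp |x| := by
        rw [div_le_iff₀ (by positivity)] at h1
        linarith
      calc |x| ^ m * Real.exp (-(x ^ 2 / 2))
          ≤ m.factorial * Real.exp |x| * Real.exp (-(x ^ 2 / 2)) := by gcongr
        _ = m.factorial * Real.exp (|x| + -(x ^ 2 / 2)) := by rw [mul_assoc, ← Real.exp_add]
        _ ≤ m.factorial * Real.exp (1 / 2) := by
          gcongr
          nlinarith [sq_nonneg (|x| - 1), sq_abs x]
  exact key _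

/-- All derivatives of a Gaussian are bounded, with the natural scaling. -/
theorem exists_gaussian_derivBound :
    ∃ A : ℕ → ℝ, (∀ r, 0 ≤ A r) ∧ ∀ α b γ γ₀ : ℝ, 0 ≤ α → b ^ 2 ≤ α * (γ - γ₀) → γ₀ ≤ γ →
      DerivBound (fun t => ((Real.exp (-(α * t ^ 2 - 2 * b * t + γ)) : ℝ) : ℂ))
        fun r => Real.exp (-γ₀) * (A r * (Real.sqrt α) ^ r) := by
  choose C hC using exists_hermite_bound
  have hC0 : ∀ r, 0 ≤ C r := fun r => (abs_nonneg _).trans (hC r 0)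
  -- The powers of √2 come from writing α t² as y²/2 with y = √(2α) t. The added 1 serves the
  -- degenerate case α = 0, r = 0, where only `C 0 ≥ 0` is used.
  refine ⟨fun r => (C r + 1) * Real.sqrt 2 ^ r, fun r => by have := hC0 r; positivity, ?_⟩
  intro α b γ γ₀ hα hb hγ
  refine ⟨Complex.ofRealCLM.contDiff.comp
    (g := Complex.ofRealCLM) (f := fun t : ℝ => Real.exp (-(α * t ^ 2 - 2 * b * t + γ)))
    (by fun_prop), fun r t => ?_⟩
  have hof : ∀ g : ℝ → ℝ, ContDiff ℝ ⊤ g →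
      ‖iteratedDeriv r (fun t => ((g t : ℝ) : ℂ)) t‖ = |iteratedDeriv r g t| := by
    intro g hg
    have := Complex.ofRealLI.norm_iteratedFDeriv_comp_left (f := g) (x := t) (n := ⊤) (i := r)
      hg.contDiffAt le_top
    rw [norm_iteratedFDeriv_eq_norm_iteratedDeriv, norm_iteratedFDeriv_eq_norm_iteratedDeriv] at this
    simpa [Function.comp_def] using this
  rw [hof _ (by fun_prop)]
  rcases hα.eq_or_lt with h0 | h0
  · subst h0
    have hb0 : b = 0 := by nlinarith
    subst hb0
    simp only [zero_mul, mul_zero, sub_zero, zero_add, Real.sqrt_zero]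
    rw [iteratedDeriv_const]
    split_ifs with hr
    · subst hr
      simp only [pow_zero, mul_one, abs_of_pos (Real.exp_pos _)]
      have : Real.exp (-γ) ≤ Real.exp (-γ₀) := Real.exp_le_exp.2 (by linarith)
      nlinarith [hC0 0, Real.exp_pos (-γ₀)]
    · rw [abs_zero]
      have := hC0 r
      positivity
  · let h : ℝ → ℝ := fun y => Real.exp (-(y ^ 2 / 2))
    have hh : ContDiff ℝ ⊤ h := by fun_prop
    set s := Real.sqrt (2 * α) with hs
    have hs2 : s ^ 2 = 2 * α := Real.sq_sqrt (by positivity)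
    -- Completing the square: the centre b/α may be anywhere, since the Hermite functions are
    -- bounded on the whole line, and the constant γ - b²/α left over is at least γ₀ by hypothesis.
    have e : (fun t => Real.exp (-(α * t ^ 2 - 2 * b * t + γ))) =
        fun t => Real.exp (-(γ - b ^ 2 / α)) * (fun x => h (s * x)) (t + -(b / α)) := by
      funext x
      simp only [h]
      rw [← Real.exp_add, mul_pow, hs2]
      congr 1
      field_simp
      ring
    rw [e, iteratedDeriv_const_mul_field, iteratedDeriv_comp_add_const (f := fun x => h (s * x)),
      iteratedDeriv_comp_const_smul (hh.of_le le_top), iteratedDeriv_eq_iterate]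
    simp only [h]
    rw [Polynomial.deriv_gaussian_eq_hermite_mul_gaussian, abs_mul, abs_of_pos (Real.exp_pos _),
      smul_eq_mul, abs_mul, mul_assoc ((-1 : ℝ) ^ r), abs_mul, abs_pow, abs_pow (-1 : ℝ), abs_neg,
      abs_one, one_pow, one_mul, abs_of_nonneg (Real.sqrt_nonneg _ : 0 ≤ s)]
    have h1 : Real.exp (-(γ - b ^ 2 / α)) ≤ Real.exp (-γ₀) := by
      apply Real.exp_le_exp.2
      have : b ^ 2 / α ≤ γ - γ₀ := by
        rw [div_le_iff₀ h0]
        linarith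
      linarith
    have h2 : s ^ r = Real.sqrt 2 ^ r * Real.sqrt α ^ r := by
      rw [hs, Real.sqrt_mul (by norm_num), mul_pow]
    rw [h2]
    have h3 := hC r (s * (t + -(b / α)))
    calc _ ≤ Real.exp (-γ₀) * (Real.sqrt 2 ^ r * Real.sqrt α ^ r * (C r + 1)) := by
          gcongr
          linarith
      _ = _ := by ring

/-! ## Differentiation under the integral sign, at all orders -/

-- The bounds on all derivatives are uniform in the parameter, so dominated differentiation can be
-- iterated. Measurability is assumed for the functions alone; it passes to the derivatives as
-- limits of difference quotients along 1/(n+1).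
open scoped ContDiff in
theorem contDiff_integral_of_derivBound {Z : Type*} [MeasurableSpace Z] {ν : Measure Z}
    {f : ℝ → Z → ℂ} {b : ℕ → Z → ℝ} (hmeas : ∀ t, AEStronglyMeasurable (f t) ν)
    (hb : ∀ r, Integrable (b r) ν)
    (hf : ∀ᵐ z ∂ν, DerivBound (fun t => f t z) fun r => b r z) :
    ContDiff ℝ ∞ (fun t => ∫ z, f t z ∂ν) ∧
      ∀ r t, Integrable (fun z => iteratedDeriv r (fun s => f s z) t) ν ∧
        iteratedDeriv r (fun s => ∫ z, f s z ∂ν) t = ∫ z, iteratedDeriv r (fun s => f s z) t ∂ν := by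
  have hdiff : ∀ r, ∀ᵐ z ∂ν, ∀ t, HasDerivAt (fun s => iteratedDeriv r (fun s => f s z) s)
      (iteratedDeriv (r + 1) (fun s => f s z) t) t := by
    intro r
    filter_upwards [hf] with z hz t
    rw [iteratedDeriv_succ]
    exact ((hz.1.differentiable_iteratedDeriv r
      (by exact_mod_cast WithTop.coe_lt_top (r : ℕ))) t).hasDerivAt
  have hm : ∀ r t, AEStronglyMeasurable (fun z => iteratedDeriv r (fun s => f s z) t) ν := by
    intro r
    induction r with
    | zero => simpa using hmeas
    | succ r ih =>
      intro t
      have hseq : Filter.Tendsto (fun n : ℕ => ((n : ℝ) + 1)⁻¹) Filter.atTop (nhdsWithin 0 {0}ᶜ) := by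
        rw [tendsto_nhdsWithin_iff]
        refine ⟨?_, Filter.Eventually.of_forall fun n => ?_⟩
        · simpa using tendsto_one_div_add_atTop_nhds_zero_nat (𝕜 := ℝ)
        · simp only [Set.mem_compl_iff, Set.mem_singleton_iff]
          positivity
      refine aestronglyMeasurable_of_tendsto_ae (u := Filter.atTop) (f := fun (n : ℕ) z =>
        (((n : ℝ) + 1)⁻¹)⁻¹ • (iteratedDeriv r (fun s => f s z) (t + ((n : ℝ) + 1)⁻¹) -
          iteratedDeriv r (fun s => f s z) t)) (fun n => ((ih (t + ((n : ℝ) + 1)⁻¹)).sub (ih t)).const_smul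
          (((n : ℝ) + 1)⁻¹)⁻¹) ?_
      filter_upwards [hdiff r] with z hz
      exact (hasDerivAt_iff_tendsto_slope_zero.1 (hz t)).comp hseq
  have hint : ∀ r t, Integrable (fun z => iteratedDeriv r (fun s => f s z) t) ν := by
    intro r t
    refine (hb r).mono' (hm r t) ?_
    filter_upwards [hf] with z hz using hz.2 r t
  have hD : ∀ r t, HasDerivAt (fun s => ∫ z, iteratedDeriv r (fun s => f s z) s ∂ν)
      (∫ z, iteratedDeriv (r + 1) (fun s => f s z) t ∂ν) t := by
    intro r t
    refine (hasDerivAt_integral_of_dominated_loc_of_deriv_le (s := Set.univ) (bound := b (r + 1))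
      (F := fun s z => iteratedDeriv r (fun s => f s z) s)
      (F' := fun s z => iteratedDeriv (r + 1) (fun s => f s z) s)
      Filter.univ_mem (Filter.Eventually.of_forall (hm r)) (hint r t) (hm (r + 1) t) ?_
      (hb (r + 1)) ?_).2
    · filter_upwards [hf] with z hz s _ using hz.2 (r + 1) s
    · filter_upwards [hdiff r] with z hz s _ using hz s
  have heq : ∀ r, iteratedDeriv r (fun s => ∫ z, f s z ∂ν) =
      fun t => ∫ z, iteratedDeriv r (fun s => f s z) t ∂ν := by
    intro r
    induction r with
    | zero => simp
    | succ r ih =>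
      rw [iteratedDeriv_succ, ih]
      funext t
      exact (hD r t).deriv
  refine ⟨contDiff_of_differentiable_iteratedDeriv fun m _ => ?_, fun r t =>
    ⟨hint r t, congrFun (heq r) t⟩⟩
  rw [heq]
  exact fun t => (hD m t).differentiableAt

/-- Taylor's formula at order `n`, between `0` and `1`. -/
theorem norm_sub_taylor_le {f : ℝ → ℂ} {B : ℕ → ℝ} (hf : DerivBound f B) (n : ℕ) :
    ‖f 1 - ∑ j ∈ Finset.range (n + 1), (1 / (j.factorial : ℂ)) * iteratedDeriv j f 0‖
      ≤ B (n + 1) := by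
  have hc : ∀ m : ℕ, ContDiff ℝ m f := fun m => hf.1.of_le (by exact_mod_cast le_top)
  have hw : ∀ (m : ℕ) (x : ℝ), x ∈ Set.Icc (0 : ℝ) 1 →
      iteratedDerivWithin m f (Set.Icc 0 1) x = iteratedDeriv m f x := fun m x hx =>
    iteratedDerivWithin_eq_iteratedDeriv (uniqueDiffOn_Icc zero_lt_one) (hc m).contDiffAt hx
  have h := taylor_mean_remainder_bound (f := f) (a := 0) (b := 1) (C := B (n + 1)) (x := 1) (n := n)
    zero_le_one (by exact_mod_cast (hc (n + 1)).contDiffOn) (by simp) (fun y hy => by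
      rw [hw _ _ hy]
      exact hf.2 _ _)
  have e : taylorWithinEval f n (Set.Icc 0 1) 0 1 =
      ∑ j ∈ Finset.range (n + 1), (1 / (j.factorial : ℂ)) * iteratedDeriv j f 0 := by
    rw [taylor_within_apply]
    refine Finset.sum_congr rfl fun j _ => ?_
    rw [hw _ _ (by simp)]
    simp
  rw [e] at h
  refine h.trans ?_
  have hB : 0 ≤ B (n + 1) := (norm_nonneg _).trans (hf.2 (n + 1) 0)
  rw [sub_zero, one_pow, mul_one]
  exact div_le_self hB (by exact_mod_cast Nat.one_le_iff_ne_zero.2 (Nat.factorial_ne_zero n))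

namespace FeynmanGraph

/-! ## Counting half-lines -/

theorem card_halfLines {G : FeynmanGraph} (hG : G.IsPhi4) :
    2 * Fintype.card G.L + Fintype.card G.X = 4 * Fintype.card G.V := by
  have h := Finset.card_eq_sum_card_fiberwise (f := G.hook) (s := Finset.univ) (t := Finset.univ)
    (fun _ _ => Finset.mem_coe.2 (Finset.mem_univ _))
  rw [Finset.sum_congr rfl fun v _ => hG v] at h
  simp only [Finset.card_univ, Fintype.card_sum, Fintype.card_prod, Fintype.card_bool,
    Finset.sum_const, smul_eq_mul] at h
  omega

/-- The half-lines of the subgraph are in bijection with the half-lines of `G` hooked to `S`: an end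
of a line which is cut becomes an external leg at the same vertex. -/
theorem isPhi4_sub {G : FeynmanGraph} (hG : G.IsPhi4) (P : Finset G.L) (S : Finset G.V) :
    (G.sub P S).IsPhi4 := by
  intro v
  rw [← hG v.1]
  let φ : (G.sub P S).HalfLine → G.HalfLine := fun h =>
    match h with
    | Sum.inl (l, b) => Sum.inl (l.1, b)
    | Sum.inr x => x.1
  have hφ : ∀ h, G.hook (φ h) = ((G.sub P S).hook h).1 := by
    rintro (⟨l, b | b⟩ | x) <;> rfl
  refine Finset.card_bij (fun h _ => φ h) ?_ ?_ ?_
  · intro h hh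
    simp only [Finset.mem_filter, Finset.mem_univ, true_and] at hh ⊢
    rw [hφ, hh]
  · rintro (⟨l, b⟩ | x) - (⟨l', b'⟩ | x') - h
    · simp only [φ, Sum.inl.injEq, Prod.mk.injEq] at h
      rw [Subtype.ext h.1, h.2]
    · exact absurd l.2 (x'.2.2 l.1 b h.symm)
    · exact absurd l'.2 (x.2.2 l'.1 b' h)
    · simp only [φ] at h
      rw [Subtype.ext h]
  · intro h hh
    simp only [Finset.mem_filter, Finset.mem_univ, true_and] at hh
    have hS : G.hook h ∈ S := hh ▸ v.2
    by_cases hx : ∀ (l : G.L) (b : Bool), h = Sum.inl (l, b) →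
        ¬ (l ∈ P ∧ G.src l ∈ S ∧ G.tgt l ∈ S)
    · refine ⟨Sum.inr ⟨h, hS, hx⟩, ?_, rfl⟩
      simp only [Finset.mem_filter, Finset.mem_univ, true_and]
      exact Subtype.ext hh
    · push Not at hx
      obtain ⟨l, b, rfl, hl⟩ := hx
      refine ⟨Sum.inl (⟨l, hl⟩, b), ?_, rfl⟩
      simp only [Finset.mem_filter, Finset.mem_univ, true_and]
      apply Subtype.ext
      rw [← hφ]
      exact hh

/-- Eliminating N through 2L + N = 4n, which also makes the division by two exact, expresses the
degree by the numbers of lines and of loops. In this form it can be distributed over the lines. -/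
theorem omega_eq {G : FeynmanGraph} (hG : G.IsPhi4) (D : ℕ) :
    omega D G = 2 * (Fintype.card G.L : ℤ) -
      D * ((Fintype.card G.L : ℤ) - Fintype.card G.V + 1) := by
  have h := card_halfLines hG
  have hX : (Fintype.card G.X : ℤ) = 2 * (2 * Fintype.card G.V - Fintype.card G.L) := by
    have : (2 * Fintype.card G.L + Fintype.card G.X : ℤ) = 4 * Fintype.card G.V := by
      exact_mod_cast h
    linarith
  rw [omega, hX]
  have : ((D : ℤ) - 2) * (2 * (2 * (Fintype.card G.V : ℤ) - Fintype.card G.L)) / 2 =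
      ((D : ℤ) - 2) * (2 * (Fintype.card G.V : ℤ) - Fintype.card G.L) := by
    rw [show ((D : ℤ) - 2) * (2 * (2 * (Fintype.card G.V : ℤ) - Fintype.card G.L)) =
      ((D : ℤ) - 2) * (2 * (Fintype.card G.V : ℤ) - Fintype.card G.L) * 2 by ring]
    exact Int.mul_ediv_cancel _ (by norm_num)
  rw [this]
  ring

theorem card_sub_V {G : FeynmanGraph} (P : Finset G.L) (S : Finset G.V) :
    Fintype.card (G.sub P S).V = S.card := by
  rw [← Fintype.card_coe]
  exact Fintype.card_congr (Equiv.refl _)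

theorem card_sub_L {G : FeynmanGraph} (P : Finset G.L) (S : Finset G.V)
    (h : ∀ l ∈ P, G.src l ∈ S ∧ G.tgt l ∈ S) :
    Fintype.card (G.sub P S).L = P.card := by
  rw [← Fintype.card_coe]
  exact Fintype.card_congr (Equiv.subtypeEquivRight fun l => ⟨fun h => h.1, fun hl => ⟨hl, h l hl⟩⟩)

/-! ## Components and spanning trees -/

section reachability

variable {G : FeynmanGraph}

theorem skeleton_adj {P : Finset G.L} {v w : G.V} : (G.skeleton P).Adj v w ↔
    v ≠ w ∧ ∃ l ∈ P, (G.src l = v ∧ G.tgt l = w) ∨ (G.src l = w ∧ G.tgt l = v) := by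
  simp only [skeleton, SimpleGraph.fromRel_adj]
  constructor
  · rintro ⟨h, ⟨l, hl, h'⟩ | ⟨l, hl, h'⟩⟩
    exacts [⟨h, l, hl, Or.inl h'⟩, ⟨h, l, hl, Or.inr h'⟩]
  · rintro ⟨h, l, hl, h' | h'⟩
    exacts [⟨h, Or.inl ⟨l, hl, h'⟩⟩, ⟨h, Or.inr ⟨l, hl, h'⟩⟩]

theorem reachable_of_mem {P : Finset G.L} {l : G.L} (hl : l ∈ P) :
    (G.skeleton P).Reachable (G.src l) (G.tgt l) := by
  by_cases h : G.src l = G.tgt l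
  · rw [h]
  · exact (skeleton_adj.2 ⟨h, l, hl, Or.inl ⟨rfl, rfl⟩⟩).reachable

theorem reachable_of_lines {P Q : Finset G.L}
    (h : ∀ l ∈ P, (G.skeleton Q).Reachable (G.src l) (G.tgt l)) {v w : G.V}
    (hvw : (G.skeleton P).Reachable v w) : (G.skeleton Q).Reachable v w := by
  obtain ⟨p⟩ := hvw
  induction p with
  | nil => exact SimpleGraph.Reachable.refl _
  | cons hab _ ih =>
    obtain ⟨-, l, hl, ⟨rfl, rfl⟩ | ⟨rfl, rfl⟩⟩ := skeleton_adj.1 hab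
    · exact (h l hl).trans ih
    · exact (h l hl).symm.trans ih

theorem reachable_mono {P Q : Finset G.L} (h : P ⊆ Q) {v w : G.V}
    (hvw : (G.skeleton P).Reachable v w) : (G.skeleton Q).Reachable v w :=
  reachable_of_lines (fun _ hl => reachable_of_mem (h hl)) hvw

/-- A component has at most one vertex more than it has lines. -/
theorem card_component_le (F : Finset G.L) (S : Finset G.V) (v : G.V)
    (hS : ∀ w, w ∈ S ↔ (G.skeleton F).Reachable v w) :
    S.card ≤ (F.filter fun l => G.src l ∈ S).card + 1 := by
  have hv : v ∈ S := (hS v).2 (SimpleGraph.Reachable.refl _)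
  -- Each vertex other than `v` chooses the first line of a shortest path to `v`. The choice is
  -- injective: if the two ends of a line both chose it, each would be strictly closer to `v` than
  -- the other.
  have key : ∀ w ∈ S.erase v, ∃ l ∈ F, ∃ w', (G.skeleton F).dist w' v < (G.skeleton F).dist w v ∧
      ((G.src l = w ∧ G.tgt l = w') ∨ (G.src l = w' ∧ G.tgt l = w)) := by
    intro w hw
    obtain ⟨hwv, hwS⟩ := Finset.mem_erase.1 hw
    obtain ⟨p, hp⟩ := ((hS w).1 hwS).symm.exists_walk_length_eq_dist
    cases p with
    | nil => exact absurd rfl hwv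
    | cons hab p =>
      obtain ⟨-, l, hl, h⟩ := skeleton_adj.1 hab
      refine ⟨l, hl, _, ?_, h⟩
      have := SimpleGraph.dist_le p
      rw [SimpleGraph.Walk.length_cons] at hp
      omega
  have hL : Nonempty G.L ∨ S.card ≤ 1 := by
    by_cases h : ∃ w, w ∈ S.erase v
    · obtain ⟨w, hw⟩ := h
      obtain ⟨l, -⟩ := key w hw
      exact Or.inl ⟨l⟩
    · right
      rw [← Finset.card_erase_add_one hv, Finset.eq_empty_of_forall_notMem (not_exists.1 h)]
      simp
  rcases hL with hL | hL
  swap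
  · omega
  have hV : Nonempty G.V := ⟨v⟩
  choose! f hf g hg hfg using key
  have hcard : (S.erase v).card ≤ (F.filter fun l => G.src l ∈ S).card := by
    refine Finset.card_le_card_of_injOn f (fun w hw => ?_) ?_
    · have hwS := Finset.mem_of_mem_erase hw
      simp only [Finset.coe_filter, Set.mem_ofPred_eq]
      refine ⟨hf w hw, ?_⟩
      rcases hfg w hw with h | h
      · rw [h.1]
        exact hwS
      · rw [hS]
        refine ((hS w).1 hwS).trans ?_
        have := (reachable_of_mem (hf w hw)).symm
        rwa [h.2] at this
    · intro w hw w' hw' h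
      have h1 := hfg w hw
      have h2 := hfg w' hw'
      have h3 := hg w hw
      have h4 := hg w' hw'
      rw [← h] at h2
      generalize g w = x at h1 h3
      generalize g w' = y at h2 h4
      rcases h1 with ⟨a, b⟩ | ⟨a, b⟩ <;> rcases h2 with ⟨c, d⟩ | ⟨c, d⟩ <;> rw [a] at c <;>
        rw [b] at d
      · exact c
      · rw [c, d] at h3
        omega
      · rw [c, d] at h3
        omega
      · exact d
  have := Finset.card_erase_add_one hv
  omega

/-- The boundary of a line. -/
noncomputable def boundary (G : FeynmanGraph) (l : G.L) : G.V → ℝ :=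
  Pi.single (G.tgt l) 1 - Pi.single (G.src l) 1

theorem sum_mul_boundary (χ : G.V → ℝ) (l : G.L) :
    (∑ v, χ v * G.boundary l v) = χ (G.tgt l) - χ (G.src l) := by
  simp [boundary, mul_sub, Finset.sum_sub_distrib, Pi.single_apply]

/-- The boundaries lie in the hyperplane of the functions of sum zero, whose dimension is less than
the number of vertices. -/
theorem card_add_one_le_of_linearIndepOn {F : Finset G.L}
    (hF : LinearIndepOn ℝ G.boundary (F : Set G.L)) [hV : Nonempty G.V] :
    F.card + 1 ≤ Fintype.card G.V := by
  classical
  let σ : (G.V → ℝ) →ₗ[ℝ] ℝ := ∑ v, LinearMap.proj v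
  have hσ : ∀ f, σ f = ∑ v, f v := fun f => by simp [σ]
  have hspan : Submodule.span ℝ (G.boundary '' (F : Set G.L)) ≤ LinearMap.ker σ := by
    rw [Submodule.span_le]
    rintro _ ⟨l, -, rfl⟩
    have := sum_mul_boundary (fun _ => (1 : ℝ)) l
    simp only [one_mul, sub_self] at this
    simpa [hσ] using this
  have hlt : LinearMap.ker σ < ⊤ := by
    rw [lt_top_iff_ne_top]
    intro h
    obtain ⟨v⟩ := hV
    have : (Pi.single v 1 : G.V → ℝ) ∈ LinearMap.ker σ := h ▸ Submodule.mem_top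
    simp [hσ] at this
  have h1 := Submodule.finrank_lt (hspan.trans_lt hlt).ne
  have h2 := finrank_span_set_eq_card hF.id_image
  have h3 : (G.boundary '' (F : Set G.L)).toFinset.card = F.card := by
    rw [Set.toFinset_image, Finset.toFinset_coe, Finset.card_image_of_injOn hF.injOn]
  rw [h2, h3, Module.finrank_fintype_fun_eq_card] at h1
  omega

/-- Kruskal's algorithm: the lines are examined in decreasing order of index, and one is kept
exactly when its ends are not yet joined. At the time when the lines of index at least j have been
examined, those kept join the ends of all of them. Independence of the boundaries stands for the
absence of cycles. -/
theorem exists_free_lines (μ : G.L → ℕ) (s : Finset G.L) :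
    ∃ F ⊆ s, LinearIndepOn ℝ G.boundary (F : Set G.L) ∧ ∀ (j : ℕ) (l : G.L), l ∈ s → j ≤ μ l →
      (G.skeleton (F ∩ G.above μ j)).Reachable (G.src l) (G.tgt l) := by
  classical
  induction s using Finset.induction_on_min_value (f := μ) with
  | empty => exact ⟨∅, subset_rfl, by simp, by simp⟩
  | insert a s ha hmin ih =>
    obtain ⟨F, hFs, hF, hreach⟩ := ih
    have hfull : ∀ j, j ≤ μ a → F ∩ G.above μ j = F := by
      intro j hj
      rw [Finset.inter_eq_left]
      intro l hl
      simp only [above, Finset.mem_filter, Finset.mem_univ, true_and]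
      exact hj.trans (hmin l (hFs hl))
    by_cases hr : (G.skeleton F).Reachable (G.src a) (G.tgt a)
    · refine ⟨F, hFs.trans (Finset.subset_insert _ _), hF, fun j l hl hj => ?_⟩
      rcases Finset.mem_insert.1 hl with rfl | hl
      · rw [hfull j hj]
        exact hr
      · exact hreach j l hl hj
    · refine ⟨insert a F, Finset.insert_subset_insert _ hFs, ?_, fun j l hl hj => ?_⟩
      · rw [Finset.coe_insert]
        refine hF.insert fun hmem => ?_
        -- The indicator of the component of `src a` vanishes on the boundaries of the lines of `F`,
        -- but not on that of `a`, which leaves the component.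
        let χ : G.V → ℝ := fun v => if (G.skeleton F).Reachable (G.src a) v then 1 else 0
        let L : (G.V → ℝ) →ₗ[ℝ] ℝ := ∑ v, χ v • LinearMap.proj v
        have hL : ∀ f, L f = ∑ v, χ v * f v := fun f => by simp [L]
        have hle : Submodule.span ℝ (G.boundary '' (F : Set G.L)) ≤ LinearMap.ker L := by
          rw [Submodule.span_le]
          rintro _ ⟨l, hl, rfl⟩
          change L (G.boundary l) = 0
          rw [hL, sum_mul_boundary]
          have h' := reachable_of_mem (Finset.mem_coe.1 hl)
          have : (G.skeleton F).Reachable (G.src a) (G.tgt l) ↔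
              (G.skeleton F).Reachable (G.src a) (G.src l) :=
            ⟨fun h => h.trans h'.symm, fun h => h.trans h'⟩
          simp only [χ, this, sub_self]
        have h0 : L (G.boundary a) = 0 := hle hmem
        rw [hL, sum_mul_boundary] at h0
        simp [χ, hr] at h0
      · rcases Finset.mem_insert.1 hl with rfl | hl
        · refine reachable_of_mem (Finset.mem_inter.2 ⟨Finset.mem_insert_self _ _, ?_⟩)
          simpa [above] using hj
        · exact reachable_mono (Finset.inter_subset_inter_right (Finset.subset_insert _ _))
            (hreach j l hl hj)

/-- A connected graph has a spanning tree which spans every component of the lines of index at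
least `j`, for all `j`. -/
theorem exists_adapted_tree (hG : G.IsConnected) (μ : G.L → ℕ) :
    ∃ T : Finset G.L, G.IsSpanningTree T ∧ ∀ (j : ℕ) (v w : G.V),
      (G.skeleton (G.above μ j)).Reachable v w →
        (G.skeleton (T ∩ G.above μ j)).Reachable v w := by
  classical
  obtain ⟨T, -, hT, hreach⟩ := exists_free_lines μ Finset.univ
  have : Nonempty G.V := hG.nonempty
  have hconn : (G.skeleton T).Connected := by
    refine ⟨fun v w => reachable_of_lines (fun l _ => ?_) (hG.preconnected v w)⟩
    exact reachable_mono Finset.inter_subset_left (hreach 0 l (Finset.mem_univ _) (Nat.zero_le _))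
  -- Independence bounds the number of lines from above, connectedness from below.
  refine ⟨T, ⟨hconn, le_antisymm (card_add_one_le_of_linearIndepOn hT) ?_⟩, fun j v w h =>
    reachable_of_lines (fun l hl => hreach j l (Finset.mem_univ _) ?_) h⟩
  · obtain ⟨v⟩ := this
    have := card_component_le T Finset.univ v (fun w => by simp [hconn.preconnected v w])
    simpa using this
  · simpa [above] using hl

end reachability

end FeynmanGraph

theorem Finset.prod_const_zpow {ι : Type*} (s : Finset ι) {M : ℝ} (hM : M ≠ 0) (f : ι → ℤ) :
    ∏ i ∈ s, M ^ f i = M ^ ∑ i ∈ s, f i := by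
  classical
  induction s using Finset.induction_on with
  | empty => simp
  | insert a s ha ih => rw [Finset.prod_insert ha, Finset.sum_insert ha, ih, zpow_add₀ hM]

namespace FeynmanGraph

/-! ## Power counting -/

variable {G : FeynmanGraph}

/-- The power counting exponent of a line. -/
def lineExp (D : ℕ) (T : Finset G.L) (l : G.L) : ℤ := if l ∈ T then -2 else -2 + D

theorem sum_lineExp (D : ℕ) (T P : Finset G.L) :
    ∑ l ∈ P, lineExp D T l = -2 * (P.card : ℤ) + D * ((P.card : ℤ) - ((T ∩ P).card : ℤ)) := by
  have h : ∀ l ∈ P, lineExp D T l = (-2 + D : ℤ) + if l ∈ T then -(D : ℤ) else 0 := by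
    intro l _
    unfold lineExp
    split_ifs <;> ring
  rw [Finset.sum_congr rfl h, Finset.sum_add_distrib, ← Finset.sum_filter, Finset.sum_const,
    Finset.sum_const, Finset.filter_mem_eq_inter, Finset.inter_comm]
  simp only [nsmul_eq_mul]
  ring

/-- The n - 1 lines of the tree give -2 each, the L - n + 1 others D - 2 each; this is the form of
the degree in `omega_eq`. -/
theorem sum_lineExp_univ (hG : G.IsPhi4) (D : ℕ) {T : Finset G.L} (hT : G.IsSpanningTree T) :
    ∑ l, lineExp D T l = -omega D G := by
  rw [sum_lineExp, omega_eq hG, Finset.inter_univ, Finset.card_univ, ← hT.2]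
  push_cast
  ring

theorem mem_above {μ : G.L → ℕ} {j : ℕ} {l : G.L} : l ∈ G.above μ j ↔ j ≤ μ l := by
  simp [above]

-- A line of index at least j belongs to exactly one quasilocal subgraph at scale j, the component
-- of its source. This turns sums over lines into sums over components.
open Classical in
theorem isQuasilocal_and_mem_iff {μ : G.L → ℕ} {j : ℕ} {P : Finset G.L} {S : Finset G.V}
    {l : G.L} : (G.IsQuasilocal μ j P S ∧ l ∈ P) ↔
      (P, S) = ((G.above μ j).filter fun l' => (G.skeleton (G.above μ j)).Reachable (G.src l)
          (G.src l'),
        Finset.univ.filter fun w => (G.skeleton (G.above μ j)).Reachable (G.src l) w) ∧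
      l ∈ G.above μ j := by
  constructor
  · rintro ⟨⟨⟨v, hv⟩, hP, -⟩, hl⟩
    have hlv := (hv _).1 ((hP l).1 hl).2
    refine ⟨Prod.ext ?_ ?_, by simpa [above] using ((hP l).1 hl).1⟩
    · ext l'
      simp only [hP, hv, mem_above, Finset.mem_filter, and_congr_right_iff]
      intro _
      exact ⟨fun h => hlv.symm.trans h, fun h => hlv.trans h⟩
    · ext w
      simp only [hv, Finset.mem_filter, Finset.mem_univ, true_and]
      exact ⟨fun h => hlv.symm.trans h, fun h => hlv.trans h⟩
  · rintro ⟨h, hl⟩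
    obtain ⟨rfl, rfl⟩ := Prod.mk.inj h
    have hl' : l ∈ (G.above μ j).filter fun l' => (G.skeleton (G.above μ j)).Reachable (G.src l)
          (G.src l') := Finset.mem_filter.2 ⟨hl, SimpleGraph.Reachable.refl _⟩
    refine ⟨⟨⟨G.src l, fun w => by simp⟩, fun l' => ?_, Or.inl ⟨l, hl'⟩⟩, hl'⟩
    simp [mem_above]

open Classical in
/-- The power counting of the lines of index at least `j` is bounded by that of the quasilocal
subgraphs at scale `j`, when the tree is adapted to this scale. -/
theorem sum_lineExp_above_le (hG : G.IsPhi4) (D : ℕ) (μ : G.L → ℕ) {j : ℕ} (hj : j ≠ 0)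
    {T : Finset G.L}
    (hT : ∀ v w : G.V, (G.skeleton (G.above μ j)).Reachable v w →
        (G.skeleton (T ∩ G.above μ j)).Reachable v w) :
    ∑ l ∈ G.above μ j, lineExp D T l ≤
      ∑ PS ∈ (Finset.univ : Finset (Finset G.L × Finset G.V)).filter
        (fun PS => G.IsQuasilocal μ j PS.1 PS.2), -omega D (G.sub PS.1 PS.2) := by
  have h1 : ∑ l ∈ G.above μ j, lineExp D T l =
      ∑ PS ∈ (Finset.univ : Finset (Finset G.L × Finset G.V)).filter
        (fun PS => G.IsQuasilocal μ j PS.1 PS.2), ∑ l ∈ PS.1, lineExp D T l := by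
    rw [Finset.sum_comm' (t' := G.above μ j) (s' := fun l =>
      {((G.above μ j).filter fun l' => (G.skeleton (G.above μ j)).Reachable (G.src l) (G.src l'),
        Finset.univ.filter fun w => (G.skeleton (G.above μ j)).Reachable (G.src l) w)})]
    · simp
    · rintro ⟨P, S⟩ l
      rw [Finset.mem_singleton, ← isQuasilocal_and_mem_iff]
      simp
  rw [h1]
  refine Finset.sum_le_sum fun PS hPS => ?_
  obtain ⟨P, S⟩ := PS
  obtain ⟨⟨v, hv⟩, hP, -⟩ := (Finset.mem_filter.1 hPS).2
  simp only at hv hP ⊢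
  have hends : ∀ l ∈ P, G.src l ∈ S ∧ G.tgt l ∈ S := by
    intro l hl
    obtain ⟨h, h'⟩ := (hP l).1 hl
    refine ⟨h', (hv _).2 (((hv _).1 h').trans (reachable_of_mem ?_))⟩
    simpa [above] using h
  rw [sum_lineExp, omega_eq (isPhi4_sub hG P S), card_sub_V, card_sub_L P S hends]
  -- The lines of the adapted tree connect the component, so at least |S| - 1 of them lie in it and
  -- at most as many lines as there are loops carry the exponent D.
  have hcard := card_component_le (T ∩ G.above μ j) S v (fun w => ⟨fun h => hT _ _ ((hv w).1 h),
    fun h => (hv w).2 (reachable_mono Finset.inter_subset_right h)⟩)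
  have hfil : ((T ∩ G.above μ j).filter fun l => G.src l ∈ S) = T ∩ P := by
    ext l
    simp only [Finset.mem_filter, Finset.mem_inter, hP, above, Finset.mem_univ, true_and]
    tauto
  rw [hfil] at hcard
  have hc : (S.card : ℤ) ≤ (T ∩ P).card + 1 := by exact_mod_cast hcard
  have hD : (0 : ℤ) ≤ D := Int.natCast_nonneg D
  nlinarith

/-- The difference μ(l) - i₀ counts the scales in (i₀, μ(l)], so the total exponent is -ω i₀ plus a
sum over scales of the power counting of the lines above each of them. With i₀ the lowest index, the
gain M^(-i₀(1-ω)) of the Taylor remainder cancels the first term and leaves M^(-i₀), which is at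
most M^(-i). -/
theorem prod_lineExp_le_innerFactor (hG : G.IsPhi4) {D : ℕ} {M : ℝ} (hM : 1 < M)
    (μ : G.L → ℕ) {T : Finset G.L} (hT : G.IsSpanningTree T)
    (hT' : ∀ (j : ℕ) (v w : G.V), (G.skeleton (G.above μ j)).Reachable v w →
        (G.skeleton (T ∩ G.above μ j)).Reachable v w) {i : ℕ} (hi : ∀ l, i ≤ μ l) :
    ∃ i₀ : ℕ, i ≤ i₀ ∧ (∀ l, i₀ ≤ μ l) ∧
      M ^ (-(i₀ : ℤ) * (1 - omega D G)) * ∏ l, M ^ (lineExp D T l * μ l) ≤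
        M ^ (-(i : ℤ)) * innerFactor D M G μ := by
  classical
  have hM0 : M ≠ 0 := by positivity
  -- Without lines the sum of the exponents is empty, which forces ω = 0; both sides are then
  -- M^(-i).
  rcases isEmpty_or_nonempty G.L with hL | hL
  · refine ⟨i, le_rfl, hi, ?_⟩
    have h0 := sum_lineExp_univ hG D hT
    simp only [Finset.univ_eq_empty, Finset.sum_empty] at h0
    have h1 : innerFactor D M G μ = 1 := by
      rw [innerFactor]
      rw [Finset.filter_eq_empty_iff.2]
      · simp
      · intro j _
        simp [Finset.eq_empty_of_isEmpty]
    rw [h1, neg_eq_zero.1 h0.symm]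
    simp
  · obtain ⟨l₀, -, hl₀⟩ := Finset.exists_min_image Finset.univ μ Finset.univ_nonempty
    refine ⟨μ l₀, hi l₀, fun l => hl₀ l (Finset.mem_univ l), ?_⟩
    set i₀ := μ l₀ with hi₀
    -- Some line has dropped out exactly at the scales strictly above the lowest index.
    have hfilt : (Finset.range (Finset.univ.sup μ + 1)).filter
        (fun j => G.above μ j ≠ Finset.univ) = Finset.Ioc i₀ (Finset.univ.sup μ) := by
      ext j
      simp only [Finset.mem_filter, Finset.mem_range, Finset.mem_Ioc, Nat.lt_succ_iff, above,
        ne_eq, Finset.filter_eq_self, Finset.mem_univ, true_imp_iff, not_forall, not_le]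
      constructor
      · rintro ⟨h1, l, hl⟩
        exact ⟨(hl₀ l (Finset.mem_univ l)).trans_lt hl, h1⟩
      · rintro ⟨h1, h2⟩
        exact ⟨h2, l₀, h1⟩
    have hsum : ∑ l, lineExp D T l * ((μ l : ℤ) - i₀) =
        ∑ j ∈ Finset.Ioc i₀ (Finset.univ.sup μ), ∑ l ∈ G.above μ j, lineExp D T l := by
      simp only [above, Finset.sum_filter]
      rw [Finset.sum_comm]
      refine Finset.sum_congr rfl fun l _ => ?_
      rw [← Finset.sum_filter, Finset.sum_const, nsmul_eq_mul, mul_comm]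
      congr 1
      have : (Finset.Ioc i₀ (Finset.univ.sup μ)).filter (fun j => j ≤ μ l) =
          Finset.Ioc i₀ (μ l) := by
        ext j
        have := Finset.le_sup (f := μ) (Finset.mem_univ l)
        simp only [Finset.mem_filter, Finset.mem_Ioc]
        omega
      rw [this, Nat.card_Ioc, Nat.cast_sub (hl₀ l (Finset.mem_univ l))]
    have hinner : M ^ (∑ l, lineExp D T l * ((μ l : ℤ) - i₀)) ≤ innerFactor D M G μ := by
      rw [innerFactor, hfilt, hsum, ← Finset.prod_const_zpow _ hM0]
      refine Finset.prod_le_prod (fun j _ => by positivity) fun j hj => ?_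
      rw [Finset.prod_const_zpow _ hM0]
      refine zpow_le_zpow_right₀ hM.le ?_
      have h := sum_lineExp_above_le hG D μ (j := j) (by
        have := (Finset.mem_Ioc.1 hj).1
        omega) (hT' j)
      convert h
    rw [Finset.prod_const_zpow _ hM0, ← zpow_add₀ hM0]
    have e : -(i₀ : ℤ) * (1 - omega D G) + ∑ l, lineExp D T l * (μ l : ℤ) =
        -(i₀ : ℤ) + ∑ l, lineExp D T l * ((μ l : ℤ) - i₀) := by
      simp only [mul_sub, Finset.sum_sub_distrib, ← Finset.sum_mul, sum_lineExp_univ hG D hT]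
      ring
    rw [e, zpow_add₀ hM0]
    refine mul_le_mul (zpow_le_zpow_right₀ hM.le ?_) hinner (by positivity) (by positivity)
    have := hi l₀
    omega

theorem IsQuasilocal.le_index {μ : G.L → ℕ} {i : ℕ} {P : Finset G.L} {S : Finset G.V}
    (h : G.IsQuasilocal μ i P S) (l : (G.sub P S).L) : i ≤ μ l.1 :=
  ((h.2.1 l.1).1 l.2.1).1

/-- Arithmetic in each dimension, from 2L + N = 4n, L ≥ n - 1 and N > 0. In dimension 0 the degree
is 2L, so that ω ≤ 0 excludes lines; this is where the proviso on D comes from. The value -2 occurs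
for D = 4 only. -/
theorem external_cases (hG : G.IsPhi4) {D : ℕ} (hD : D ≤ 4) {T : Finset G.L}
    (hT : G.IsSpanningTree T) (hX : Nonempty G.X) (hω : omega D G ≤ 0) :
    (Fintype.card G.X = 4 ∧ omega D G = 0 ∧ (Nonempty G.L → 1 ≤ D)) ∨
    (Fintype.card G.X = 2 ∧ 1 ≤ D ∧ (omega D G = 0 ∨ omega D G = -1 ∨ omega D G = -2)) := by
  have h1 := card_halfLines hG
  have h2 := hT.2
  have h3 := Finset.card_le_univ T
  have h4 : 0 < Fintype.card G.X := Fintype.card_pos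
  have h5 : 0 < Fintype.card G.V := by omega
  rw [omega_eq hG] at hω ⊢
  have h6 : Nonempty G.L → 0 < Fintype.card G.L := fun h => Fintype.card_pos
  interval_cases D <;> first
    | (right; omega)
    | (left; refine ⟨by omega, by omega, fun h => ?_⟩; have := h6 h; omega)
    | (by_cases hx : Fintype.card G.X = 4
       · left
         exact ⟨hx, by omega, fun h => by omega⟩
       · right
         omega)

end FeynmanGraph

namespace FeynmanGraph

/-! ## Linearity of the momentum routing -/

section routing

variable {D : ℕ} {G : FeynmanGraph}

theorem route_eq (e₀ : G.X) {T : Finset G.L} (hT : G.IsSpanningTree T)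
    {k : {e : G.X // e ≠ e₀} → EuclideanSpace ℝ (Fin D)} {u q : G.L → EuclideanSpace ℝ (Fin D)}
    {w : {l : G.L // l ∉ T} → EuclideanSpace ℝ (Fin D)}
    (hw : ∀ l : {l : G.L // l ∉ T}, q l.1 = w l)
    (hq : ∀ v, v ≠ G.leg e₀ → G.Conserves e₀ k u q v) : G.route e₀ T k u w = q :=
  (existsUnique_route G e₀ T hT k u w).unique (route_spec G e₀ T hT k u w) ⟨hw, hq⟩

theorem route_apply_notMem (e₀ : G.X) {T : Finset G.L} (hT : G.IsSpanningTree T)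
    (k : {e : G.X // e ≠ e₀} → EuclideanSpace ℝ (Fin D)) (u : G.L → EuclideanSpace ℝ (Fin D))
    (w : {l : G.L // l ∉ T} → EuclideanSpace ℝ (Fin D)) (l : {l : G.L // l ∉ T}) :
    G.route e₀ T k u w l.1 = w l :=
  (route_spec G e₀ T hT k u w).1 l

theorem route_add (e₀ : G.X) {T : Finset G.L} (hT : G.IsSpanningTree T)
    (k k' : {e : G.X // e ≠ e₀} → EuclideanSpace ℝ (Fin D))
    (u u' : G.L → EuclideanSpace ℝ (Fin D))
    (w w' : {l : G.L // l ∉ T} → EuclideanSpace ℝ (Fin D)) :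
    G.route e₀ T (k + k') (u + u') (w + w') = G.route e₀ T k u w + G.route e₀ T k' u' w' := by
  have h := route_spec G e₀ T hT k u w
  have h' := route_spec G e₀ T hT k' u' w'
  refine route_eq e₀ hT (fun l => by simp [h.1, h'.1]) fun v hv => ?_
  have h1 := h.2 v hv
  have h2 := h'.2 v hv
  simp only [Conserves, Pi.add_apply, Finset.sum_add_distrib, Finset.sum_sub_distrib] at h1 h2 ⊢
  rw [h1, h2]
  abel

theorem route_comp (e₀ : G.X) {T : Finset G.L} (hT : G.IsSpanningTree T)
    (R : EuclideanSpace ℝ (Fin D) →ₗ[ℝ] EuclideanSpace ℝ (Fin D))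
    (k : {e : G.X // e ≠ e₀} → EuclideanSpace ℝ (Fin D))
    (u : G.L → EuclideanSpace ℝ (Fin D)) (w : {l : G.L // l ∉ T} → EuclideanSpace ℝ (Fin D)) :
    (G.route e₀ T (fun e => R (k e)) (fun l => R (u l)) fun l => R (w l)) =
      fun l => R (G.route e₀ T k u w l) := by
  have h := route_spec G e₀ T hT k u w
  refine route_eq e₀ hT (fun l => by rw [h.1]) fun v hv => ?_
  have h1 := congrArg R (h.2 v hv)
  simpa only [Conserves, map_add, map_sum, map_sub] using h1

theorem route_smul (e₀ : G.X) {T : Finset G.L} (hT : G.IsSpanningTree T) (c : ℝ)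
    (k : {e : G.X // e ≠ e₀} → EuclideanSpace ℝ (Fin D))
    (u : G.L → EuclideanSpace ℝ (Fin D)) (w : {l : G.L // l ∉ T} → EuclideanSpace ℝ (Fin D)) :
    G.route e₀ T (c • k) (c • u) (c • w) = c • G.route e₀ T k u w :=
  route_comp e₀ hT (c • LinearMap.id) k u w

/-- The routing as a linear map. -/
noncomputable def routeLin (D : ℕ) (e₀ : G.X) {T : Finset G.L} (hT : G.IsSpanningTree T) :
    (({e : G.X // e ≠ e₀} → EuclideanSpace ℝ (Fin D)) × (G.L → EuclideanSpace ℝ (Fin D)) ×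
      ({l : G.L // l ∉ T} → EuclideanSpace ℝ (Fin D))) →ₗ[ℝ] (G.L → EuclideanSpace ℝ (Fin D)) where
  toFun z := G.route e₀ T z.1 z.2.1 z.2.2
  map_add' _ _ := route_add e₀ hT _ _ _ _ _ _
  map_smul' _ _ := route_smul e₀ hT _ _ _ _

theorem route_eq_add (e₀ : G.X) {T : Finset G.L} (hT : G.IsSpanningTree T)
    (k : {e : G.X // e ≠ e₀} → EuclideanSpace ℝ (Fin D))
    (u : G.L → EuclideanSpace ℝ (Fin D)) (w : {l : G.L // l ∉ T} → EuclideanSpace ℝ (Fin D)) :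
    G.route e₀ T k u w = G.route e₀ T k 0 0 + G.route e₀ T 0 u w := by
  rw [← route_add e₀ hT]
  simp

@[fun_prop]
theorem continuous_route (e₀ : G.X) {T : Finset G.L} (hT : G.IsSpanningTree T) :
    Continuous fun z : ({e : G.X // e ≠ e₀} → EuclideanSpace ℝ (Fin D)) ×
      (G.L → EuclideanSpace ℝ (Fin D)) × ({l : G.L // l ∉ T} → EuclideanSpace ℝ (Fin D)) =>
      G.route e₀ T z.1 z.2.1 z.2.2 :=
  (routeLin D e₀ hT).continuous_of_finiteDimensional

theorem exists_route_bound (D : ℕ) (e₀ : G.X) {T : Finset G.L} (hT : G.IsSpanningTree T) :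
    ∃ C : ℝ, 0 ≤ C ∧ ∀ (k : {e : G.X // e ≠ e₀} → EuclideanSpace ℝ (Fin D))
      (u : G.L → EuclideanSpace ℝ (Fin D)) (w : {l : G.L // l ∉ T} → EuclideanSpace ℝ (Fin D))
      (l : G.L), ‖G.route e₀ T k u w l‖ ≤ C * (‖k‖ + ‖u‖ + ‖w‖) := by
  obtain ⟨C, hC, h⟩ := (LinearMap.toContinuousLinearMap (routeLin D e₀ hT)).bound
  refine ⟨C, hC.le, fun k u w l => ?_⟩
  refine (norm_le_pi_norm _ l).trans ((h (k, u, w)).trans ?_)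
  refine mul_le_mul_of_nonneg_left ?_ hC.le
  simp only [Prod.norm_def]
  have := norm_nonneg k
  have := norm_nonneg u
  have := norm_nonneg w
  exact max_le (by linarith) (max_le (by linarith) (by linarith))

/-- Momentum conservation does not refer to the tree. A solution found with one tree is therefore
the solution for the other one, with the prescribed values read off from it. -/
theorem conserves_congr (e₀ : G.X) {T T' : Finset G.L} (hT : G.IsSpanningTree T)
    (hT' : G.IsSpanningTree T') (k : {e : G.X // e ≠ e₀} → EuclideanSpace ℝ (Fin D))
    (u : G.L → EuclideanSpace ℝ (Fin D)) (w : {l : G.L // l ∉ T} → EuclideanSpace ℝ (Fin D)) :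
    G.route e₀ T' k u (fun l => G.route e₀ T k u w l.1) = G.route e₀ T k u w :=
  route_eq e₀ hT' (fun _ => rfl) (route_spec G e₀ T hT k u w).2

/-- A change of spanning tree is a linear change of integration variables. -/
theorem exists_tree_change (D : ℕ) (e₀ : G.X) {T T' : Finset G.L} (hT : G.IsSpanningTree T)
    (hT' : G.IsSpanningTree T') :
    ∃ J : ℝ, 0 < J ∧ ∀ (k : {e : G.X // e ≠ e₀} → EuclideanSpace ℝ (Fin D))
      (u : G.L → EuclideanSpace ℝ (Fin D)) (f : (G.L → EuclideanSpace ℝ (Fin D)) → ℝ),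
      (Integrable (fun w => f (G.route e₀ T' k u w)) → Integrable fun w => f (G.route e₀ T k u w)) ∧
      ∫ w, f (G.route e₀ T k u w) = J * ∫ w, f (G.route e₀ T' k u w) := by
  -- The loop momenta of `T'` as linear functions of those of `T`; the inverse is the same
  -- construction with the trees exchanged.
  let A : ({l : G.L // l ∉ T} → EuclideanSpace ℝ (Fin D)) ≃ₗ[ℝ]
      ({l : G.L // l ∉ T'} → EuclideanSpace ℝ (Fin D)) :=
    { toFun := fun w l => G.route e₀ T 0 0 w l.1
      map_add' := fun w w' => by
        have := route_add e₀ hT 0 0 0 0 w w'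
        simp only [add_zero] at this
        funext l
        exact congrFun this l.1
      map_smul' := fun c w => by
        have := route_smul e₀ hT c 0 0 w
        simp only [smul_zero] at this
        funext l
        exact congrFun this l.1
      invFun := fun w l => G.route e₀ T' 0 0 w l.1
      left_inv := fun w => by
        funext l
        simp only [conserves_congr e₀ hT hT', route_apply_notMem e₀ hT]
      right_inv := fun w => by
        funext l
        simp only [conserves_congr e₀ hT' hT, route_apply_notMem e₀ hT'] }
  let A' := A.toContinuousLinearEquiv
  -- The image of Lebesgue measure under a linear isomorphism is a Haar measure, hence proportional
  -- to Lebesgue measure. The factor is independent of `k` and `u`, which only translate the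
  -- variables.
  let ν := Measure.map A' (volume : Measure ({l : G.L // l ∉ T} → EuclideanSpace ℝ (Fin D)))
  have hν : ν.IsAddHaarMeasure := A'.isAddHaarMeasure_map _
  have hc : ν = _ := Measure.isAddLeftInvariant_eq_smul ν volume
  have hc0 := Measure.addHaarScalarFactor_pos_of_isAddHaarMeasure ν volume
  set c := Measure.addHaarScalarFactor ν volume
  have hemb : MeasurableEmbedding A' := A'.toHomeomorph.measurableEmbedding
  have key : ∀ (k : {e : G.X // e ≠ e₀} → EuclideanSpace ℝ (Fin D))
      (u : G.L → EuclideanSpace ℝ (Fin D)) (f : (G.L → EuclideanSpace ℝ (Fin D)) → ℝ),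
      (fun w => f (G.route e₀ T k u w)) = fun w =>
        (fun y => f (G.route e₀ T' k u (y + fun l => G.route e₀ T k u 0 l.1))) (A' w) := by
    intro k u f
    funext w
    congr 1
    rw [← conserves_congr e₀ hT hT' k u w]
    congr 1
    have := route_add e₀ hT 0 k 0 u w 0
    simp only [add_zero, zero_add] at this
    rw [this]
    rfl
  refine ⟨c, hc0, fun k u f => ⟨fun h => ?_, ?_⟩⟩
  · rw [key k u f]
    refine (hemb.integrable_map_iff (g := fun y => f (G.route e₀ T' k u
      (y + fun l => G.route e₀ T k u 0 l.1)))).1 ?_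
    change Integrable _ ν
    rw [hc]
    exact (h.comp_add_right _).smul_measure_nnreal
  · rw [key k u f]
    refine (hemb.integral_map (fun y => f (G.route e₀ T' k u
      (y + fun l => G.route e₀ T k u 0 l.1)))).symm.trans ?_
    change ∫ y, _ ∂ν = _
    rw [hc, integral_smul_nnreal_measure,
      integral_add_right_eq_self (fun y => f (G.route e₀ T' k u y))]
    rfl

/-- This makes it possible to choose the tree after the attribution: the factor J depends on neither
the attribution, nor the field, nor the scaling parameter. -/
theorem reducedAmp_tree_change (e₀ : G.X) {T T' : Finset G.L} (hT : G.IsSpanningTree T)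
    (hT' : G.IsSpanningTree T') :
    ∃ J : ℝ, 0 < J ∧ ∀ (Ω m M : ℝ) (μ : G.L → ℕ),
      (G.AmpWellDefined D Ω m M μ e₀ T' → G.AmpWellDefined D Ω m M μ e₀ T) ∧
      ∀ φ : 𝓢(EuclideanSpace ℝ (Fin D), ℝ),
        scaledAmp Ω m M G μ e₀ T φ = fun t => (J : ℂ) * scaledAmp Ω m M G μ e₀ T' φ t := by
  obtain ⟨J, hJ, h⟩ := exists_tree_change D e₀ hT hT'
  have hred : ∀ (Ω m M : ℝ) (μ : G.L → ℕ) (k : {e : G.X // e ≠ e₀} → EuclideanSpace ℝ (Fin D)) u,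
      reducedAmp Ω m M G μ e₀ T k u = J * reducedAmp Ω m M G μ e₀ T' k u := fun Ω m M μ k u =>
    (h k u fun q => ∏ l, propSlice Ω m M (μ l) (u l - q l) (q l)).2
  have hsc : ∀ (Ω m M : ℝ) (μ : G.L → ℕ) (φ : 𝓢(EuclideanSpace ℝ (Fin D), ℝ)) (t : ℝ),
      scaledIntegrand Ω m M G μ e₀ T φ t =
        fun z => (J : ℂ) * scaledIntegrand Ω m M G μ e₀ T' φ t z := by
    intro Ω m M μ φ t
    funext z
    simp only [scaledIntegrand, hred]
    push_cast
    ring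
  have hamp : ∀ (Ω m M : ℝ) (μ : G.L → ℕ) (φ : 𝓢(EuclideanSpace ℝ (Fin D), ℝ)),
        scaledAmp Ω m M G μ e₀ T φ = fun t => (J : ℂ) * scaledAmp Ω m M G μ e₀ T' φ t := by
    intro Ω m M μ φ
    funext t
    simp only [scaledAmp, hsc, integral_const_mul]
  refine ⟨J, hJ, fun Ω m M μ => ⟨fun hW => ⟨hW.1, fun k u => ?_, fun φ t => ?_, fun φ => ?_⟩,
    hamp Ω m M μ⟩⟩
  · exact (h k u fun q => ∏ l, propSlice Ω m M (μ l) (u l - q l) (q l)).1 (hW.2.1 k u)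
  · rw [hsc]
    exact (hW.2.2.1 φ t).const_mul _
  · rw [hamp]
    exact contDiff_const.mul (hW.2.2.2 φ)

/-- The scaled amplitude is an even function. -/
theorem scaledAmp_neg (e₀ : G.X) {T : Finset G.L} (hT : G.IsSpanningTree T) (Ω m M : ℝ)
    (μ : G.L → ℕ) (φ : 𝓢(EuclideanSpace ℝ (Fin D), ℝ)) (t : ℝ) :
    scaledAmp Ω m M G μ e₀ T φ (-t) = scaledAmp Ω m M G μ e₀ T φ t := by
  have hker : ∀ (s : ℝ) (p q : EuclideanSpace ℝ (Fin D)),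
      propKernel Ω m s (-p) (-q) = propKernel Ω m s p q := by
    intro s p q
    have h1 : ‖-p + -q‖ = ‖p + q‖ := by rw [← neg_add, norm_neg]
    have h2 : ‖-p - -q‖ = ‖p - q‖ := by rw [← neg_sub', norm_neg]
    simp only [propKernel, h1, h2]
  have hprod : ∀ (k : {e : G.X // e ≠ e₀} → EuclideanSpace ℝ (Fin D))
      (u : G.L → EuclideanSpace ℝ (Fin D)) (w : {l : G.L // l ∉ T} → EuclideanSpace ℝ (Fin D)),
      lineProduct Ω m M G μ e₀ T (-k) (-u) (-w) = lineProduct Ω m M G μ e₀ T k u w := by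
    intro k u w
    have := route_smul e₀ hT (-1) k u w
    simp only [neg_smul, one_smul] at this
    simp only [lineProduct, this, propSlice, Pi.neg_apply, ← neg_sub', hker]
  have hred : ∀ (k : {e : G.X // e ≠ e₀} → EuclideanSpace ℝ (Fin D))
      (u : G.L → EuclideanSpace ℝ (Fin D)),
      reducedAmp Ω m M G μ e₀ T (-k) (-u) = reducedAmp Ω m M G μ e₀ T k u := by
    intro k u
    have : (volume : Measure ({l : G.L // l ∉ T} → EuclideanSpace ℝ (Fin D))).IsNegInvariant :=
      Measure.pi.isNegInvariant _
    rw [reducedAmp, ← integral_neg_eq_self]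
    simp only [hprod, reducedAmp]
  have : (volume : Measure (G.L → EuclideanSpace ℝ (Fin D))).IsNegInvariant :=
    Measure.pi.isNegInvariant _
  -- Only `u` is reflected: this changes the sign of the total t ∑ u, and the joint parity `hred` of
  -- the reduced amplitude takes care of t k.
  have hmp : MeasurePreserving (fun z : ({e : G.X // e ≠ e₀} → EuclideanSpace ℝ (Fin D)) ×
      (G.L → EuclideanSpace ℝ (Fin D)) => (z.1, -z.2)) volume volume :=
    (MeasurePreserving.id volume).prod (Measure.measurePreserving_neg volume)
  have hemb : MeasurableEmbedding (fun z : ({e : G.X // e ≠ e₀} → EuclideanSpace ℝ (Fin D)) ×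
      (G.L → EuclideanSpace ℝ (Fin D)) => (z.1, -z.2)) :=
    ((Homeomorph.refl _).prodCongr (Homeomorph.neg _)).measurableEmbedding
  rw [scaledAmp, ← hmp.integral_comp hemb, scaledAmp]
  congr 1
  funext z
  simp only [scaledIntegrand]
  rw [← hred (-t • z.1) (-z.2)]
  simp

end routing

end FeynmanGraph

/-! ## Bounds on the slices of the propagator -/

theorem Real.sinh_le_mul_cosh {x : ℝ} (hx : 0 ≤ x) : Real.sinh x ≤ x * Real.cosh x := by
  have hmono : MonotoneOn (fun y => y * Real.cosh y - Real.sinh y) (Set.Ici 0) := by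
    refine monotoneOn_of_deriv_nonneg (convex_Ici 0) (by fun_prop) (by fun_prop) fun y hy => ?_
    rw [interior_Ici] at hy
    have h : HasDerivAt (fun y => y * Real.cosh y - Real.sinh y)
        (1 * Real.cosh y + y * Real.sinh y - Real.cosh y) y :=
      ((hasDerivAt_id y).mul (Real.hasDerivAt_cosh y)).sub (Real.hasDerivAt_sinh y)
    rw [h.deriv]
    have := mul_nonneg hy.le (Real.sinh_nonneg_iff.2 hy.le)
    linarith
  have := hmono (Set.self_mem_Ici) hx hx
  simp only [zero_mul, Real.sinh_zero, sub_zero] at this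
  linarith

/-- The factor of the propagator which does not depend on the momenta. -/
noncomputable def propFactor (D : ℕ) (Ω m t : ℝ) : ℝ :=
  Real.exp (-m ^ 2 * t) / Real.sinh (2 * Ω * t) ^ ((D : ℝ) / 2)

/-- The coefficient of `‖p + q‖ ^ 2` in the propagator. -/
noncomputable def propShort (Ω t : ℝ) : ℝ :=
  (1 / (4 * Ω)) * (Real.cosh (Ω * t) / Real.sinh (Ω * t))

/-- The coefficient of `‖p - q‖ ^ 2` in the propagator. -/
noncomputable def propLong (Ω t : ℝ) : ℝ :=
  (1 / (4 * Ω)) * Real.tanh (Ω * t)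

theorem propKernel_eq {D : ℕ} (Ω m t : ℝ) (p q : EuclideanSpace ℝ (Fin D)) :
    propKernel Ω m t p q = propFactor D Ω m t *
      Real.exp (-(propShort Ω t * ‖p + q‖ ^ 2) - propLong Ω t * ‖p - q‖ ^ 2) := by
  unfold propKernel propFactor propShort propLong
  congr 2
  ring

theorem measurableSet_sliceSet (M : ℝ) (i : ℕ) : MeasurableSet (sliceSet M i) := by
  cases i
  exacts [measurableSet_Ioi, measurableSet_Ioc]

theorem measurable_propFactor (D : ℕ) (Ω m : ℝ) : Measurable (propFactor D Ω m) := by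
  unfold propFactor
  fun_prop

theorem measurable_propShort (Ω : ℝ) : Measurable (propShort Ω) := by
  unfold propShort
  fun_prop

theorem measurable_propLong (Ω : ℝ) : Measurable (propLong Ω) := by
  unfold propLong
  simp_rw [Real.tanh_eq_sinh_div_cosh]
  fun_prop

theorem sliceSet_succ {M : ℝ} (hM : 1 < M) (i : ℕ) :
    sliceSet M (i + 1) = Set.Ioc (((M ^ (i + 1)) ^ 2)⁻¹) (M ^ 2 * ((M ^ (i + 1)) ^ 2)⁻¹) := by
  have hM0 : M ≠ 0 := by positivity
  have h1 : M ^ (-2 * ((i : ℤ) + 1)) = ((M ^ (i + 1)) ^ 2)⁻¹ := by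
    rw [show -2 * ((i : ℤ) + 1) = -(((i + 1) * 2 : ℕ) : ℤ) by push_cast; ring, zpow_neg,
      zpow_natCast, pow_mul]
  have h2 : M ^ (-2 * (i : ℤ)) = M ^ 2 * ((M ^ (i + 1)) ^ 2)⁻¹ := by
    rw [← h1, ← zpow_natCast, ← zpow_add₀ hM0]
    congr 1
    push_cast
    ring
  rw [sliceSet, h1, h2]

theorem sliceSet_succ_subset {M : ℝ} (hM : 1 < M) (i : ℕ) :
    sliceSet M (i + 1) ⊆ Set.Ioc 0 1 := by
  intro t ht
  rw [sliceSet_succ hM] at ht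
  have hM0 : 0 < M := by positivity
  refine ⟨lt_trans (by positivity) ht.1, ht.2.trans ?_⟩
  rw [← div_eq_mul_inv, div_le_one (by positivity), pow_succ M i, mul_pow]
  have : 1 ≤ (M ^ i) ^ 2 := one_le_pow₀ (one_le_pow₀ hM.le)
  nlinarith [sq_nonneg M]

theorem sliceSet_pos {M : ℝ} (hM : 1 < M) {i : ℕ} {t : ℝ} (ht : t ∈ sliceSet M i) : 0 < t := by
  cases i with
  | zero => exact lt_trans one_pos ht
  | succ i => exact (sliceSet_succ_subset hM i ht).1

theorem propFactor_pos (D : ℕ) {Ω : ℝ} (m : ℝ) {t : ℝ} (hΩ : 0 < Ω) (ht : 0 < t) :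
    0 < propFactor D Ω m t :=
  div_pos (Real.exp_pos _) (Real.rpow_pos_of_pos (Real.sinh_pos_iff.2 (by positivity)) _)

theorem propShort_nonneg {Ω t : ℝ} (hΩ : 0 < Ω) (ht : 0 < t) : 0 ≤ propShort Ω t :=
  mul_nonneg (by positivity)
    (div_nonneg (Real.cosh_pos _).le (Real.sinh_nonneg_iff.2 (by positivity)))

theorem propLong_nonneg {Ω t : ℝ} (hΩ : 0 < Ω) (ht : 0 < t) : 0 ≤ propLong Ω t := by
  rw [propLong, Real.tanh_eq_sinh_div_cosh]
  exact mul_nonneg (by positivity)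
    (div_nonneg (Real.sinh_nonneg_iff.2 (by positivity)) (Real.cosh_pos _).le)

/-- In the slice of scale `i`, with `Λ = M ^ i`, the two coefficients are of order `Λ ^ 2` and
`Λ ^ (-2)`. -/
theorem exists_coefficient_bounds {Ω M : ℝ} (hΩ : 0 < Ω) (hM : 1 < M) :
    ∃ c C : ℝ, 0 < c ∧ 0 < C ∧ ∀ (i : ℕ) (t : ℝ), t ∈ sliceSet M i →
      c * (M ^ i) ^ 2 ≤ propShort Ω t ∧ propShort Ω t ≤ C * (M ^ i) ^ 2 ∧
      c * ((M ^ i) ^ 2)⁻¹ ≤ propLong Ω t ∧ propLong Ω t ≤ C * ((M ^ i) ^ 2)⁻¹ := by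
  have hM0 : 0 < M := by positivity
  -- On the unbounded slice Ωt > Ω, and cosh ≤ sinh + 1 together with sinh(Ωt) ≥ Ω keeps coth and
  -- tanh between (1 + 1/Ω)⁻¹ and 1 + 1/Ω.
  obtain ⟨c₀, C₀, hc₀, hC₀, h₀⟩ : ∃ c C : ℝ, 0 < c ∧ 0 < C ∧ ∀ (t : ℝ), 1 < t →
      c ≤ propShort Ω t ∧ propShort Ω t ≤ C ∧ c ≤ propLong Ω t ∧ propLong Ω t ≤ C := by
    refine ⟨1 / (4 * Ω) * (1 + 1 / Ω)⁻¹, 1 / (4 * Ω) * (1 + 1 / Ω), by positivity, by positivity,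
      fun t ht => ?_⟩
    have hx : Ω ≤ Ω * t := by nlinarith
    have hs : Ω ≤ Real.sinh (Ω * t) := hx.trans (Real.self_le_sinh_iff.2 (by nlinarith))
    have hs0 : 0 < Real.sinh (Ω * t) := hΩ.trans_le hs
    have hc : Real.cosh (Ω * t) ≤ Real.sinh (Ω * t) + 1 := by
      have h1 := Real.cosh_sub_sinh (Ω * t)
      have h2 : Real.exp (-(Ω * t)) ≤ 1 := Real.exp_le_one_iff.2 (by nlinarith)
      linarith
    have hsc : Real.sinh (Ω * t) ≤ Real.cosh (Ω * t) := (Real.sinh_lt_cosh _).le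
    have hcoth : Real.cosh (Ω * t) / Real.sinh (Ω * t) ≤ 1 + 1 / Ω := by
      rw [div_le_iff₀ hs0]
      have : 1 ≤ 1 / Ω * Real.sinh (Ω * t) := by
        rw [one_div, ← div_eq_inv_mul, one_le_div hΩ]
        exact hs
      nlinarith
    have h1 : (1 + 1 / Ω)⁻¹ ≤ 1 := inv_le_one_of_one_le₀ (by
      have : 0 < 1 / Ω := by positivity
      linarith)
    have h1' : 1 ≤ 1 + 1 / Ω := by
      have : 0 < 1 / Ω := by positivity
      linarith
    refine ⟨?_, ?_, ?_, ?_⟩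
    · refine mul_le_mul_of_nonneg_left (h1.trans ?_) (by positivity)
      rw [one_le_div hs0]
      exact hsc
    · exact mul_le_mul_of_nonneg_left hcoth (by positivity)
    · refine mul_le_mul_of_nonneg_left ?_ (by positivity)
      rw [Real.tanh_eq_sinh_div_cosh, ← inv_div (Real.cosh _)]
      exact inv_anti₀ (div_pos (Real.cosh_pos _) hs0) hcoth
    · refine mul_le_mul_of_nonneg_left (le_trans ?_ h1') (by positivity)
      rw [Real.tanh_eq_sinh_div_cosh, div_le_one (Real.cosh_pos _)]
      exact hsc
  have hch := Real.cosh_pos Ω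
  -- On the bounded slices t Λ² lies between 1 and M² and t ≤ 1, so that coth(Ωt) and tanh(Ωt) agree
  -- with 1/(Ωt) and Ωt up to a factor cosh Ω.
  obtain ⟨c₁, C₁, hc₁, hC₁, h₁⟩ : ∃ c C : ℝ, 0 < c ∧ 0 < C ∧ ∀ (i : ℕ) (t : ℝ),
      t ∈ sliceSet M (i + 1) →
      c * (M ^ (i + 1)) ^ 2 ≤ propShort Ω t ∧ propShort Ω t ≤ C * (M ^ (i + 1)) ^ 2 ∧
      c * ((M ^ (i + 1)) ^ 2)⁻¹ ≤ propLong Ω t ∧ propLong Ω t ≤ C * ((M ^ (i + 1)) ^ 2)⁻¹ := by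
    refine ⟨min (1 / (4 * Ω ^ 2 * M ^ 2)) (1 / (4 * Real.cosh Ω)),
      max (Real.cosh Ω / (4 * Ω ^ 2)) (M ^ 2 / 4), by positivity, by positivity, fun i t ht => ?_⟩
    obtain ⟨ht0, ht1⟩ := sliceSet_succ_subset hM i ht
    rw [sliceSet_succ hM] at ht
    set Λ := (M ^ (i + 1)) ^ 2 with hΛ
    have hΛ0 : 0 < Λ := by positivity
    obtain ⟨hl, hu⟩ := ht
    have hx0 : 0 < Ω * t := by positivity
    have hxc : Real.cosh (Ω * t) ≤ Real.cosh Ω := by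
      rw [Real.cosh_le_cosh, abs_of_pos hx0, abs_of_pos hΩ]
      nlinarith
    have hs := Real.sinh_le_mul_cosh hx0.le
    have hs' : Ω * t ≤ Real.sinh (Ω * t) := Real.self_le_sinh_iff.2 hx0.le
    have hs0 : 0 < Real.sinh (Ω * t) := hx0.trans_le hs'
    have hc0 := Real.cosh_pos (Ω * t)
    have hc1 := Real.one_le_cosh (Ω * t)
    have htl : 1 ≤ t * Λ := by
      rw [inv_lt_iff_one_lt_mul₀ hΛ0] at hl
      linarith
    have htu : t * Λ ≤ M ^ 2 := by
      rw [← div_eq_mul_inv, le_div_iff₀ hΛ0] at hu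
      exact hu
    have hlow : 1 / (Ω * t) ≤ Real.cosh (Ω * t) / Real.sinh (Ω * t) := by
      rw [div_le_div_iff₀ hx0 hs0]
      linarith
    have hup : Real.cosh (Ω * t) / Real.sinh (Ω * t) ≤ Real.cosh Ω / (Ω * t) := by
      rw [div_le_div_iff₀ hs0 hx0]
      exact mul_le_mul hxc hs' hx0.le hch.le
    have htl' : Ω * t / Real.cosh Ω ≤ Real.tanh (Ω * t) := by
      rw [Real.tanh_eq_sinh_div_cosh, div_le_div_iff₀ hch hc0]
      exact mul_le_mul hs' hxc hc0.le hs0.le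
    have htu' : Real.tanh (Ω * t) ≤ Ω * t := by
      rw [Real.tanh_eq_sinh_div_cosh, div_le_iff₀ hc0]
      exact hs
    refine ⟨?_, ?_, ?_, ?_⟩
    · calc _ ≤ 1 / (4 * Ω ^ 2 * M ^ 2) * Λ := by
            gcongr
            exact min_le_left _ _
        _ ≤ 1 / (4 * Ω) * (1 / (Ω * t)) := by
            rw [← one_div_mul_one_div, div_mul_div_comm, div_mul_div_comm, div_mul_eq_mul_div,
              div_le_div_iff₀ (by positivity) (by positivity)]
            nlinarith [mul_le_mul_of_nonneg_left htu (by positivity : 0 ≤ 4 * Ω * Ω)]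
        _ ≤ _ := mul_le_mul_of_nonneg_left hlow (by positivity)
    · calc _ ≤ 1 / (4 * Ω) * (Real.cosh Ω / (Ω * t)) :=
            mul_le_mul_of_nonneg_left hup (by positivity)
        _ ≤ Real.cosh Ω / (4 * Ω ^ 2) * Λ := by
            rw [div_mul_div_comm, div_mul_eq_mul_div,
              div_le_div_iff₀ (by positivity) (by positivity)]
            nlinarith [mul_le_mul_of_nonneg_left htl (by positivity : 0 ≤ Real.cosh Ω * 4 * Ω * Ω)]
        _ ≤ _ := by
            gcongr
            exact le_max_left _ _
    · calc _ ≤ 1 / (4 * Real.cosh Ω) * Λ⁻¹ := by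
            gcongr
            exact min_le_right _ _
        _ ≤ 1 / (4 * Real.cosh Ω) * t := by gcongr
        _ = 1 / (4 * Ω) * (Ω * t / Real.cosh Ω) := by field_simp
        _ ≤ _ := mul_le_mul_of_nonneg_left htl' (by positivity)
    · calc _ ≤ 1 / (4 * Ω) * (Ω * t) := mul_le_mul_of_nonneg_left htu' (by positivity)
        _ = t / 4 := by field_simp
        _ ≤ M ^ 2 / 4 * Λ⁻¹ := by linarith
        _ ≤ _ := by
            gcongr
            exact le_max_right _ _
  refine ⟨min c₀ c₁, max C₀ C₁, lt_min hc₀ hc₁, lt_max_of_lt_left hC₀, fun i t ht => ?_⟩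
  cases i with
  | zero =>
    obtain ⟨h1, h2, h3, h4⟩ := h₀ t ht
    simp only [pow_zero, one_pow, mul_one, inv_one]
    exact ⟨(min_le_left _ _).trans h1, h2.trans (le_max_left _ _), (min_le_left _ _).trans h3,
      h4.trans (le_max_left _ _)⟩
  | succ i =>
    obtain ⟨h1, h2, h3, h4⟩ := h₁ i t ht
    have hp : 0 < (M ^ (i + 1)) ^ 2 := by positivity
    exact ⟨(mul_le_mul_of_nonneg_right (min_le_right _ _) hp.le).trans h1,
      h2.trans (mul_le_mul_of_nonneg_right (le_max_right _ _) hp.le),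
      (mul_le_mul_of_nonneg_right (min_le_right _ _) (inv_pos.2 hp).le).trans h3,
      h4.trans (mul_le_mul_of_nonneg_right (le_max_right _ _) (inv_pos.2 hp).le)⟩

theorem inv_sq_rpow_half {x : ℝ} (hx : 0 < x) (D : ℕ) : ((x ^ 2)⁻¹) ^ ((D : ℝ) / 2) = (x ^ D)⁻¹ := by
  rw [Real.inv_rpow (by positivity), ← Real.rpow_natCast x 2, ← Real.rpow_mul hx.le,
    ← Real.rpow_natCast x D]
  congr 2
  push_cast
  ring

theorem volume_sliceSet_succ {M : ℝ} (hM : 1 < M) (i : ℕ) :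
    volume.real (sliceSet M (i + 1)) = (M ^ 2 - 1) * ((M ^ (i + 1)) ^ 2)⁻¹ := by
  have : 0 < ((M ^ (i + 1)) ^ 2)⁻¹ := by positivity
  have h1 : 1 ≤ M ^ 2 := one_le_pow₀ hM.le
  rw [sliceSet_succ hM, Real.volume_real_Ioc_of_le (by nlinarith)]
  ring

/-- The factor of the propagator is integrable on every slice, with an integral bounded by
`Λ ^ (D - 2)`. -/
theorem exists_propFactor_bound {D : ℕ} (hD : 1 ≤ D) {Ω M : ℝ} (m : ℝ) (hΩ : 0 < Ω) (hM : 1 < M) :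
    ∃ C : ℝ, 0 < C ∧ ∀ i : ℕ, IntegrableOn (propFactor D Ω m) (sliceSet M i) ∧
      ∫ t in sliceSet M i, propFactor D Ω m t ≤ C * ((M ^ i) ^ D / (M ^ i) ^ 2) := by
  have hM0 : 0 < M := by positivity
  have hle : ∀ t, 0 < t → ∀ s, 0 < s → s ≤ Real.sinh (2 * Ω * t) →
      propFactor D Ω m t ≤ (s ^ ((D : ℝ) / 2))⁻¹ := by
    intro t ht s hs hst
    rw [propFactor, ← one_div]
    refine div_le_div₀ zero_le_one (Real.exp_le_one_iff.2 ?_) (Real.rpow_pos_of_pos hs _)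
      (Real.rpow_le_rpow hs.le hst (by positivity))
    nlinarith [mul_nonneg (sq_nonneg m) ht.le]
  -- On the unbounded slice the decay comes from the power D/2 of sinh, and this needs D ≥ 1; the
  -- mass may vanish and does not help.
  have h0 : IntegrableOn (propFactor D Ω m) (sliceSet M 0) := by
    have hκ : 0 < (1 - Real.exp (-(4 * Ω))) / 2 := by
      have : Real.exp (-(4 * Ω)) < 1 := by
        rw [← Real.exp_zero]
        exact Real.exp_lt_exp.2 (by linarith)
      linarith
    set κ := (1 - Real.exp (-(4 * Ω))) / 2 with hκ'
    have hint : IntegrableOn (fun t => (κ ^ ((D : ℝ) / 2))⁻¹ * Real.exp (-(Ω * D) * t))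
        (Set.Ioi 1) := by
      have hpos : 0 < Ω * D := by
        have : (0 : ℝ) < D := by exact_mod_cast hD
        positivity
      exact (exp_neg_integrableOn_Ioi 1 hpos).const_mul _
    refine Integrable.mono' hint (measurable_propFactor D Ω m).aestronglyMeasurable ?_
    refine (ae_restrict_mem measurableSet_Ioi).mono fun t ht => ?_
    have ht0 : 0 < t := lt_trans one_pos ht
    rw [Real.norm_of_nonneg (propFactor_pos D m hΩ ht0).le]
    have hsinh : κ * Real.exp (2 * Ω * t) ≤ Real.sinh (2 * Ω * t) := by
      rw [Real.sinh_eq]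
      have h1 : Real.exp (-(2 * Ω * t)) ≤ Real.exp (-(4 * Ω)) * Real.exp (2 * Ω * t) := by
        rw [← Real.exp_add]
        apply Real.exp_le_exp.2
        have : (1 : ℝ) < t := ht
        nlinarith
      rw [hκ']
      linarith
    refine (hle t ht0 _ (by positivity) hsinh).trans (le_of_eq ?_)
    rw [Real.mul_rpow hκ.le (Real.exp_pos _).le, mul_inv, ← Real.exp_mul, ← Real.exp_neg]
    congr 2
    ring
  refine ⟨max (∫ t in sliceSet M 0, propFactor D Ω m t) (((2 * Ω) ^ ((D : ℝ) / 2))⁻¹ * M ^ 2),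
    lt_max_of_lt_right (by positivity), fun i => ?_⟩
  cases i with
  | zero => exact ⟨h0, by simp⟩
  | succ i =>
    set Λ := M ^ (i + 1) with hΛ
    have hΛ0 : 0 < Λ := by positivity
    -- From sinh x ≥ x and t > Λ⁻² the factor is at most of order Λ^D, and the length of the slice
    -- supplies Λ⁻².
    have hb : ∀ t ∈ sliceSet M (i + 1),
        ‖propFactor D Ω m t‖ ≤ ((2 * Ω) ^ ((D : ℝ) / 2))⁻¹ * Λ ^ D := by
      intro t ht
      have ht0 := sliceSet_pos hM ht
      rw [Real.norm_of_nonneg (propFactor_pos D m hΩ ht0).le]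
      rw [sliceSet_succ hM] at ht
      refine (hle t ht0 (2 * Ω * (Λ ^ 2)⁻¹) (by positivity) ?_).trans (le_of_eq ?_)
      · refine le_trans ?_ (Real.self_le_sinh_iff.2 (by positivity))
        exact mul_le_mul_of_nonneg_left ht.1.le (by positivity)
      · rw [Real.mul_rpow (by positivity) (by positivity), inv_sq_rpow_half hΛ0, mul_inv, inv_inv]
    have hfin : volume (sliceSet M (i + 1)) ≠ ⊤ := by
      rw [sliceSet_succ hM]
      simp
    refine ⟨IntegrableOn.of_bound hfin.lt_top
      (measurable_propFactor D Ω m).aestronglyMeasurable _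
      ((ae_restrict_mem (measurableSet_sliceSet M _)).mono hb), ?_⟩
    have := norm_setIntegral_le_of_norm_le_const hfin.lt_top hb
    refine (le_abs_self _).trans (this.trans ?_)
    rw [volume_sliceSet_succ hM]
    calc _ ≤ ((2 * Ω) ^ ((D : ℝ) / 2))⁻¹ * Λ ^ D * (M ^ 2 * (Λ ^ 2)⁻¹) := by
          gcongr
          linarith
      _ = ((2 * Ω) ^ ((D : ℝ) / 2))⁻¹ * M ^ 2 * (Λ ^ D / Λ ^ 2) := by ring
      _ ≤ _ := by
          gcongr
          exact le_max_right _ _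

/-- The counterpart for the divergence of the counterterms. On the slices with t ≤ 1, sinh is
comparable to its argument and the mass factor is at least exp(-m²). -/
theorem exists_propFactor_lower_bound (D : ℕ) {Ω M : ℝ} (m : ℝ) (hΩ : 0 < Ω) (hM : 1 < M) :
    ∃ c : ℝ, 0 < c ∧ ∀ i : ℕ, 1 ≤ i → IntegrableOn (propFactor D Ω m) (sliceSet M i) →
      c * ((M ^ i) ^ D / (M ^ i) ^ 2) ≤ ∫ t in sliceSet M i, propFactor D Ω m t := by
  have hM0 : 0 < M := by positivity
  have hM1 : 0 < M ^ 2 - 1 := by nlinarith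
  have hch := Real.cosh_pos (2 * Ω)
  refine ⟨Real.exp (-m ^ 2) * ((2 * Ω * M ^ 2 * Real.cosh (2 * Ω)) ^ ((D : ℝ) / 2))⁻¹ * (M ^ 2 - 1),
    by positivity, fun i hi hint => ?_⟩
  obtain ⟨i, rfl⟩ := Nat.exists_eq_succ_of_ne_zero (by omega : i ≠ 0)
  rw [Nat.succ_eq_add_one] at hint ⊢
  set Λ := M ^ (i + 1) with hΛ
  have hΛ0 : 0 < Λ := by positivity
  have hb : ∀ t ∈ sliceSet M (i + 1),
      Real.exp (-m ^ 2) * ((2 * Ω * M ^ 2 * Real.cosh (2 * Ω)) ^ ((D : ℝ) / 2))⁻¹ * Λ ^ D ≤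
        propFactor D Ω m t := by
    intro t ht
    obtain ⟨ht0, ht1⟩ := sliceSet_succ_subset hM i ht
    rw [sliceSet_succ hM] at ht
    have hx0 : 0 < 2 * Ω * t := by positivity
    have hsinh : Real.sinh (2 * Ω * t) ≤ 2 * Ω * M ^ 2 * Real.cosh (2 * Ω) * (Λ ^ 2)⁻¹ := by
      refine (Real.sinh_le_mul_cosh hx0.le).trans ?_
      have hc : Real.cosh (2 * Ω * t) ≤ Real.cosh (2 * Ω) := by
        rw [Real.cosh_le_cosh, abs_of_pos hx0, abs_of_pos (by positivity)]
        nlinarith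
      calc 2 * Ω * t * Real.cosh (2 * Ω * t)
          ≤ 2 * Ω * (M ^ 2 * (Λ ^ 2)⁻¹) * Real.cosh (2 * Ω) := by
            gcongr
            exact ht.2
        _ = _ := by ring
    rw [propFactor, div_eq_mul_inv, mul_assoc]
    refine mul_le_mul (Real.exp_le_exp.2 ?_) ?_ (by positivity) (by positivity)
    · nlinarith [mul_nonneg (sq_nonneg m) (sub_nonneg.2 ht1)]
    · have h1 := Real.rpow_le_rpow (Real.sinh_pos_iff.2 hx0).le hsinh
        (by positivity : (0 : ℝ) ≤ (D : ℝ) / 2)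
      rw [Real.mul_rpow (by positivity) (by positivity), inv_sq_rpow_half hΛ0] at h1
      have h2 := inv_anti₀ (Real.rpow_pos_of_pos (Real.sinh_pos_iff.2 hx0) _) h1
      rwa [mul_inv, inv_inv] at h2
  have hfin : volume (sliceSet M (i + 1)) ≠ ⊤ := by
    rw [sliceSet_succ hM]
    simp
  have := setIntegral_mono_on (integrableOn_const hfin) hint (measurableSet_sliceSet M _) hb
  rw [setIntegral_const, volume_sliceSet_succ hM, smul_eq_mul] at this
  refine le_trans (le_of_eq ?_) this
  ring

/-! ## Fourier transforms of Schwartz functions -/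

section fourier

open FourierTransform LineDeriv

variable {D : ℕ}

/-- A real Schwartz function, seen as a complex one. -/
noncomputable def SchwartzMap.toComplex (φ : 𝓢(EuclideanSpace ℝ (Fin D), ℝ)) :
    𝓢(EuclideanSpace ℝ (Fin D), ℂ) :=
  SchwartzMap.postcompCLM Complex.ofRealCLM φ

@[simp]
theorem SchwartzMap.toComplex_apply (φ : 𝓢(EuclideanSpace ℝ (Fin D), ℝ))
    (x : EuclideanSpace ℝ (Fin D)) : φ.toComplex x = (φ x : ℂ) := rfl

/-- The Fourier transform with the normalization `∫ f(x) e^{-ipx} dx`. -/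
noncomputable def hat (f : 𝓢(EuclideanSpace ℝ (Fin D), ℂ)) : 𝓢(EuclideanSpace ℝ (Fin D), ℂ) :=
  SchwartzMap.compCLMOfContinuousLinearEquiv ℂ
    (ContinuousLinearEquiv.smulLeft (Units.mk0 (2 * Real.pi)⁻¹ (by positivity))) (𝓕 f)

theorem hat_apply (f : 𝓢(EuclideanSpace ℝ (Fin D), ℂ)) (p : EuclideanSpace ℝ (Fin D)) :
    hat f p = 𝓕 f ((2 * Real.pi)⁻¹ • p) := rfl

theorem hat_eq_integral (f : 𝓢(EuclideanSpace ℝ (Fin D), ℂ)) (p : EuclideanSpace ℝ (Fin D)) :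
    hat f p = ∫ x, f x * Complex.exp (-(Complex.I * ((inner ℝ p x : ℝ) : ℂ))) := by
  rw [hat_apply, fourier_coe, Real.fourier_eq']
  congr 1
  funext x
  rw [smul_eq_mul, mul_comm]
  congr 2
  rw [real_inner_smul_right, real_inner_comm]
  push_cast
  have : (Real.pi : ℂ) ≠ 0 := by exact_mod_cast Real.pi_ne_zero
  field_simp

theorem fieldHat_eq (φ : 𝓢(EuclideanSpace ℝ (Fin D), ℝ)) (p : EuclideanSpace ℝ (Fin D)) :
    fieldHat φ p = hat φ.toComplex p := by
  rw [hat_eq_integral]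
  rfl

theorem integral_hat_mul_exp (f : 𝓢(EuclideanSpace ℝ (Fin D), ℂ)) (x : EuclideanSpace ℝ (Fin D)) :
    ∫ k, hat f k * Complex.exp (Complex.I * ((inner ℝ k x : ℝ) : ℂ)) =
      ((2 * Real.pi) ^ D : ℝ) * f x := by
  have h1 : (fun k => hat f k * Complex.exp (Complex.I * ((inner ℝ k x : ℝ) : ℂ))) = fun k =>
      (fun v => Complex.exp (((2 * Real.pi * inner ℝ v x : ℝ) : ℂ) * Complex.I) • 𝓕 f v)
        ((2 * Real.pi)⁻¹ • k) := by
    funext k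
    beta_reduce
    rw [hat_apply, smul_eq_mul, mul_comm, real_inner_smul_left]
    congr 2
    push_cast
    have : (Real.pi : ℂ) ≠ 0 := by exact_mod_cast Real.pi_ne_zero
    field_simp
  rw [h1, Measure.integral_comp_smul volume (fun v : EuclideanSpace ℝ (Fin D) =>
    Complex.exp (((2 * Real.pi * inner ℝ v x : ℝ) : ℂ) * Complex.I) • 𝓕 f v), finrank_euclideanSpace, Fintype.card_fin, inv_pow, inv_inv,
    abs_of_pos (by positivity), Complex.real_smul]
  congr 1
  have h2 : 𝓕⁻ (𝓕 f) x = f x := by rw [fourierInv_fourier_eq]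
  rw [← h2, fourierInv_coe, Real.fourierInv_eq']

theorem continuous_hat (f : 𝓢(EuclideanSpace ℝ (Fin D), ℂ)) : Continuous (hat f) :=
  (hat f).continuous

/-- The functions `f(k) = ∏ f_e(k_e)` and a further function of `- ∑ k_e`, in Fourier space. -/
theorem integral_prod_hat {ι : Type*} [Fintype ι] (f : ι → 𝓢(EuclideanSpace ℝ (Fin D), ℂ))
    (g : 𝓢(EuclideanSpace ℝ (Fin D), ℂ)) :
    ∫ k : ι → EuclideanSpace ℝ (Fin D), (∏ e, hat (f e) (k e)) * hat g (-∑ e, k e) =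
      (((2 * Real.pi) ^ D) ^ Fintype.card ι : ℝ) * ∫ x, (∏ e, f e x) * g x := by
  -- Writing the last factor as an integral over x makes the integrand factorise over the momenta;
  -- Fourier inversion then gives (2π)^D times the value at x for each of them.
  have h1 : ∀ k : ι → EuclideanSpace ℝ (Fin D), (∏ e, hat (f e) (k e)) * hat g (-∑ e, k e) =
      ∫ x, (∏ e, hat (f e) (k e)) * (g x * Complex.exp (Complex.I * ((inner ℝ (∑ e, k e) x : ℝ) : ℂ)))
      := by
    intro k
    rw [integral_const_mul, hat_eq_integral]
    simp only [inner_neg_left, Complex.ofReal_neg, mul_neg, neg_neg]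
  simp_rw [h1]
  have hint : Integrable (fun z : (ι → EuclideanSpace ℝ (Fin D)) × EuclideanSpace ℝ (Fin D) =>
      (∏ e, hat (f e) (z.1 e)) * (g z.2 * Complex.exp (Complex.I *
        ((inner ℝ (∑ e, z.1 e) z.2 : ℝ) : ℂ)))) (volume.prod volume) := by
    have h0 : Integrable (fun z : (ι → EuclideanSpace ℝ (Fin D)) × EuclideanSpace ℝ (Fin D) =>
      (∏ e, hat (f e) (z.1 e)) * g z.2) (volume.prod volume) :=
      (Integrable.fintype_prod (f := fun e => hat (f e)) fun e => (hat (f e)).integrable).mul_prod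
        g.integrable
    refine h0.mono ?_ (Filter.Eventually.of_forall fun z => ?_)
    · refine Continuous.aestronglyMeasurable ?_
      have := g.continuous
      have h' : ∀ e, Continuous (hat (f e)) := fun e => continuous_hat _
      fun_prop
    · rw [norm_mul, norm_mul, norm_mul, mul_comm Complex.I, Complex.norm_exp_ofReal_mul_I, mul_one]
  rw [integral_integral_swap hint, ← integral_const_mul]
  congr 1
  funext x
  have h2 : ∀ k : ι → EuclideanSpace ℝ (Fin D), (∏ e, hat (f e) (k e)) *
      (g x * Complex.exp (Complex.I * ((inner ℝ (∑ e, k e) x : ℝ) : ℂ))) =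
      g x * ∏ e, (hat (f e) (k e) * Complex.exp (Complex.I * ((inner ℝ (k e) x : ℝ) : ℂ))) := by
    intro k
    rw [Finset.prod_mul_distrib, ← Complex.exp_sum, sum_inner, Complex.ofReal_sum, Finset.mul_sum]
    ring
  simp_rw [h2]
  rw [integral_const_mul, integral_fintype_prod_volume_eq_prod (fun e k => hat (f e) k *
    Complex.exp (Complex.I * ((inner ℝ k x : ℝ) : ℂ)))]
  simp_rw [integral_hat_mul_exp]
  rw [Finset.prod_mul_distrib, Finset.prod_const, Finset.card_univ]
  push_cast
  ring

/-- Multiplication by a coordinate. -/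
noncomputable def coordMul (a : Fin D) (f : 𝓢(EuclideanSpace ℝ (Fin D), ℂ)) :
    𝓢(EuclideanSpace ℝ (Fin D), ℂ) :=
  smulLeftCLM ℂ (fun x : EuclideanSpace ℝ (Fin D) => inner ℝ x (EuclideanSpace.single a 1)) f

theorem inner_hasTemperateGrowth (m : EuclideanSpace ℝ (Fin D)) :
    (fun x : EuclideanSpace ℝ (Fin D) => inner ℝ x m).HasTemperateGrowth :=
  ((innerSL ℝ).flip m).hasTemperateGrowth

theorem coordMul_apply (a : Fin D) (f : 𝓢(EuclideanSpace ℝ (Fin D), ℂ))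
    (x : EuclideanSpace ℝ (Fin D)) : coordMul a f x = (x a : ℂ) * f x := by
  rw [coordMul, smulLeftCLM_apply_apply (inner_hasTemperateGrowth _), EuclideanSpace.inner_single_right]
  simp

/-- Differentiation of a Fourier transform multiplies the function by -i x. This is the origin of
the factors x, hence of the harmonic term, in the counterterm. -/
theorem hasDerivAt_hat_line (f : 𝓢(EuclideanSpace ℝ (Fin D), ℂ)) (σ s : EuclideanSpace ℝ (Fin D))
    (t : ℝ) : HasDerivAt (fun t : ℝ => hat f (t • σ - s))
      (-Complex.I * ∑ a, (σ a : ℂ) * hat (coordMul a f) (t • σ - s)) t := by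
  set c : ℝ := (2 * Real.pi)⁻¹
  have h1 : HasDerivAt (fun t : ℝ => c • (t • σ - s)) (c • σ) t := by
    have := (((hasDerivAt_id t).smul_const σ).sub_const s).const_smul c
    rw [one_smul] at this
    exact this
  have h2 := ((𝓕 f).hasFDerivAt (c • (t • σ - s))).comp_hasDerivAt t h1
  refine h2.congr_deriv ?_
  rw [← SchwartzMap.lineDerivOp_apply_eq_fderiv, lineDerivOp_fourier_eq]
  have h3 : smulLeftCLM ℂ (fun x : EuclideanSpace ℝ (Fin D) => inner ℝ x (c • σ)) f =
      ∑ a, ((c * σ a : ℝ) : ℂ) • coordMul a f := by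
    ext x
    rw [smulLeftCLM_apply_apply (inner_hasTemperateGrowth _)]
    simp only [sum_apply, smul_apply, coordMul_apply, PiLp.inner_apply, RCLike.inner_apply,
      conj_trivial, smul_eq_mul, Complex.real_smul, PiLp.smul_apply]
    push_cast
    rw [Finset.sum_mul]
    refine Finset.sum_congr rfl fun a _ => ?_
    ring
  rw [h3, FourierTransform.fourier_smul, FourierTransform.fourier_sum]
  simp_rw [FourierTransform.fourier_smul]
  simp only [sum_apply, smul_apply, hat_apply, smul_eq_mul, Finset.mul_sum]
  refine Finset.sum_congr rfl fun a _ => ?_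
  have : (Real.pi : ℂ) ≠ 0 := by exact_mod_cast Real.pi_ne_zero
  simp only [c]
  push_cast
  field_simp

/-- Through this identity the external momenta in the Taylor coefficients become derivatives of the
field. -/
theorem hat_lineDeriv (f : 𝓢(EuclideanSpace ℝ (Fin D), ℂ)) (a : Fin D)
    (k : EuclideanSpace ℝ (Fin D)) :
    hat (∂_{EuclideanSpace.single a (1 : ℝ)} f) k = Complex.I * (k a : ℂ) * hat f k := by
  rw [hat_apply, fourier_lineDerivOp_eq, smul_apply,
    smulLeftCLM_apply_apply (inner_hasTemperateGrowth _), EuclideanSpace.inner_single_right, hat_apply]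
  simp only [PiLp.smul_apply, smul_eq_mul, conj_trivial, one_mul, Complex.real_smul]
  have : (Real.pi : ℂ) ≠ 0 := by exact_mod_cast Real.pi_ne_zero
  push_cast
  field_simp

/-- The derivatives of the Fourier transform along a line are bounded. -/
theorem exists_hat_derivBound (f : 𝓢(EuclideanSpace ℝ (Fin D), ℂ)) :
    ∃ B : ℕ → ℝ, (∀ r, 0 ≤ B r) ∧ ∀ σ s : EuclideanSpace ℝ (Fin D),
      DerivBound (fun t => hat f (t • σ - s)) fun r => B r * ‖σ‖ ^ r := by
  refine ⟨fun r => SchwartzMap.seminorm ℝ 0 r (hat f), fun r => apply_nonneg _ _, fun σ s => ?_⟩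
  have hsm := (hat f).smooth ⊤
  refine ⟨hsm.comp (by fun_prop), fun r t => ?_⟩
  have e : (fun t : ℝ => hat f (t • σ - s)) =
      (fun y => hat f (y - s)) ∘ (ContinuousLinearMap.toSpanSingleton ℝ σ) := by
    funext t
    simp
  rw [← norm_iteratedFDeriv_eq_norm_iteratedDeriv, e,
    ContinuousLinearMap.iteratedFDeriv_comp_right (f := fun y => hat f (y - s)) _ (n := r)
      ((hsm.comp (by fun_prop)).of_le (by exact_mod_cast le_top)) _ le_rfl]
  refine (ContinuousMultilinearMap.norm_compContinuousLinearMap_le _ _).trans ?_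
  rw [iteratedFDeriv_comp_sub, Finset.prod_const, Finset.card_univ, Fintype.card_fin,
    ContinuousLinearMap.norm_toSpanSingleton]
  exact mul_le_mul_of_nonneg_right (SchwartzMap.norm_iteratedFDeriv_le_seminorm ℝ _ _ _)
    (by positivity)

theorem integrable_hat_weight (f : 𝓢(EuclideanSpace ℝ (Fin D), ℂ)) (r : ℕ) :
    Integrable fun k => (1 + ‖k‖) ^ r * ‖hat f k‖ := by
  have h : (fun k => (1 + ‖k‖) ^ r * ‖hat f k‖) = fun k =>
      ∑ j ∈ Finset.range (r + 1), (r.choose j : ℝ) * (‖k‖ ^ j * ‖hat f k‖) := by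
    funext k
    rw [add_comm, add_pow, Finset.sum_mul]
    refine Finset.sum_congr rfl fun j _ => ?_
    rw [one_pow]
    ring
  rw [h]
  exact integrable_finsetSum _ fun j _ => ((hat f).integrable_pow_mul volume j).const_mul _

end fourier

/-! ### Gaussian integrals and the dominating function -/

theorem integral_gaussian_eq (D : ℕ) {c Λ : ℝ} (hc : 0 < c) (hΛ : 0 < Λ) :
    ∫ x : EuclideanSpace ℝ (Fin D), Real.exp (-(c * Λ ^ 2 * ‖x‖ ^ 2)) =
      (Real.pi / c) ^ ((D : ℝ) / 2) * (Λ ^ D)⁻¹ := by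
  have h := GaussianFourier.integral_rexp_neg_mul_sq_norm (V := EuclideanSpace ℝ (Fin D))
    (b := c * Λ ^ 2) (by positivity)
  simp only [neg_mul] at h
  rw [h, finrank_euclideanSpace, Fintype.card_fin, ← inv_sq_rpow_half hΛ, ← Real.mul_rpow
    (by positivity) (by positivity)]
  congr 1
  field_simp

theorem integrable_gaussian (D : ℕ) {c Λ : ℝ} (hc : 0 < c) (hΛ : 0 < Λ) :
    Integrable fun x : EuclideanSpace ℝ (Fin D) => Real.exp (-(c * Λ ^ 2 * ‖x‖ ^ 2)) := by
  -- The integral of a function which is not integrable is 0 by convention, whereas the value found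
  -- above is positive.
  by_contra h
  have h1 := integral_gaussian_eq D hc hΛ
  rw [integral_undef h] at h1
  have : 0 < (Real.pi / c) ^ ((D : ℝ) / 2) * (Λ ^ D)⁻¹ := by positivity
  linarith

/-- The product is a majorant of 1 and of the sum that factorises over the variables, so that its
powers can be absorbed line by line or leg by leg. -/
theorem sum_le_prod_one_add {ι : Type*} (s : Finset ι) (x : ι → ℝ) (hx : ∀ i, 0 ≤ x i) :
    1 + ∑ i ∈ s, x i ≤ ∏ i ∈ s, (1 + x i) := by
  classical
  induction s using Finset.induction_on with
  | empty => simp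
  | insert a s ha ih =>
    rw [Finset.sum_insert ha, Finset.prod_insert ha]
    have := Finset.sum_nonneg fun i (_ : i ∈ s) => hx i
    nlinarith [hx a]

/-- Powers are absorbed by half of a Gaussian. -/
theorem exists_absorb {c : ℝ} (hc : 0 < c) (r : ℕ) :
    ∃ C : ℝ, 0 < C ∧ ∀ x : ℝ, 0 ≤ x → (1 + x) ^ r * Real.exp (-(c * x ^ 2)) ≤
      C * Real.exp (-(c / 2 * x ^ 2)) := by
  refine ⟨r.factorial * Real.exp (1 + 1 / (2 * c)), by positivity, fun x hx => ?_⟩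
  have h1 := Real.pow_div_factorial_le_exp (1 + x) (by positivity) r
  rw [div_le_iff₀ (by positivity)] at h1
  calc (1 + x) ^ r * Real.exp (-(c * x ^ 2))
      ≤ Real.exp (1 + x) * r.factorial * Real.exp (-(c * x ^ 2)) := by gcongr
    _ = r.factorial * Real.exp (1 + x + -(c * x ^ 2)) := by
        rw [Real.exp_add (1 + x)]
        ring
    _ ≤ r.factorial * Real.exp (1 + 1 / (2 * c) + -(c / 2 * x ^ 2)) := by
        have : x ≤ 1 / (2 * c) + c / 2 * x ^ 2 := by
          have h2 : 1 / (2 * c) + c / 2 * x ^ 2 - x = (1 - c * x) ^ 2 / (2 * c) := by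
            field_simp
            ring
          have h3 : 0 ≤ (1 - c * x) ^ 2 / (2 * c) := by positivity
          linarith
        refine mul_le_mul_of_nonneg_left (Real.exp_le_exp.2 ?_) (by positivity)
        linarith
    _ = _ := by rw [Real.exp_add (1 + 1 / (2 * c))]; ring

namespace FeynmanGraph

section domination

variable {D : ℕ} {G : FeynmanGraph}

/-- The measure on the parameters of the lines. -/
noncomputable def sliceMeasure (M : ℝ) (μ : G.L → ℕ) : Measure (G.L → ℝ) :=
  Measure.pi fun l => volume.restrict (sliceSet M (μ l))

instance (M : ℝ) (μ : G.L → ℕ) : SigmaFinite (sliceMeasure M μ) := by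
  unfold sliceMeasure
  infer_instance

theorem ae_sliceMeasure (M : ℝ) (μ : G.L → ℕ) :
    ∀ᵐ τ ∂(sliceMeasure M μ), ∀ l, τ l ∈ sliceSet M (μ l) := by
  rw [sliceMeasure, ← Measure.restrict_pi_pi]
  refine (ae_restrict_mem (MeasurableSet.univ_pi fun l => measurableSet_sliceSet M (μ l))).mono ?_
  intro τ hτ l
  exact hτ l (Set.mem_univ l)

/-- The product of the factors of the propagators which do not depend on the momenta. -/
noncomputable def factorProd (D : ℕ) (Ω m : ℝ) (τ : G.L → ℝ) : ℝ := ∏ l, propFactor D Ω m (τ l)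

/-- A Gaussian in the variables `u`. -/
noncomputable def gaussShort (M c : ℝ) (μ : G.L → ℕ) (u : G.L → EuclideanSpace ℝ (Fin D)) : ℝ :=
  ∏ l, Real.exp (-(c * (M ^ μ l) ^ 2 * ‖u l‖ ^ 2))

/-- A Gaussian in the loop momenta. -/
noncomputable def gaussLong (M c : ℝ) (μ : G.L → ℕ) {T : Finset G.L}
    (w : {l : G.L // l ∉ T} → EuclideanSpace ℝ (Fin D)) : ℝ :=
  ∏ l : {l : G.L // l ∉ T}, Real.exp (-(c * ((M ^ μ l.1)⁻¹) ^ 2 * ‖w l‖ ^ 2))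

theorem exists_factorProd_bound {Ω M : ℝ} (m : ℝ) (hD : Nonempty G.L → 1 ≤ D) (hΩ : 0 < Ω)
    (hM : 1 < M) : ∃ C : ℝ, 0 < C ∧ ∀ μ : G.L → ℕ,
      Integrable (factorProd D Ω m) (sliceMeasure M μ) ∧
      ∫ τ, factorProd D Ω m τ ∂(sliceMeasure M μ) ≤ C * ∏ l, ((M ^ μ l) ^ D / (M ^ μ l) ^ 2) := by
  -- The dummy line makes the bound vacuous for a graph without lines, for which D = 0 is permitted.
  obtain ⟨C, hC, h⟩ : ∃ C : ℝ, 0 < C ∧ ∀ (_ : G.L) (i : ℕ),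
      IntegrableOn (propFactor D Ω m) (sliceSet M i) ∧
      ∫ t in sliceSet M i, propFactor D Ω m t ≤ C * ((M ^ i) ^ D / (M ^ i) ^ 2) := by
    rcases isEmpty_or_nonempty G.L with hL | hL
    · exact ⟨1, one_pos, fun l => isEmptyElim l⟩
    · obtain ⟨C, hC, h⟩ := exists_propFactor_bound (hD hL) m hΩ hM
      exact ⟨C, hC, fun _ => h⟩
  refine ⟨C ^ Fintype.card G.L, by positivity, fun μ => ⟨?_, ?_⟩⟩
  · exact Integrable.fintype_prod (f := fun _ => propFactor D Ω m) fun l => (h l (μ l)).1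
  · rw [sliceMeasure]
    unfold factorProd
    rw [integral_fintype_prod_eq_prod (fun _ => propFactor D Ω m), ← Finset.card_univ,
      ← Finset.prod_const, ← Finset.prod_mul_distrib]
    refine Finset.prod_le_prod (fun l _ => ?_) fun l _ => (h l (μ l)).2
    exact setIntegral_nonneg (measurableSet_sliceSet M _) fun t ht =>
      (propFactor_pos D m hΩ (sliceSet_pos hM ht)).le

theorem integrable_gaussShort {M c : ℝ} (hM : 1 < M) (hc : 0 < c) (μ : G.L → ℕ) :
    Integrable (gaussShort (D := D) M c μ) :=
  Integrable.fintype_prod (f := fun l (x : EuclideanSpace ℝ (Fin D)) =>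
    Real.exp (-(c * (M ^ μ l) ^ 2 * ‖x‖ ^ 2))) fun l => integrable_gaussian D hc (by positivity)

theorem integral_gaussShort {M c : ℝ} (hM : 1 < M) (hc : 0 < c) (μ : G.L → ℕ) :
    ∫ u, gaussShort (D := D) M c μ u =
      ((Real.pi / c) ^ ((D : ℝ) / 2)) ^ Fintype.card G.L * ∏ l, ((M ^ μ l) ^ D)⁻¹ := by
  unfold gaussShort
  rw [integral_fintype_prod_volume_eq_prod (fun l (x : EuclideanSpace ℝ (Fin D)) =>
    Real.exp (-(c * (M ^ μ l) ^ 2 * ‖x‖ ^ 2)))]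
  simp_rw [fun l => integral_gaussian_eq D hc (by positivity : 0 < M ^ μ l)]
  rw [Finset.prod_mul_distrib, Finset.prod_const, Finset.card_univ]

theorem integrable_gaussLong {M c : ℝ} (hM : 1 < M) (hc : 0 < c) (μ : G.L → ℕ) (T : Finset G.L) :
    Integrable (gaussLong (D := D) (T := T) M c μ) :=
  Integrable.fintype_prod (f := fun (l : {l : G.L // l ∉ T}) (x : EuclideanSpace ℝ (Fin D)) =>
    Real.exp (-(c * ((M ^ μ l.1)⁻¹) ^ 2 * ‖x‖ ^ 2))) fun l =>
      integrable_gaussian D hc (by positivity)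

theorem integral_gaussLong {M c : ℝ} (hM : 1 < M) (hc : 0 < c) (μ : G.L → ℕ) (T : Finset G.L) :
    ∫ w, gaussLong (D := D) (T := T) M c μ w =
      ((Real.pi / c) ^ ((D : ℝ) / 2)) ^ Fintype.card {l : G.L // l ∉ T} *
        ∏ l : {l : G.L // l ∉ T}, (M ^ μ l.1) ^ D := by
  unfold gaussLong
  rw [integral_fintype_prod_volume_eq_prod (fun (l : {l : G.L // l ∉ T})
    (x : EuclideanSpace ℝ (Fin D)) => Real.exp (-(c * ((M ^ μ l.1)⁻¹) ^ 2 * ‖x‖ ^ 2)))]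
  simp_rw [fun l : {l : G.L // l ∉ T} =>
    integral_gaussian_eq D hc (by positivity : 0 < (M ^ μ l.1)⁻¹), inv_pow, inv_inv]
  rw [Finset.prod_mul_distrib, Finset.prod_const, Finset.card_univ]

/-- The dominating function of the integrals over the internal variables. -/
noncomputable def dominant (Ω m M c : ℝ) (μ : G.L → ℕ) (T : Finset G.L)
    (y : (G.L → EuclideanSpace ℝ (Fin D)) ×
      (({l : G.L // l ∉ T} → EuclideanSpace ℝ (Fin D)) × (G.L → ℝ))) : ℝ :=
  gaussShort M c μ y.1 * (gaussLong M c μ y.2.1 * factorProd D Ω m y.2.2)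

/-- The measure on the internal variables. -/
noncomputable def innerMeasure (D : ℕ) (M : ℝ) (μ : G.L → ℕ) (T : Finset G.L) :
    Measure ((G.L → EuclideanSpace ℝ (Fin D)) ×
      (({l : G.L // l ∉ T} → EuclideanSpace ℝ (Fin D)) × (G.L → ℝ))) :=
  volume.prod (volume.prod (sliceMeasure M μ))

instance (M : ℝ) (μ : G.L → ℕ) (T : Finset G.L) : SigmaFinite (innerMeasure D M μ T) := by
  unfold innerMeasure
  infer_instance

/-- The integral factorises over the lines: Λ^(-D) from u, Λ^(D-2) from the parameter and, off the
tree, Λ^D from the loop momentum. -/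
theorem exists_dominant_bound {Ω M c : ℝ} (m : ℝ) (hD : Nonempty G.L → 1 ≤ D) (hΩ : 0 < Ω)
    (hM : 1 < M) (hc : 0 < c) (T : Finset G.L) :
    ∃ C : ℝ, 0 < C ∧ ∀ μ : G.L → ℕ,
      Integrable (dominant (D := D) Ω m M c μ T) (innerMeasure D M μ T) ∧
      ∫ y, dominant Ω m M c μ T y ∂(innerMeasure D M μ T) ≤
        C * ∏ l, M ^ (lineExp D T l * μ l) := by
  have hM0 : 0 < M := by positivity
  obtain ⟨C, hC, h⟩ := exists_factorProd_bound (D := D) (G := G) m hD hΩ hM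
  set P := (Real.pi / c) ^ ((D : ℝ) / 2) with hP
  have hP0 : 0 < P := by positivity
  refine ⟨P ^ Fintype.card G.L * P ^ Fintype.card {l : G.L // l ∉ T} * C, by positivity,
    fun μ => ⟨?_, ?_⟩⟩
  · exact (integrable_gaussShort hM hc μ).mul_prod ((integrable_gaussLong hM hc μ T).mul_prod (h μ).1)
  · rw [innerMeasure]
    unfold dominant
    rw [integral_prod_mul (gaussShort (D := D) M c μ) (fun y : ({l : G.L // l ∉ T} →
        EuclideanSpace ℝ (Fin D)) × (G.L → ℝ) => gaussLong M c μ y.1 * factorProd D Ω m y.2),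
      integral_prod_mul (gaussLong (D := D) (T := T) M c μ) (factorProd D Ω m),
      integral_gaussShort hM hc, integral_gaussLong hM hc]
    have hsub : ∏ l : {l : G.L // l ∉ T}, (M ^ μ l.1) ^ D =
        ∏ l, if l ∈ T then 1 else (M ^ μ l) ^ D := by
      rw [Finset.prod_ite, Finset.prod_const_one, one_mul]
      exact Finset.prod_subtype _ (by simp) (fun l => (M ^ μ l) ^ D) |>.symm
    rw [hsub]
    calc _ ≤ P ^ Fintype.card G.L * (∏ l, ((M ^ μ l) ^ D)⁻¹) *
          (P ^ Fintype.card {l : G.L // l ∉ T} * (∏ l, if l ∈ T then 1 else (M ^ μ l) ^ D) *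
            (C * ∏ l, ((M ^ μ l) ^ D / (M ^ μ l) ^ 2))) := by
          gcongr
          exact (h μ).2
      _ = P ^ Fintype.card G.L * P ^ Fintype.card {l : G.L // l ∉ T} * C *
          ∏ l, (((M ^ μ l) ^ D)⁻¹ * (if l ∈ T then 1 else (M ^ μ l) ^ D) *
            ((M ^ μ l) ^ D / (M ^ μ l) ^ 2)) := by
          rw [Finset.prod_mul_distrib, Finset.prod_mul_distrib]
          ring
      _ = _ := by
          congr 1
          refine Finset.prod_congr rfl fun l _ => ?_
          have hpos : 0 < M ^ μ l := by positivity
          have e : M ^ (lineExp D T l * μ l) = (M ^ μ l) ^ lineExp D T l := by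
            rw [mul_comm, zpow_mul, zpow_natCast]
          rw [e]
          unfold lineExp
          split_ifs
          · rw [zpow_neg]
            field_simp
          · rw [zpow_add₀ hpos.ne', zpow_neg, zpow_natCast]
            field_simp

end domination

end FeynmanGraph

/-! ### The integrand as a Gaussian in the scaling parameter -/

namespace FeynmanGraph

section integrand

variable {D : ℕ} {G : FeynmanGraph}

/-- The product of the integrands of the propagators. -/
noncomputable def kernelProd (Ω m : ℝ) (e₀ : G.X) (T : Finset G.L)
    (k : {e : G.X // e ≠ e₀} → EuclideanSpace ℝ (Fin D))
    (y : (G.L → EuclideanSpace ℝ (Fin D)) ×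
      (({l : G.L // l ∉ T} → EuclideanSpace ℝ (Fin D)) × (G.L → ℝ))) : ℝ :=
  ∏ l, propKernel Ω m (y.2.2 l) (y.1 l - G.route e₀ T k y.1 y.2.1 l)
    (G.route e₀ T k y.1 y.2.1 l)

/-- The integrand of the scaled amplitude in all variables. -/
noncomputable def fullIntegrand (Ω m : ℝ) (e₀ : G.X) (T : Finset G.L)
    (φ : 𝓢(EuclideanSpace ℝ (Fin D), ℝ)) (t : ℝ)
    (z : ({e : G.X // e ≠ e₀} → EuclideanSpace ℝ (Fin D)) × ((G.L → EuclideanSpace ℝ (Fin D)) ×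
      (({l : G.L // l ∉ T} → EuclideanSpace ℝ (Fin D)) × (G.L → ℝ)))) : ℂ :=
  (kernelProd Ω m e₀ T (t • z.1) z.2 : ℂ) * (∏ e, hat φ.toComplex (z.1 e)) *
    hat φ.toComplex (t • ∑ l, z.2.1 l - ∑ e, z.1 e)

/-- Half of the coefficient of `- t` in the exponent. -/
noncomputable def expLin (Ω : ℝ) (e₀ : G.X) (T : Finset G.L)
    (k : {e : G.X // e ≠ e₀} → EuclideanSpace ℝ (Fin D))
    (y : (G.L → EuclideanSpace ℝ (Fin D)) ×
      (({l : G.L // l ∉ T} → EuclideanSpace ℝ (Fin D)) × (G.L → ℝ))) : ℝ :=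
  ∑ l, propLong Ω (y.2.2 l) * (2 * inner ℝ (y.1 l - (2 : ℝ) • G.route e₀ T 0 y.1 y.2.1 l)
    (G.route e₀ T k 0 0 l))

/-- The coefficient of `t ^ 2` in the exponent, as a bilinear form. -/
noncomputable def expQuad (Ω : ℝ) (e₀ : G.X) (T : Finset G.L)
    (k k' : {e : G.X // e ≠ e₀} → EuclideanSpace ℝ (Fin D)) (τ : G.L → ℝ) : ℝ :=
  ∑ l, propLong Ω (τ l) * (4 * inner ℝ (G.route e₀ T k 0 0 l) (G.route e₀ T k' 0 0 l))

/-- The exponent at `t = 0`. -/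
noncomputable def expZero (Ω : ℝ) (e₀ : G.X) (T : Finset G.L)
    (y : (G.L → EuclideanSpace ℝ (Fin D)) ×
      (({l : G.L // l ∉ T} → EuclideanSpace ℝ (Fin D)) × (G.L → ℝ))) : ℝ :=
  ∑ l, propLong Ω (y.2.2 l) * ‖y.1 l - (2 : ℝ) • G.route e₀ T 0 y.1 y.2.1 l‖ ^ 2

/-- The part of the product of the kernels which does not depend on `t`. -/
noncomputable def outerFactor (Ω m : ℝ) (T : Finset G.L)
    (y : (G.L → EuclideanSpace ℝ (Fin D)) ×
      (({l : G.L // l ∉ T} → EuclideanSpace ℝ (Fin D)) × (G.L → ℝ))) : ℝ :=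
  factorProd D Ω m y.2.2 * Real.exp (-∑ l, propShort Ω (y.2.2 l) * ‖y.1 l‖ ^ 2)

/-- With p + q = u and p - q = u - 2q, the strong coefficients see only u; the external momenta
enter through the weak ones alone. -/
theorem kernelProd_eq (Ω m : ℝ) (e₀ : G.X) (T : Finset G.L)
    (k : {e : G.X // e ≠ e₀} → EuclideanSpace ℝ (Fin D))
    (y : (G.L → EuclideanSpace ℝ (Fin D)) ×
      (({l : G.L // l ∉ T} → EuclideanSpace ℝ (Fin D)) × (G.L → ℝ))) :
    kernelProd Ω m e₀ T k y = outerFactor Ω m T y *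
      Real.exp (-∑ l, propLong Ω (y.2.2 l) *
        ‖y.1 l - (2 : ℝ) • G.route e₀ T k y.1 y.2.1 l‖ ^ 2) := by
  have h : ∀ l, propKernel Ω m (y.2.2 l) (y.1 l - G.route e₀ T k y.1 y.2.1 l)
      (G.route e₀ T k y.1 y.2.1 l) = propFactor D Ω m (y.2.2 l) *
        Real.exp (-(propShort Ω (y.2.2 l) * ‖y.1 l‖ ^ 2) + -(propLong Ω (y.2.2 l) *
          ‖y.1 l - (2 : ℝ) • G.route e₀ T k y.1 y.2.1 l‖ ^ 2)) := by
    intro l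
    rw [propKernel_eq, sub_add_cancel, sub_sub, ← two_smul ℝ, sub_eq_add_neg]
  unfold kernelProd outerFactor factorProd
  rw [Finset.prod_congr rfl fun l _ => h l, Finset.prod_mul_distrib, ← Real.exp_sum,
    Finset.sum_add_distrib, Finset.sum_neg_distrib, Finset.sum_neg_distrib, Real.exp_add, mul_assoc]

/-- The routing is linear, so u - 2q is affine in t and its squared norm is a quadratic polynomial.
-/
theorem exponent_smul_eq (Ω : ℝ) (e₀ : G.X) {T : Finset G.L} (hT : G.IsSpanningTree T)
    (k : {e : G.X // e ≠ e₀} → EuclideanSpace ℝ (Fin D))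
    (y : (G.L → EuclideanSpace ℝ (Fin D)) ×
      (({l : G.L // l ∉ T} → EuclideanSpace ℝ (Fin D)) × (G.L → ℝ))) (t : ℝ) :
    ∑ l, propLong Ω (y.2.2 l) * ‖y.1 l - (2 : ℝ) • G.route e₀ T (t • k) y.1 y.2.1 l‖ ^ 2 =
      expQuad Ω e₀ T k k y.2.2 * t ^ 2 - 2 * expLin Ω e₀ T k y * t + expZero Ω e₀ T y := by
  unfold expQuad expLin expZero
  rw [Finset.sum_mul, Finset.mul_sum, Finset.sum_mul, ← Finset.sum_sub_distrib,
    ← Finset.sum_add_distrib]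
  refine Finset.sum_congr rfl fun l _ => ?_
  have h1 : G.route e₀ T (t • k) y.1 y.2.1 l =
      t • G.route e₀ T k 0 0 l + G.route e₀ T 0 y.1 y.2.1 l := by
    have := route_smul e₀ hT t k 0 0
    simp only [smul_zero] at this
    rw [route_eq_add e₀ hT, this]
    rfl
  have h2 : y.1 l - (2 : ℝ) • G.route e₀ T (t • k) y.1 y.2.1 l =
      (y.1 l - (2 : ℝ) • G.route e₀ T 0 y.1 y.2.1 l) - (2 * t) • G.route e₀ T k 0 0 l := by
    rw [h1, smul_add, smul_smul]
    abel
  rw [h2, norm_sub_sq_real, real_inner_smul_right, norm_smul, mul_pow, real_inner_self_eq_norm_sq,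
    Real.norm_eq_abs, sq_abs]
  ring

theorem kernelProd_smul_eq (Ω m : ℝ) (e₀ : G.X) {T : Finset G.L} (hT : G.IsSpanningTree T)
    (k : {e : G.X // e ≠ e₀} → EuclideanSpace ℝ (Fin D))
    (y : (G.L → EuclideanSpace ℝ (Fin D)) ×
      (({l : G.L // l ∉ T} → EuclideanSpace ℝ (Fin D)) × (G.L → ℝ))) (t : ℝ) :
    kernelProd Ω m e₀ T (t • k) y = outerFactor Ω m T y *
      Real.exp (-(expQuad Ω e₀ T k k y.2.2 * t ^ 2 - 2 * expLin Ω e₀ T k y * t +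
        expZero Ω e₀ T y)) := by
  rw [kernelProd_eq, exponent_smul_eq Ω e₀ hT]

/-- The part of the exponent at `t = 0` which comes from the lines outside of the tree. -/
noncomputable def expLoop (Ω : ℝ) (T : Finset G.L)
    (y : (G.L → EuclideanSpace ℝ (Fin D)) ×
      (({l : G.L // l ∉ T} → EuclideanSpace ℝ (Fin D)) × (G.L → ℝ))) : ℝ :=
  ∑ l : {l : G.L // l ∉ T}, propLong Ω (y.2.2 l.1) * ‖y.1 l.1 - (2 : ℝ) • y.2.1 l‖ ^ 2

/-- The lines outside of the tree do not contribute to the dependence on `t`. -/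
theorem expLoop_le {Ω : ℝ} (e₀ : G.X) {T : Finset G.L} (hT : G.IsSpanningTree T)
    (k : {e : G.X // e ≠ e₀} → EuclideanSpace ℝ (Fin D))
    (y : (G.L → EuclideanSpace ℝ (Fin D)) ×
      (({l : G.L // l ∉ T} → EuclideanSpace ℝ (Fin D)) × (G.L → ℝ)))
    (hτ : ∀ l, 0 ≤ propLong Ω (y.2.2 l)) (t : ℝ) :
    expLoop Ω T y ≤ expQuad Ω e₀ T k k y.2.2 * t ^ 2 - 2 * expLin Ω e₀ T k y * t +
        expZero Ω e₀ T y := by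
  have h1 : expLoop Ω T y = ∑ l ∈ Finset.univ.filter (fun l => l ∉ T), propLong Ω (y.2.2 l) *
      ‖y.1 l - (2 : ℝ) • G.route e₀ T (t • k) y.1 y.2.1 l‖ ^ 2 := by
    unfold expLoop
    rw [Finset.sum_subtype (p := fun l => l ∉ T) _ (by simp)]
    refine Finset.sum_congr rfl fun l _ => ?_
    rw [route_apply_notMem e₀ hT]
  rw [h1, ← exponent_smul_eq Ω e₀ hT]
  exact Finset.sum_le_sum_of_subset_of_nonneg (Finset.filter_subset _ _) fun l _ _ =>
    mul_nonneg (hτ l) (sq_nonneg _)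

/-- The polynomial in t never falls below the contribution of the lines off the tree, so its
discriminant, after subtraction of this contribution, is not positive. This is the hypothesis of
`exists_gaussian_derivBound` with γ₀ equal to `expLoop`. -/
theorem expLin_sq_le {Ω : ℝ} (e₀ : G.X) {T : Finset G.L} (hT : G.IsSpanningTree T)
    (k : {e : G.X // e ≠ e₀} → EuclideanSpace ℝ (Fin D))
    (y : (G.L → EuclideanSpace ℝ (Fin D)) ×
      (({l : G.L // l ∉ T} → EuclideanSpace ℝ (Fin D)) × (G.L → ℝ)))
    (hτ : ∀ l, 0 ≤ propLong Ω (y.2.2 l)) :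
    expLin Ω e₀ T k y ^ 2 ≤ expQuad Ω e₀ T k k y.2.2 * (expZero Ω e₀ T y - expLoop Ω T y) := by
  have h := discrim_le_zero (a := expQuad Ω e₀ T k k y.2.2) (b := -(2 * expLin Ω e₀ T k y))
    (c := expZero Ω e₀ T y - expLoop Ω T y) fun t => by
      have := expLoop_le e₀ hT k y hτ t
      nlinarith
  rw [discrim] at h
  linarith

theorem expQuad_nonneg {Ω : ℝ} (e₀ : G.X) {T : Finset G.L}
    (k : {e : G.X // e ≠ e₀} → EuclideanSpace ℝ (Fin D)) (τ : G.L → ℝ)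
    (hτ : ∀ l, 0 ≤ propLong Ω (τ l)) : 0 ≤ expQuad Ω e₀ T k k τ :=
  Finset.sum_nonneg fun l _ => mul_nonneg (hτ l)
    (mul_nonneg (by norm_num) real_inner_self_nonneg)

/-- The bound on the factor which does not depend on `t`, with some room to spare for powers
of `Λ ‖u‖`. -/
theorem exists_outerFactor_bound {Ω M : ℝ} (hΩ : 0 < Ω) (hM : 1 < M) (D : ℕ) (G : FeynmanGraph) :
    ∃ c : ℝ, 0 < c ∧ ∀ r : ℕ, ∃ E : ℝ, 0 < E ∧ ∀ (m : ℝ) (T : Finset G.L) (μ : G.L → ℕ)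
      (y : (G.L → EuclideanSpace ℝ (Fin D)) ×
      (({l : G.L // l ∉ T} → EuclideanSpace ℝ (Fin D)) × (G.L → ℝ))),
      (∀ l, y.2.2 l ∈ sliceSet M (μ l)) →
      (∏ l, (1 + M ^ μ l * ‖y.1 l‖) ^ r) * (outerFactor Ω m T y *
        Real.exp (-(1 / 2 * expLoop Ω T y))) ≤ E * dominant Ω m M c μ T y := by
  obtain ⟨c, C, hc, hC, hcoef⟩ := exists_coefficient_bounds hΩ hM
  have hM0 : 0 < M := by positivity
  -- Of the coefficient c of Λ²|u|², one half absorbs the powers of Λ|u|, one quarter pays for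
  -- replacing u - 2w by w in the loop Gaussian, and one quarter remains.
  refine ⟨c / 4, by positivity, fun r => ?_⟩
  obtain ⟨E, hE, habs⟩ := exists_absorb hc r
  refine ⟨E ^ Fintype.card G.L, by positivity, fun m T μ y hy => ?_⟩
  have hfac : 0 ≤ factorProd D Ω m y.2.2 :=
    Finset.prod_nonneg fun l _ => (propFactor_pos D m hΩ (sliceSet_pos hM (hy l))).le
  have h1 : (∏ l, (1 + M ^ μ l * ‖y.1 l‖) ^ r) *
      Real.exp (-∑ l, propShort Ω (y.2.2 l) * ‖y.1 l‖ ^ 2) ≤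
      E ^ Fintype.card G.L * ∏ l, Real.exp (-(c / 2 * (M ^ μ l * ‖y.1 l‖) ^ 2)) := by
    rw [← Finset.sum_neg_distrib, Real.exp_sum, ← Finset.prod_mul_distrib, ← Finset.card_univ,
      ← Finset.prod_const, ← Finset.prod_mul_distrib]
    refine Finset.prod_le_prod (fun l _ => by positivity) fun l _ => ?_
    refine le_trans ?_ (habs (M ^ μ l * ‖y.1 l‖) (by positivity))
    refine mul_le_mul_of_nonneg_left (Real.exp_le_exp.2 (neg_le_neg ?_)) (by positivity)
    rw [mul_pow, ← mul_assoc]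
    exact mul_le_mul_of_nonneg_right (hcoef _ _ (hy l)).1 (sq_nonneg _)
  have h2 : Real.exp (-(1 / 2 * expLoop Ω T y)) ≤
      gaussLong M (c / 4) μ y.2.1 *
        ∏ l, Real.exp (c / 4 * (M ^ μ l * ‖y.1 l‖) ^ 2) := by
    have h3 : ∏ l : {l : G.L // l ∉ T}, Real.exp (c / 4 * (M ^ μ l.1 * ‖y.1 l.1‖) ^ 2) ≤
        ∏ l, Real.exp (c / 4 * (M ^ μ l * ‖y.1 l‖) ^ 2) := by
      rw [← Finset.prod_subtype (Finset.univ.filter fun l => l ∉ T) (by simp)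
        (fun l => Real.exp (c / 4 * (M ^ μ l * ‖y.1 l‖) ^ 2))]
      rw [← Real.exp_sum, ← Real.exp_sum]
      exact Real.exp_le_exp.2 (Finset.sum_le_sum_of_subset_of_nonneg (Finset.filter_subset _ _)
        fun l _ _ => by positivity)
    refine le_trans ?_ (mul_le_mul_of_nonneg_left h3 (Finset.prod_nonneg fun l _ => by positivity))
    unfold expLoop gaussLong
    rw [Finset.mul_sum, ← Finset.sum_neg_distrib, Real.exp_sum, ← Finset.prod_mul_distrib]
    refine Finset.prod_le_prod (fun l _ => by positivity) fun l _ => ?_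
    rw [← Real.exp_add]
    refine Real.exp_le_exp.2 ?_
    set Λ := M ^ μ l.1
    have hΛ : 1 ≤ Λ := one_le_pow₀ hM.le
    have hlong : c * (Λ ^ 2)⁻¹ ≤ propLong Ω (y.2.2 l.1) := (hcoef _ _ (hy l.1)).2.2.1
    have hn : 2 * ‖y.2.1 l‖ ^ 2 - ‖y.1 l.1‖ ^ 2 ≤ ‖y.1 l.1 - (2 : ℝ) • y.2.1 l‖ ^ 2 := by
      have h5 : ‖(2 : ℝ) • y.2.1 l‖ ≤ ‖y.1 l.1 - (2 : ℝ) • y.2.1 l‖ + ‖y.1 l.1‖ := by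
        have := norm_sub_le (y.1 l.1) (y.1 l.1 - (2 : ℝ) • y.2.1 l)
        rw [sub_sub_cancel] at this
        linarith
      rw [norm_smul, Real.norm_of_nonneg (by norm_num)] at h5
      nlinarith [sq_nonneg (‖y.1 l.1 - (2 : ℝ) • y.2.1 l‖ - ‖y.1 l.1‖), norm_nonneg (y.2.1 l),
        norm_nonneg (y.1 l.1 - (2 : ℝ) • y.2.1 l), norm_nonneg (y.1 l.1)]
    have hinv : 0 < (Λ ^ 2)⁻¹ := by positivity
    -- Since Λ ≥ 1, the error of order Λ⁻²|u|² can be charged to the strong Gaussian in u.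
    have hinv' : (Λ ^ 2)⁻¹ ≤ Λ ^ 2 :=
      (inv_le_one_of_one_le₀ (one_le_pow₀ hΛ)).trans (one_le_pow₀ hΛ)
    have h6 := mul_le_mul_of_nonneg_right hlong (sq_nonneg ‖y.1 l.1 - (2 : ℝ) • y.2.1 l‖)
    have h7 := mul_le_mul_of_nonneg_left hn (by positivity : 0 ≤ c * (Λ ^ 2)⁻¹)
    have h8 := mul_le_mul_of_nonneg_left
      (mul_le_mul_of_nonneg_right hinv' (sq_nonneg ‖y.1 l.1‖)) hc.le
    rw [inv_pow, mul_pow]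
    have h9 : 0 ≤ c * (Λ ^ 2)⁻¹ * ‖y.2.1 l‖ ^ 2 := by positivity
    have h10 : 0 ≤ c * (Λ ^ 2)⁻¹ * ‖y.1 l.1 - (2 : ℝ) • y.2.1 l‖ ^ 2 := by positivity
    have h11 : c * (Λ ^ 2)⁻¹ * (2 * ‖y.2.1 l‖ ^ 2 - ‖y.1 l.1‖ ^ 2) =
      2 * (c * (Λ ^ 2)⁻¹ * ‖y.2.1 l‖ ^ 2) - c * ((Λ ^ 2)⁻¹ * ‖y.1 l.1‖ ^ 2) := by ring
    linarith
  have h3 : (∏ l, Real.exp (-(c / 2 * (M ^ μ l * ‖y.1 l‖) ^ 2))) *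
      ∏ l, Real.exp (c / 4 * (M ^ μ l * ‖y.1 l‖) ^ 2) = gaussShort M (c / 4) μ y.1 := by
    unfold gaussShort
    rw [← Finset.prod_mul_distrib]
    refine Finset.prod_congr rfl fun l _ => ?_
    rw [← Real.exp_add]
    congr 1
    ring
  have hgl : 0 ≤ gaussLong M (c / 4) μ y.2.1 := Finset.prod_nonneg fun l _ => (Real.exp_pos _).le
  calc _ = factorProd D Ω m y.2.2 * ((∏ l, (1 + M ^ μ l * ‖y.1 l‖) ^ r) *
        Real.exp (-∑ l, propShort Ω (y.2.2 l) * ‖y.1 l‖ ^ 2)) *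
          Real.exp (-(1 / 2 * expLoop Ω T y)) := by
        unfold outerFactor
        ring
    _ ≤ factorProd D Ω m y.2.2 * (E ^ Fintype.card G.L *
        ∏ l, Real.exp (-(c / 2 * (M ^ μ l * ‖y.1 l‖) ^ 2))) * (gaussLong M (c / 4) μ y.2.1 *
        ∏ l, Real.exp (c / 4 * (M ^ μ l * ‖y.1 l‖) ^ 2)) := by
        refine mul_le_mul (mul_le_mul_of_nonneg_left h1 hfac) h2 (Real.exp_pos _).le ?_
        exact mul_nonneg hfac (mul_nonneg (by positivity)
          (Finset.prod_nonneg fun l _ => (Real.exp_pos _).le))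
    _ = E ^ Fintype.card G.L * dominant Ω m M (c / 4) μ T y := by
        rw [dominant, ← h3]
        ring

end integrand

end FeynmanGraph

/-! ### Bounds on the derivatives of the integrand -/

namespace FeynmanGraph

section estimate

variable {D : ℕ} {G : FeynmanGraph}

/-- The weight of the external momenta in the bound on the derivatives of order `r`. -/
noncomputable def legWeight {e₀ : G.X} (φ : 𝓢(EuclideanSpace ℝ (Fin D), ℝ)) (r : ℕ)
    (k : {e : G.X // e ≠ e₀} → EuclideanSpace ℝ (Fin D)) : ℝ :=
  ∏ e, ((1 + ‖k e‖) ^ r * ‖hat φ.toComplex (k e)‖)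

theorem integrable_legWeight {e₀ : G.X} (φ : 𝓢(EuclideanSpace ℝ (Fin D), ℝ)) (r : ℕ) :
    Integrable (legWeight (e₀ := e₀) φ r) :=
  Integrable.fintype_prod (f := fun (_ : {e : G.X // e ≠ e₀}) k =>
    (1 + ‖k‖) ^ r * ‖hat φ.toComplex k‖) fun _ => integrable_hat_weight _ r

theorem norm_le_prod_one_add {ι E : Type*} [Fintype ι] [SeminormedAddCommGroup E] (k : ι → E) :
    ‖k‖ ≤ ∏ i, (1 + ‖k i‖) := by
  have h := sum_le_prod_one_add Finset.univ (fun i => ‖k i‖) fun i => norm_nonneg _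
  refine (pi_norm_le_iff_of_nonneg ((by positivity : (0:ℝ) ≤ 1 + ∑ i, ‖k i‖).trans h)).2 fun i => ?_
  refine le_trans ?_ h
  have := Finset.single_le_sum (f := fun i => ‖k i‖) (fun i _ => norm_nonneg _) (Finset.mem_univ i)
  linarith

/-- A sum of the variables `u` is small with the lowest scale. -/
theorem norm_sum_le_prod {M : ℝ} (hM : 1 < M) {μ : G.L → ℕ} {i : ℕ} (hi : ∀ l, i ≤ μ l)
    (u : G.L → EuclideanSpace ℝ (Fin D)) :
    ‖∑ l, u l‖ ≤ (M ^ i)⁻¹ * ∏ l, (1 + M ^ μ l * ‖u l‖) := by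
  have h := sum_le_prod_one_add Finset.univ (fun l => M ^ μ l * ‖u l‖) fun l => by positivity
  have h0 : 0 < M ^ i := by positivity
  calc ‖∑ l, u l‖ ≤ ∑ l, ‖u l‖ := norm_sum_le _ _
    _ ≤ ∑ l, (M ^ i)⁻¹ * (M ^ μ l * ‖u l‖) := by
        refine Finset.sum_le_sum fun l _ => ?_
        rw [← mul_assoc]
        refine le_mul_of_one_le_left (norm_nonneg _) ?_
        rw [inv_mul_eq_div, one_le_div h0]
        exact pow_le_pow_right₀ hM.le (hi l)
    _ = (M ^ i)⁻¹ * ∑ l, M ^ μ l * ‖u l‖ := by rw [Finset.mul_sum]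
    _ ≤ _ := mul_le_mul_of_nonneg_left (by linarith) (by positivity)

/-- Only the weak coefficients, of order M^(-2μ(l)) ≤ M^(-2i), occur, and the routed external
momentum is at most a constant times ‖k‖. The root is what one derivative of the Gaussian in t
brings. -/
theorem exists_sqrt_expQuad_bound {Ω M : ℝ} (hΩ : 0 < Ω) (hM : 1 < M) (D : ℕ) (e₀ : G.X)
    {T : Finset G.L} (hT : G.IsSpanningTree T) :
    ∃ C : ℝ, 0 ≤ C ∧ ∀ (μ : G.L → ℕ) (i : ℕ), (∀ l, i ≤ μ l) →
      ∀ (k : {e : G.X // e ≠ e₀} → EuclideanSpace ℝ (Fin D)) (τ : G.L → ℝ),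
        (∀ l, τ l ∈ sliceSet M (μ l)) →
        Real.sqrt (expQuad Ω e₀ T k k τ) ≤ C * ((M ^ i)⁻¹ * ‖k‖) := by
  obtain ⟨c, C, hc, hC, hcoef⟩ := exists_coefficient_bounds hΩ hM
  obtain ⟨R, hR, hroute⟩ := exists_route_bound D e₀ hT
  have hM0 : 0 < M := by positivity
  refine ⟨Real.sqrt (Fintype.card G.L * (C * 4 * R ^ 2)), Real.sqrt_nonneg _, ?_⟩
  intro μ i hi k τ hτ
  rw [← Real.sqrt_sq (by positivity : 0 ≤ (M ^ i)⁻¹ * ‖k‖), ← Real.sqrt_mul (by positivity)]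
  refine Real.sqrt_le_sqrt ?_
  unfold expQuad
  calc _ ≤ ∑ l : G.L, C * 4 * R ^ 2 * ((M ^ i)⁻¹ * ‖k‖) ^ 2 := by
        refine Finset.sum_le_sum fun l _ => ?_
        rw [real_inner_self_eq_norm_sq]
        have h1 : propLong Ω (τ l) ≤ C * ((M ^ i) ^ 2)⁻¹ := by
          refine (hcoef _ _ (hτ l)).2.2.2.trans (mul_le_mul_of_nonneg_left ?_ hC.le)
          gcongr
          · exact hM.le
          · exact hi l
        have h2 : ‖G.route e₀ T k 0 0 l‖ ≤ R * ‖k‖ := by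
          refine (hroute k 0 0 l).trans ?_
          simp
        calc propLong Ω (τ l) * (4 * ‖G.route e₀ T k 0 0 l‖ ^ 2)
            ≤ C * ((M ^ i) ^ 2)⁻¹ * (4 * (R * ‖k‖) ^ 2) := by gcongr
          _ = _ := by
            rw [mul_pow, mul_pow, inv_pow]
            ring
    _ = _ := by
        rw [Finset.sum_const, Finset.card_univ, nsmul_eq_mul]
        ring

/-- The derivatives of the integrand in the scaling parameter. -/
theorem exists_fullIntegrand_derivBound {Ω M : ℝ} (hΩ : 0 < Ω) (hM : 1 < M) (D : ℕ) (e₀ : G.X)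
    {T : Finset G.L} (hT : G.IsSpanningTree T) :
    ∃ c : ℝ, 0 < c ∧ ∀ φ : 𝓢(EuclideanSpace ℝ (Fin D), ℝ),
      ∃ H : ℕ → ℝ, (∀ r, 0 ≤ H r) ∧ ∀ (m : ℝ) (μ : G.L → ℕ) (i : ℕ), (∀ l, i ≤ μ l) →
        ∀ z : ({e : G.X // e ≠ e₀} → EuclideanSpace ℝ (Fin D)) ×
          ((G.L → EuclideanSpace ℝ (Fin D)) ×
            (({l : G.L // l ∉ T} → EuclideanSpace ℝ (Fin D)) × (G.L → ℝ))),
        (∀ l, z.2.2.2 l ∈ sliceSet M (μ l)) →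
        DerivBound (fun t => fullIntegrand Ω m e₀ T φ t z) fun r =>
          H r * ((M ^ i)⁻¹) ^ r * (legWeight φ r z.1 * dominant Ω m M c μ T z.2) := by
  have hM0 : 0 < M := by positivity
  obtain ⟨C₁, hC₁, hsqrt⟩ := exists_sqrt_expQuad_bound hΩ hM D e₀ hT
  obtain ⟨c, hc, hout⟩ := exists_outerFactor_bound hΩ hM D G
  choose E hE hout using hout
  obtain ⟨A, hA, hgauss⟩ := exists_gaussian_derivBound
  refine ⟨c, hc, fun φ => ?_⟩
  obtain ⟨B, hB, hhat⟩ := exists_hat_derivBound φ.toComplex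
  refine ⟨fun r => (∑ j ∈ Finset.range (r + 1), (r.choose j : ℝ) * A j * B (r - j)) *
    (1 + C₁) ^ r * E r, fun r => ?_, ?_⟩
  · have : 0 ≤ ∑ j ∈ Finset.range (r + 1), (r.choose j : ℝ) * A j * B (r - j) :=
      Finset.sum_nonneg fun j _ => mul_nonneg (mul_nonneg (by positivity) (hA _)) (hB _)
    have := (hE r).le
    positivity
  intro m μ i hi z hz
  set p := ∏ l, (1 + M ^ μ l * ‖z.2.1 l‖) with hp
  set q := ∏ e, (1 + ‖z.1 e‖) with hq
  have hp1 : 1 ≤ p := (le_add_of_nonneg_right (by positivity)).trans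
    (sum_le_prod_one_add Finset.univ (fun l => M ^ μ l * ‖z.2.1 l‖) fun l => by positivity)
  have hq1 : 1 ≤ q := (le_add_of_nonneg_right (by positivity)).trans
    (sum_le_prod_one_add Finset.univ (fun e => ‖z.1 e‖) fun e => norm_nonneg _)
  have hMi : 0 < (M ^ i)⁻¹ := by positivity
  -- A common scale for the two factors of the integrand: the root of `expQuad` is at most C₁ M^(-i)
  -- q and the norm of ∑ u at most M^(-i) p, while p and q are at least 1.
  set ρ := (M ^ i)⁻¹ * ((1 + C₁) * q * p) with hρ
  have hρ0 : 0 ≤ ρ := by positivity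
  have hlong : ∀ l, 0 ≤ propLong Ω (z.2.2.2 l) := fun l =>
    propLong_nonneg hΩ (sliceSet_pos hM (hz l))
  have hα := expQuad_nonneg e₀ (T := T) z.1 z.2.2.2 hlong
  have hzero : expLoop Ω T z.2 ≤ expZero Ω e₀ T z.2 := by
    have := expLoop_le e₀ hT z.1 z.2 hlong 0
    simpa using this
  have h1 := (hgauss _ _ _ _ hα (expLin_sq_le e₀ hT z.1 z.2 hlong) hzero).mono
    (C := fun r => Real.exp (-expLoop Ω T z.2) * (A r * ρ ^ r)) fun r => by
      have : Real.sqrt (expQuad Ω e₀ T z.1 z.1 z.2.2.2) ≤ ρ := by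
        refine (hsqrt μ i hi z.1 _ hz).trans ?_
        have h2 : ‖z.1‖ ≤ q := norm_le_prod_one_add z.1
        calc C₁ * ((M ^ i)⁻¹ * ‖z.1‖) ≤ (1 + C₁) * ((M ^ i)⁻¹ * q) := by
              gcongr
              linarith
          _ ≤ (1 + C₁) * ((M ^ i)⁻¹ * q) * p := le_mul_of_one_le_right (by positivity) hp1
          _ = ρ := by rw [hρ]; ring
      have := hA r
      gcongr
  have h2 := (hhat (∑ l, z.2.1 l) (∑ e, z.1 e)).mono (C := fun r => 1 * (B r * ρ ^ r)) fun r => by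
      have : ‖∑ l, z.2.1 l‖ ≤ ρ := by
        refine (norm_sum_le_prod hM hi z.2.1).trans ?_
        rw [hρ]
        refine mul_le_mul_of_nonneg_left ?_ hMi.le
        refine le_mul_of_one_le_left (by positivity) ?_
        nlinarith
      have := hB r
      rw [one_mul]
      gcongr
  have h3 := (DerivBound.mul (Real.exp_pos _).le hρ0 hA h1 h2).const_mul
    ((outerFactor Ω m T z.2 : ℂ) * ∏ e, hat φ.toComplex (z.1 e))
  have e : (fun t => fullIntegrand Ω m e₀ T φ t z) = fun t =>
      (outerFactor Ω m T z.2 : ℂ) * (∏ e, hat φ.toComplex (z.1 e)) *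
      ((Real.exp (-(expQuad Ω e₀ T z.1 z.1 z.2.2.2 * t ^ 2 - 2 * expLin Ω e₀ T z.1 z.2 * t +
        expZero Ω e₀ T z.2)) : ℝ) * hat φ.toComplex (t • ∑ l, z.2.1 l - ∑ e, z.1 e)) := by
    funext t
    rw [fullIntegrand, kernelProd_smul_eq Ω m e₀ hT, Complex.ofReal_mul]
    ring
  rw [e]
  refine h3.mono fun r => ?_
  have hof : 0 ≤ outerFactor Ω m T z.2 := mul_nonneg
    (Finset.prod_nonneg fun l _ => (propFactor_pos D m hΩ (sliceSet_pos hM (hz l))).le)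
    (Real.exp_pos _).le
  have hS : 0 ≤ ∑ j ∈ Finset.range (r + 1), (r.choose j : ℝ) * A j * B (r - j) :=
    Finset.sum_nonneg fun j _ => mul_nonneg (mul_nonneg (by positivity) (hA _)) (hB _)
  have hloop : 0 ≤ expLoop Ω T z.2 :=
    Finset.sum_nonneg fun l _ => mul_nonneg (hlong _) (sq_nonneg _)
  -- Half of the loop decay is enough for the domination; the other half is discarded.
  have h4 : p ^ r * (outerFactor Ω m T z.2 * Real.exp (-expLoop Ω T z.2)) ≤
      E r * dominant Ω m M c μ T z.2 := by
    refine le_trans ?_ (hout r m T μ z.2 hz)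
    rw [hp, ← Finset.prod_pow]
    refine mul_le_mul_of_nonneg_left (mul_le_mul_of_nonneg_left (Real.exp_le_exp.2 ?_) hof)
      (Finset.prod_nonneg fun l _ => by positivity)
    linarith
  have h5 : legWeight φ r z.1 = q ^ r * ∏ e, ‖hat φ.toComplex (z.1 e)‖ := by
    rw [legWeight, Finset.prod_mul_distrib, hq, Finset.prod_pow]
  rw [norm_mul, Complex.norm_real, Real.norm_of_nonneg hof, norm_prod, h5, mul_one]
  calc _ = (∑ j ∈ Finset.range (r + 1), (r.choose j : ℝ) * A j * B (r - j)) * (1 + C₁) ^ r *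
        ((M ^ i)⁻¹) ^ r * (q ^ r * ∏ e, ‖hat φ.toComplex (z.1 e)‖) *
        (p ^ r * (outerFactor Ω m T z.2 * Real.exp (-expLoop Ω T z.2))) := by
        rw [hρ, mul_pow, mul_pow, mul_pow]
        ring
    _ ≤ (∑ j ∈ Finset.range (r + 1), (r.choose j : ℝ) * A j * B (r - j)) * (1 + C₁) ^ r *
        ((M ^ i)⁻¹) ^ r * (q ^ r * ∏ e, ‖hat φ.toComplex (z.1 e)‖) *
        (E r * dominant Ω m M c μ T z.2) := by
        refine mul_le_mul_of_nonneg_left h4 ?_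
        have : 0 ≤ ∏ e, ‖hat φ.toComplex (z.1 e)‖ := Finset.prod_nonneg fun e _ => norm_nonneg _
        positivity
    _ = _ := by ring

theorem kernelProd_nonneg {Ω M : ℝ} (hΩ : 0 < Ω) (hM : 1 < M) (m : ℝ) (e₀ : G.X)
    {T : Finset G.L} {μ : G.L → ℕ}
    (k : {e : G.X // e ≠ e₀} → EuclideanSpace ℝ (Fin D))
    {y : (G.L → EuclideanSpace ℝ (Fin D)) ×
      (({l : G.L // l ∉ T} → EuclideanSpace ℝ (Fin D)) × (G.L → ℝ))}
    (hy : ∀ l, y.2.2 l ∈ sliceSet M (μ l)) : 0 ≤ kernelProd Ω m e₀ T k y := by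
  rw [kernelProd_eq]
  exact mul_nonneg (mul_nonneg
    (Finset.prod_nonneg fun l _ => (propFactor_pos D m hΩ (sliceSet_pos hM (hy l))).le)
    (Real.exp_pos _).le) (Real.exp_pos _).le

theorem exists_kernelProd_bound {Ω M : ℝ} (hΩ : 0 < Ω) (hM : 1 < M) (D : ℕ) (e₀ : G.X)
    {T : Finset G.L} (hT : G.IsSpanningTree T) :
    ∃ c E : ℝ, 0 < c ∧ 0 < E ∧ ∀ (m : ℝ) (μ : G.L → ℕ)
      (k : {e : G.X // e ≠ e₀} → EuclideanSpace ℝ (Fin D))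
      (y : (G.L → EuclideanSpace ℝ (Fin D)) ×
        (({l : G.L // l ∉ T} → EuclideanSpace ℝ (Fin D)) × (G.L → ℝ))),
      (∀ l, y.2.2 l ∈ sliceSet M (μ l)) →
        kernelProd Ω m e₀ T k y ≤ E * dominant Ω m M c μ T y := by
  obtain ⟨c, hc, hout⟩ := exists_outerFactor_bound hΩ hM D G
  obtain ⟨E, hE, hout⟩ := hout 0
  refine ⟨c, E, hc, hE, fun m μ k y hy => ?_⟩
  have hof : 0 ≤ outerFactor Ω m T y := mul_nonneg
    (Finset.prod_nonneg fun l _ => (propFactor_pos D m hΩ (sliceSet_pos hM (hy l))).le)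
    (Real.exp_pos _).le
  have hlong : ∀ l, 0 ≤ propLong Ω (y.2.2 l) := fun l =>
    propLong_nonneg hΩ (sliceSet_pos hM (hy l))
  have hloop : 0 ≤ expLoop Ω T y :=
    Finset.sum_nonneg fun l _ => mul_nonneg (hlong _) (sq_nonneg _)
  refine le_trans ?_ (hout m T μ y hy)
  have h := kernelProd_smul_eq Ω m e₀ hT k y 1
  rw [one_smul] at h
  rw [h]
  simp only [pow_zero, Finset.prod_const_one, one_mul]
  refine mul_le_mul_of_nonneg_left (Real.exp_le_exp.2 ?_) hof
  have := expLoop_le e₀ hT k y hlong 1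
  linarith

theorem measurable_kernelProd (Ω m : ℝ) (e₀ : G.X) {T : Finset G.L} (hT : G.IsSpanningTree T) :
    Measurable fun z : ({e : G.X // e ≠ e₀} → EuclideanSpace ℝ (Fin D)) ×
      ((G.L → EuclideanSpace ℝ (Fin D)) ×
        (({l : G.L // l ∉ T} → EuclideanSpace ℝ (Fin D)) × (G.L → ℝ))) =>
      kernelProd Ω m e₀ T z.1 z.2 := by
  have hF := measurable_propFactor D Ω m
  have hS := measurable_propShort Ω
  have hL := measurable_propLong Ω
  have hR : ∀ l, Measurable fun z : ({e : G.X // e ≠ e₀} → EuclideanSpace ℝ (Fin D)) ×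
      ((G.L → EuclideanSpace ℝ (Fin D)) ×
        (({l : G.L // l ∉ T} → EuclideanSpace ℝ (Fin D)) × (G.L → ℝ))) =>
      G.route e₀ T z.1 z.2.1 z.2.2.1 l := fun l =>
    (((continuous_apply l).comp (continuous_route e₀ hT)).comp
      (continuous_fst.prodMk (continuous_snd.fst.prodMk continuous_snd.snd.fst))).measurable
  simp_rw [kernelProd_eq]
  unfold outerFactor factorProd
  fun_prop

theorem measurable_fullIntegrand (Ω m : ℝ) (e₀ : G.X) {T : Finset G.L} (hT : G.IsSpanningTree T)
    (φ : 𝓢(EuclideanSpace ℝ (Fin D), ℝ)) (t : ℝ) :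
    Measurable (fullIntegrand Ω m e₀ T φ t) := by
  have h0 : Measurable fun z : ({e : G.X // e ≠ e₀} → EuclideanSpace ℝ (Fin D)) ×
      ((G.L → EuclideanSpace ℝ (Fin D)) ×
        (({l : G.L // l ∉ T} → EuclideanSpace ℝ (Fin D)) × (G.L → ℝ))) => (t • z.1, z.2) := by
    fun_prop
  have h := (measurable_kernelProd (D := D) Ω m e₀ hT).comp h0
  have hh := (continuous_hat φ.toComplex).measurable
  unfold fullIntegrand
  have h' := Complex.measurable_ofReal.comp h
  refine (h'.mul ?_).mul ?_
  · fun_prop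
  · fun_prop

end estimate

end FeynmanGraph

/-! ### Fubini, power counting of the derivatives, and the bound on the rest -/

namespace FeynmanGraph

section fubini

variable {D : ℕ} {G : FeynmanGraph}

theorem IsSpanningTree.isConnected {T : Finset G.L} (hT : G.IsSpanningTree T) :
    G.IsConnected := by
  refine hT.1.mono fun v w h => ?_
  simp only [skeleton, SimpleGraph.fromRel_adj] at h ⊢
  exact ⟨h.1, h.2.imp (fun ⟨l, _, h⟩ => ⟨l, Finset.mem_univ l, h⟩)
    fun ⟨l, _, h⟩ => ⟨l, Finset.mem_univ l, h⟩⟩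

theorem ae_innerMeasure (M : ℝ) (μ : G.L → ℕ) (T : Finset G.L) :
    ∀ᵐ y ∂(innerMeasure D M μ T), ∀ l, y.2.2 l ∈ sliceSet M (μ l) := by
  have h1 : Measure.QuasiMeasurePreserving (fun y : (G.L → EuclideanSpace ℝ (Fin D)) ×
      (({l : G.L // l ∉ T} → EuclideanSpace ℝ (Fin D)) × (G.L → ℝ)) => y.2.2)
      (innerMeasure D M μ T) (sliceMeasure M μ) :=
    Measure.quasiMeasurePreserving_snd.comp Measure.quasiMeasurePreserving_snd
  exact h1.ae (ae_sliceMeasure M μ)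

/-- The constant in front of the product of the integrals of the kernels. -/
noncomputable def lineConst (D : ℕ) (Ω : ℝ) (G : FeynmanGraph) : ℝ :=
  ((2 * Real.pi / Ω) ^ ((D : ℝ) / 2)) ^ Fintype.card G.L

theorem lineConst_pos (D : ℕ) {Ω : ℝ} (hΩ : 0 < Ω) (G : FeynmanGraph) : 0 < lineConst D Ω G := by
  unfold lineConst
  have := Real.pi_pos
  positivity

theorem lineProduct_eq (Ω m M : ℝ) (μ : G.L → ℕ) (e₀ : G.X) (T : Finset G.L)
    (k : {e : G.X // e ≠ e₀} → EuclideanSpace ℝ (Fin D)) (u : G.L → EuclideanSpace ℝ (Fin D))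
    (w : {l : G.L // l ∉ T} → EuclideanSpace ℝ (Fin D)) :
    lineProduct Ω m M G μ e₀ T k u w =
      lineConst D Ω G * ∫ τ, kernelProd Ω m e₀ T k (u, (w, τ)) ∂(sliceMeasure M μ) := by
  unfold lineProduct propSlice kernelProd lineConst sliceMeasure
  rw [integral_fintype_prod_eq_prod (fun l t => propKernel Ω m t
    (u l - G.route e₀ T k u w l) (G.route e₀ T k u w l)), Finset.prod_mul_distrib,
    Finset.prod_const, Finset.card_univ]

variable {Ω M : ℝ} {e₀ : G.X} {T : Finset G.L}

theorem integrable_kernelProd (hΩ : 0 < Ω) (hM : 1 < M) (m : ℝ) (hD : Nonempty G.L → 1 ≤ D)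
    (hT : G.IsSpanningTree T) (μ : G.L → ℕ)
    (k : {e : G.X // e ≠ e₀} → EuclideanSpace ℝ (Fin D)) :
    Integrable (kernelProd Ω m e₀ T k) (innerMeasure D M μ T) := by
  obtain ⟨c, E, hc, hE, h⟩ := exists_kernelProd_bound hΩ hM D e₀ hT
  obtain ⟨C, -, hdom⟩ := exists_dominant_bound (D := D) m hD hΩ hM hc T
  refine ((hdom μ).1.const_mul E).mono'
    ((measurable_kernelProd Ω m e₀ hT).comp measurable_prodMk_left).aestronglyMeasurable ?_
  filter_upwards [ae_innerMeasure M μ T] with y hy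
  rw [Real.norm_of_nonneg (kernelProd_nonneg hΩ hM m e₀ k hy)]
  exact h m μ k y hy

/-- Fubini's theorem applied to `integrable_kernelProd` would give this for almost every u only. The
reduced amplitude is required at every u, whence the separate domination. -/
theorem integrable_kernelProd_right (hΩ : 0 < Ω) (hM : 1 < M) (m : ℝ) (hD : Nonempty G.L → 1 ≤ D)
    (hT : G.IsSpanningTree T) (μ : G.L → ℕ)
    (k : {e : G.X // e ≠ e₀} → EuclideanSpace ℝ (Fin D)) (u : G.L → EuclideanSpace ℝ (Fin D)) :
    Integrable (fun x : ({l : G.L // l ∉ T} → EuclideanSpace ℝ (Fin D)) × (G.L → ℝ) =>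
      kernelProd Ω m e₀ T k (u, x)) (volume.prod (sliceMeasure M μ)) := by
  obtain ⟨c, E, hc, hE, h⟩ := exists_kernelProd_bound hΩ hM D e₀ hT
  obtain ⟨C, -, hfac⟩ := exists_factorProd_bound (D := D) (G := G) m hD hΩ hM
  have h1 := (((integrable_gaussLong (D := D) hM hc μ T).mul_prod
    (hfac μ).1).const_mul (gaussShort M c μ u)).const_mul E
  refine h1.mono' ((measurable_kernelProd Ω m e₀ hT).comp
    (measurable_prodMk_left.comp measurable_prodMk_left)).aestronglyMeasurable ?_
  have hae : ∀ᵐ x ∂((volume : Measure ({l : G.L // l ∉ T} → EuclideanSpace ℝ (Fin D))).prod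
      (sliceMeasure M μ)), ∀ l, x.2 l ∈ sliceSet M (μ l) :=
    Measure.quasiMeasurePreserving_snd.ae (ae_sliceMeasure M μ)
  filter_upwards [hae] with x hx
  rw [Real.norm_of_nonneg (kernelProd_nonneg hΩ hM m e₀ k hx)]
  exact h m μ k (u, x) hx

theorem integrable_lineProduct (hΩ : 0 < Ω) (hM : 1 < M) (m : ℝ) (hD : Nonempty G.L → 1 ≤ D)
    (hT : G.IsSpanningTree T) (μ : G.L → ℕ)
    (k : {e : G.X // e ≠ e₀} → EuclideanSpace ℝ (Fin D)) (u : G.L → EuclideanSpace ℝ (Fin D)) :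
    Integrable (fun w => lineProduct Ω m M G μ e₀ T k u w) := by
  simp_rw [lineProduct_eq]
  exact ((integrable_kernelProd_right hΩ hM m hD hT μ k u).integral_prod_left).const_mul _

theorem reducedAmp_eq (hΩ : 0 < Ω) (hM : 1 < M) (m : ℝ) (hD : Nonempty G.L → 1 ≤ D)
    (hT : G.IsSpanningTree T) (μ : G.L → ℕ)
    (k : {e : G.X // e ≠ e₀} → EuclideanSpace ℝ (Fin D)) (u : G.L → EuclideanSpace ℝ (Fin D)) :
    reducedAmp Ω m M G μ e₀ T k u =
      lineConst D Ω G * ∫ x, kernelProd Ω m e₀ T k (u, x) ∂(volume.prod (sliceMeasure M μ)) := by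
  unfold reducedAmp
  simp_rw [lineProduct_eq]
  rw [integral_const_mul, integral_prod _ (integrable_kernelProd_right hΩ hM m hD hT μ k u)]

theorem integrableOn_propKernel (hΩ : 0 < Ω) (hM : 1 < M) (m : ℝ) (hD : 1 ≤ D) (i : ℕ)
    (p q : EuclideanSpace ℝ (Fin D)) :
    IntegrableOn (fun t => propKernel Ω m t p q) (sliceSet M i) := by
  obtain ⟨C, -, h⟩ := exists_propFactor_bound hD m hΩ hM
  simp_rw [propKernel_eq]
  refine (h i).1.mono' ?_ ?_
  · have hF := measurable_propFactor D Ω m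
    have hS := measurable_propShort Ω
    have hL := measurable_propLong Ω
    exact Measurable.aestronglyMeasurable (by fun_prop)
  · refine (ae_restrict_mem (measurableSet_sliceSet M i)).mono fun t ht => ?_
    have ht0 := sliceSet_pos hM ht
    have hf := (propFactor_pos D m hΩ ht0).le
    rw [Real.norm_of_nonneg (mul_nonneg hf (Real.exp_pos _).le)]
    refine mul_le_of_le_one_right hf (Real.exp_le_one_iff.2 ?_)
    have := mul_nonneg (propShort_nonneg hΩ ht0) (sq_nonneg ‖p + q‖)
    have := mul_nonneg (propLong_nonneg hΩ ht0) (sq_nonneg ‖p - q‖)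
    linarith

/-- The measure on all the variables of the scaled amplitude. -/
noncomputable def fullMeasure (D : ℕ) (M : ℝ) (μ : G.L → ℕ) (e₀ : G.X) (T : Finset G.L) :
    Measure (({e : G.X // e ≠ e₀} → EuclideanSpace ℝ (Fin D)) ×
      ((G.L → EuclideanSpace ℝ (Fin D)) ×
        (({l : G.L // l ∉ T} → EuclideanSpace ℝ (Fin D)) × (G.L → ℝ)))) :=
  volume.prod (innerMeasure D M μ T)

theorem ae_fullMeasure (M : ℝ) (μ : G.L → ℕ) (e₀ : G.X) (T : Finset G.L) :
    ∀ᵐ z ∂(fullMeasure D M μ e₀ T), ∀ l, z.2.2.2 l ∈ sliceSet M (μ l) :=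
  Measure.quasiMeasurePreserving_snd.ae (ae_innerMeasure M μ T)

/-- The bounds on the derivatives of the integrand are integrable, and their integrals scale as
expected. -/
theorem exists_integrated_bound (hΩ : 0 < Ω) (hM : 1 < M) (m : ℝ) (hD : Nonempty G.L → 1 ≤ D)
    (hT : G.IsSpanningTree T) (φ : 𝓢(EuclideanSpace ℝ (Fin D), ℝ)) :
    ∃ K : ℕ → ℝ, (∀ r, 0 ≤ K r) ∧ ∀ (μ : G.L → ℕ) (i : ℕ), (∀ l, i ≤ μ l) →
      ∃ b : ℕ → (({e : G.X // e ≠ e₀} → EuclideanSpace ℝ (Fin D)) ×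
        ((G.L → EuclideanSpace ℝ (Fin D)) ×
          (({l : G.L // l ∉ T} → EuclideanSpace ℝ (Fin D)) × (G.L → ℝ)))) → ℝ,
        (∀ r, Integrable (b r) (fullMeasure D M μ e₀ T)) ∧
        (∀ᵐ z ∂(fullMeasure D M μ e₀ T),
          DerivBound (fun t => fullIntegrand Ω m e₀ T φ t z) fun r => b r z) ∧
        ∀ r, ∫ z, b r z ∂(fullMeasure D M μ e₀ T) ≤
          K r * (((M ^ i)⁻¹) ^ r * ∏ l, M ^ (lineExp D T l * μ l)) := by
  obtain ⟨c, hc, h⟩ := exists_fullIntegrand_derivBound hΩ hM D e₀ hT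
  obtain ⟨H, hH, h⟩ := h φ
  obtain ⟨C, hC, hdom⟩ := exists_dominant_bound (D := D) m hD hΩ hM hc T
  have hw : ∀ r, 0 ≤ ∫ k, legWeight (e₀ := e₀) φ r k := fun r =>
    integral_nonneg fun k => Finset.prod_nonneg fun e _ => by positivity
  refine ⟨fun r => H r * (∫ k, legWeight (e₀ := e₀) φ r k) * C, fun r => ?_, ?_⟩
  · have := hH r
    have := hw r
    positivity
  intro μ i hi
  refine ⟨fun r z => H r * ((M ^ i)⁻¹) ^ r * (legWeight φ r z.1 * dominant Ω m M c μ T z.2),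
    fun r => ?_, ?_, fun r => ?_⟩
  · exact ((integrable_legWeight φ r).mul_prod (hdom μ).1).const_mul _
  · filter_upwards [ae_fullMeasure M μ e₀ T] with z hz using h m μ i hi z hz
  · rw [integral_const_mul, fullMeasure, integral_prod_mul (legWeight φ r) (dominant Ω m M c μ T)]
    have h1 := mul_le_mul_of_nonneg_left (mul_le_mul_of_nonneg_left (hdom μ).2 (hw r))
      (mul_nonneg (hH r) (by positivity : 0 ≤ ((M ^ i)⁻¹) ^ r))
    refine h1.trans (le_of_eq ?_)
    ring

theorem integrable_fullIntegrand (hΩ : 0 < Ω) (hM : 1 < M) (m : ℝ) (hD : Nonempty G.L → 1 ≤ D)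
    (hT : G.IsSpanningTree T) (μ : G.L → ℕ) (φ : 𝓢(EuclideanSpace ℝ (Fin D), ℝ)) (t : ℝ) :
    Integrable (fullIntegrand Ω m e₀ T φ t) (fullMeasure D M μ e₀ T) := by
  obtain ⟨K, hK, h⟩ := exists_integrated_bound (e₀ := e₀) hΩ hM m hD hT φ
  obtain ⟨b, hb, hd, -⟩ := h μ 0 fun l => Nat.zero_le _
  refine (hb 0).mono' (measurable_fullIntegrand Ω m e₀ hT φ t).aestronglyMeasurable ?_
  filter_upwards [hd] with z hz
  simpa using hz.2 0 t

/-- The integrand of the scaled amplitude is obtained by integrating the internal variables. -/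
theorem scaledIntegrand_eq (hΩ : 0 < Ω) (hM : 1 < M) (m : ℝ) (hD : Nonempty G.L → 1 ≤ D)
    (hT : G.IsSpanningTree T) (μ : G.L → ℕ) (φ : 𝓢(EuclideanSpace ℝ (Fin D), ℝ)) (t : ℝ)
    (z : ({e : G.X // e ≠ e₀} → EuclideanSpace ℝ (Fin D)) × (G.L → EuclideanSpace ℝ (Fin D))) :
    scaledIntegrand Ω m M G μ e₀ T φ t z = (lineConst D Ω G : ℂ) *
      ∫ x, fullIntegrand Ω m e₀ T φ t (z.1, (z.2, x)) ∂(volume.prod (sliceMeasure M μ)) := by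
  unfold scaledIntegrand fullIntegrand
  simp only [fieldHat_eq]
  rw [reducedAmp_eq hΩ hM m hD hT, integral_mul_const, integral_mul_const, integral_complex_ofReal,
    Complex.ofReal_mul]
  ring

theorem measurePreserving_assoc_full (M : ℝ) (μ : G.L → ℕ) (e₀ : G.X) (T : Finset G.L) :
    MeasurePreserving (MeasurableEquiv.prodAssoc :
      (({e : G.X // e ≠ e₀} → EuclideanSpace ℝ (Fin D)) × (G.L → EuclideanSpace ℝ (Fin D))) ×
        (({l : G.L // l ∉ T} → EuclideanSpace ℝ (Fin D)) × (G.L → ℝ)) ≃ᵐ _)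
      ((volume.prod volume).prod (volume.prod (sliceMeasure M μ))) (fullMeasure D M μ e₀ T) :=
  measurePreserving_prodAssoc _ _ _

theorem integrable_scaledIntegrand (hΩ : 0 < Ω) (hM : 1 < M) (m : ℝ) (hD : Nonempty G.L → 1 ≤ D)
    (hT : G.IsSpanningTree T) (μ : G.L → ℕ) (φ : 𝓢(EuclideanSpace ℝ (Fin D), ℝ)) (t : ℝ) :
    Integrable (scaledIntegrand Ω m M G μ e₀ T φ t) := by
  have h := (measurePreserving_assoc_full M μ e₀ T).integrable_comp_of_integrable
    (integrable_fullIntegrand hΩ hM m hD hT μ φ t)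
  have e : scaledIntegrand Ω m M G μ e₀ T φ t = fun z => (lineConst D Ω G : ℂ) *
      ∫ x, fullIntegrand Ω m e₀ T φ t (z.1, (z.2, x)) ∂(volume.prod (sliceMeasure M μ)) :=
    funext (scaledIntegrand_eq hΩ hM m hD hT μ φ t)
  rw [e]
  exact h.integral_prod_left.const_mul _

theorem scaledAmp_eq (hΩ : 0 < Ω) (hM : 1 < M) (m : ℝ) (hD : Nonempty G.L → 1 ≤ D)
    (hT : G.IsSpanningTree T) (μ : G.L → ℕ) (φ : 𝓢(EuclideanSpace ℝ (Fin D), ℝ)) (t : ℝ) :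
    scaledAmp Ω m M G μ e₀ T φ t = (lineConst D Ω G : ℂ) *
      ∫ z, fullIntegrand Ω m e₀ T φ t z ∂(fullMeasure D M μ e₀ T) := by
  have h := (measurePreserving_assoc_full M μ e₀ T).integrable_comp_of_integrable
    (integrable_fullIntegrand hΩ hM m hD hT μ φ t)
  unfold scaledAmp
  simp_rw [scaledIntegrand_eq hΩ hM m hD hT]
  rw [integral_const_mul, ← (measurePreserving_assoc_full M μ e₀ T).integral_comp']
  exact congrArg _ (integral_prod _ h).symm

/-- The derivatives of the scaled amplitude are integrals over all the variables. -/
theorem iteratedDeriv_scaledAmp (hΩ : 0 < Ω) (hM : 1 < M) (m : ℝ) (hD : Nonempty G.L → 1 ≤ D)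
    (hT : G.IsSpanningTree T) (μ : G.L → ℕ) (φ : 𝓢(EuclideanSpace ℝ (Fin D), ℝ)) (r : ℕ) (t : ℝ) :
    iteratedDeriv r (scaledAmp Ω m M G μ e₀ T φ) t = (lineConst D Ω G : ℂ) *
      ∫ z, iteratedDeriv r (fun s => fullIntegrand Ω m e₀ T φ s z) t
        ∂(fullMeasure D M μ e₀ T) := by
  obtain ⟨K, hK, h⟩ := exists_integrated_bound (e₀ := e₀) hΩ hM m hD hT φ
  obtain ⟨b, hb, hd, -⟩ := h μ 0 fun l => Nat.zero_le _
  have h1 := contDiff_integral_of_derivBound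
    (fun t => (measurable_fullIntegrand Ω m e₀ hT φ t).aestronglyMeasurable) hb hd
  rw [funext (scaledAmp_eq hΩ hM m hD hT μ φ), iteratedDeriv_const_mul_field, (h1.2 r t).2]

theorem ampWellDefined (hΩ : 0 < Ω) (hM : 1 < M) (m : ℝ) (hD : Nonempty G.L → 1 ≤ D)
    (hT : G.IsSpanningTree T) (μ : G.L → ℕ) : AmpWellDefined D Ω m M G μ e₀ T := by
  refine ⟨fun l p q => integrableOn_propKernel hΩ hM m (hD ⟨l⟩) _ p q,
    integrable_lineProduct hΩ hM m hD hT μ, integrable_scaledIntegrand hΩ hM m hD hT μ,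
    fun φ => ?_⟩
  obtain ⟨K, hK, h⟩ := exists_integrated_bound (e₀ := e₀) hΩ hM m hD hT φ
  obtain ⟨b, hb, hd, -⟩ := h μ 0 fun l => Nat.zero_le _
  have h1 := contDiff_integral_of_derivBound
    (fun t => (measurable_fullIntegrand Ω m e₀ hT φ t).aestronglyMeasurable) hb hd
  rw [funext (scaledAmp_eq hΩ hM m hD hT μ φ)]
  exact contDiff_const.mul h1.1

/-- Power counting for the derivatives of the scaled amplitude. -/
theorem exists_scaledAmp_derivBound (hΩ : 0 < Ω) (hM : 1 < M) (m : ℝ) (hD : Nonempty G.L → 1 ≤ D)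
    (hT : G.IsSpanningTree T) (φ : 𝓢(EuclideanSpace ℝ (Fin D), ℝ)) :
    ∃ K : ℕ → ℝ, (∀ r, 0 ≤ K r) ∧ ∀ (μ : G.L → ℕ) (i : ℕ), (∀ l, i ≤ μ l) →
      DerivBound (scaledAmp Ω m M G μ e₀ T φ) fun r =>
        K r * (((M ^ i)⁻¹) ^ r * ∏ l, M ^ (lineExp D T l * μ l)) := by
  obtain ⟨K, hK, h⟩ := exists_integrated_bound (e₀ := e₀) hΩ hM m hD hT φ
  refine ⟨fun r => lineConst D Ω G * K r,
    fun r => mul_nonneg (lineConst_pos D hΩ G).le (hK r), fun μ i hi => ?_⟩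
  refine ⟨(ampWellDefined hΩ hM m hD hT μ).2.2.2 φ, fun r t => ?_⟩
  obtain ⟨b, hb, hd, hbd⟩ := h μ i hi
  rw [iteratedDeriv_scaledAmp hΩ hM m hD hT, norm_mul, Complex.norm_real,
    Real.norm_of_nonneg (lineConst_pos D hΩ G).le]
  beta_reduce
  rw [mul_assoc]
  refine mul_le_mul_of_nonneg_left ?_ (lineConst_pos D hΩ G).le
  refine le_trans (norm_integral_le_of_norm_le (hb r) ?_) (hbd r)
  filter_upwards [hd] with z hz using hz.2 r t

/-- The rest after subtraction of the counterterm. -/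
theorem exists_rest_bound (hG : G.IsPhi4) (hΩ : 0 < Ω) (hM : 1 < M) (m : ℝ)
    (hD : Nonempty G.L → 1 ≤ D) (hω : omega D G ≤ 0) (hT : G.IsSpanningTree T)
    (φ : 𝓢(EuclideanSpace ℝ (Fin D), ℝ)) :
    ∃ K : ℝ, 0 ≤ K ∧ ∀ (μ : G.L → ℕ) (i : ℕ), (∀ l, i ≤ μ l) →
      ‖amp Ω m M G μ e₀ T φ - counterterm Ω m M G μ e₀ T φ‖ ≤
        K * (M ^ (-(i : ℤ)) * innerFactor D M G μ) := by
  classical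
  have hM0 : 0 < M := by positivity
  -- One constant for every set of lines, with the value 0 for sets which are not spanning trees.
  -- There are finitely many, so their sum is a constant that does not depend on the attribution.
  have key : ∀ T' : Finset G.L, ∃ K : ℝ, 0 ≤ K ∧ (G.IsSpanningTree T' → ∀ (μ : G.L → ℕ) (i : ℕ),
      (∀ l, i ≤ μ l) → ‖amp Ω m M G μ e₀ T φ - counterterm Ω m M G μ e₀ T φ‖ ≤
        K * (M ^ (-(i : ℤ) * (1 - omega D G)) * ∏ l, M ^ (lineExp D T' l * μ l))) := by
    intro T'
    by_cases hT' : G.IsSpanningTree T'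
    · obtain ⟨K, hK, hb⟩ := exists_scaledAmp_derivBound (e₀ := e₀) hΩ hM m hD hT' φ
      obtain ⟨J, hJ, hJ'⟩ := reducedAmp_tree_change (D := D) e₀ hT hT'
      refine ⟨J * K ((-omega D G).toNat + 1), mul_nonneg hJ.le (hK _), fun _ μ i hi => ?_⟩
      have h1 := norm_sub_taylor_le (hb μ i hi) (-omega D G).toNat
      have h2 : amp Ω m M G μ e₀ T φ - counterterm Ω m M G μ e₀ T φ = (J : ℂ) *
          (scaledAmp Ω m M G μ e₀ T' φ 1 - ∑ j ∈ Finset.range ((-omega D G).toNat + 1),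
            (1 / (j.factorial : ℂ)) * iteratedDeriv j (scaledAmp Ω m M G μ e₀ T' φ) 0) := by
        unfold amp counterterm
        rw [(hJ' Ω m M μ).2 φ, mul_sub, Finset.mul_sum]
        congr 1
        refine Finset.sum_congr rfl fun j _ => ?_
        rw [iteratedDeriv_const_mul_field]
        ring
      rw [h2, norm_mul, Complex.norm_real, Real.norm_of_nonneg hJ.le, mul_assoc]
      refine mul_le_mul_of_nonneg_left (h1.trans (le_of_eq ?_)) hJ.le
      congr 2
      rw [inv_pow, ← pow_mul, ← zpow_natCast, ← zpow_neg]
      congr 1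
      have : (((-omega D G).toNat : ℕ) : ℤ) = -omega D G := Int.toNat_of_nonneg (by omega)
      push_cast
      rw [this]
      ring
    · exact ⟨0, le_rfl, fun h => absurd h hT'⟩
  choose K hK hb using key
  refine ⟨∑ T', K T', Finset.sum_nonneg fun T' _ => hK T', fun μ i hi => ?_⟩
  -- For a given attribution the estimate is applied with the adapted tree, and with the lowest
  -- index i₀ in place of i.
  obtain ⟨T', hT', hadapt⟩ := exists_adapted_tree hT.isConnected μ
  obtain ⟨i₀, hi₀, hμ, hle⟩ := prod_lineExp_le_innerFactor (D := D) hG hM μ hT' hadapt hi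
  refine (hb T' hT' μ i₀ hμ).trans (mul_le_mul
    (Finset.single_le_sum (fun T' _ => hK T') (Finset.mem_univ T')) hle ?_
    (Finset.sum_nonneg fun T' _ => hK T'))
  exact mul_nonneg (by positivity) (Finset.prod_nonneg fun l _ => by positivity)

end fubini

end FeynmanGraph

/-! ### Isotropy and moments of the internal momenta -/

/-- A bilinear expression which is invariant under isometries is a multiple of the scalar product,
on the standard basis. -/
theorem exists_isotropic {D : ℕ} (B : EuclideanSpace ℝ (Fin D) → EuclideanSpace ℝ (Fin D) → ℝ)
    (hinv : ∀ (R : EuclideanSpace ℝ (Fin D) ≃ₗᵢ[ℝ] EuclideanSpace ℝ (Fin D)) v w,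
      B (R v) (R w) = B v w) (hneg : ∀ v w, B (-v) w = -B v w) :
    ∃ q : ℝ, ∀ a b, B (EuclideanSpace.single a 1) (EuclideanSpace.single b 1) =
      if a = b then q else 0 := by
  rcases isEmpty_or_nonempty (Fin D) with h | ⟨⟨a₀⟩⟩
  · exact ⟨0, fun a => isEmptyElim a⟩
  refine ⟨B (EuclideanSpace.single a₀ 1) (EuclideanSpace.single a₀ 1), fun a b => ?_⟩
  split_ifs with hab
  · subst hab
    -- The reflection that exchanges two basis vectors identifies the diagonal entries.
    have h1 := hinv ((ℝ ∙ (EuclideanSpace.single a (1 : ℝ) - EuclideanSpace.single a₀ 1))ᗮ.reflection)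
      (EuclideanSpace.single a 1) (EuclideanSpace.single a 1)
    rw [Submodule.reflection_sub (by simp)] at h1
    exact h1.symm
  -- The reflection that reverses one basis vector and fixes the other kills the entry off the
  -- diagonal.
  · have h1 := hinv ((ℝ ∙ (EuclideanSpace.single a (1 : ℝ)))ᗮ.reflection)
      (EuclideanSpace.single a 1) (EuclideanSpace.single b 1)
    rw [Submodule.reflection_orthogonalComplement_singleton_eq_neg,
      Submodule.reflection_mem_subspace_eq_self, hneg] at h1
    · linarith
    · rw [Submodule.mem_orthogonal_singleton_iff_inner_right, EuclideanSpace.inner_single_left]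
      simp [hab]

namespace FeynmanGraph

section moments

variable {D : ℕ} {G : FeynmanGraph} {Ω M : ℝ} {e₀ : G.X} {T : Finset G.L}

/-- An isometry acting on the internal momenta. -/
noncomputable def rotate {T : Finset G.L} (R : EuclideanSpace ℝ (Fin D) ≃ₗᵢ[ℝ] EuclideanSpace ℝ (Fin D))
    (y : (G.L → EuclideanSpace ℝ (Fin D)) ×
      (({l : G.L // l ∉ T} → EuclideanSpace ℝ (Fin D)) × (G.L → ℝ))) :
    (G.L → EuclideanSpace ℝ (Fin D)) ×
      (({l : G.L // l ∉ T} → EuclideanSpace ℝ (Fin D)) × (G.L → ℝ)) :=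
  (fun l => R (y.1 l), (fun l => R (y.2.1 l), y.2.2))

theorem measurePreserving_rotate (M : ℝ) (μ : G.L → ℕ) (T : Finset G.L)
    (R : EuclideanSpace ℝ (Fin D) ≃ₗᵢ[ℝ] EuclideanSpace ℝ (Fin D)) :
    MeasurePreserving (rotate (T := T) R) (innerMeasure D M μ T) (innerMeasure D M μ T) :=
  (volume_preserving_pi fun _ => R.measurePreserving).prod
    ((volume_preserving_pi fun _ => R.measurePreserving).prod (MeasurePreserving.id _))

theorem route_rotate (hT : G.IsSpanningTree T)
    (R : EuclideanSpace ℝ (Fin D) ≃ₗᵢ[ℝ] EuclideanSpace ℝ (Fin D))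
    (k : {e : G.X // e ≠ e₀} → EuclideanSpace ℝ (Fin D))
    (u : G.L → EuclideanSpace ℝ (Fin D)) (w : {l : G.L // l ∉ T} → EuclideanSpace ℝ (Fin D))
    (l : G.L) : G.route e₀ T (fun e => R (k e)) (fun l => R (u l)) (fun l => R (w l)) l =
      R (G.route e₀ T k u w l) :=
  congrFun (route_comp e₀ hT R.toLinearEquiv.toLinearMap k u w) l

theorem kernelProd_rotate (m : ℝ) (hT : G.IsSpanningTree T)
    (R : EuclideanSpace ℝ (Fin D) ≃ₗᵢ[ℝ] EuclideanSpace ℝ (Fin D))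
    (y : (G.L → EuclideanSpace ℝ (Fin D)) ×
      (({l : G.L // l ∉ T} → EuclideanSpace ℝ (Fin D)) × (G.L → ℝ))) :
    kernelProd Ω m e₀ T 0 (rotate R y) = kernelProd Ω m e₀ T 0 y := by
  unfold kernelProd
  refine Finset.prod_congr rfl fun l _ => ?_
  have h := route_rotate (e₀ := e₀) hT R 0 y.1 y.2.1 l
  have h0 : (fun e : {e : G.X // e ≠ e₀} => R ((0 : {e : G.X // e ≠ e₀} →
      EuclideanSpace ℝ (Fin D)) e)) = 0 := by
    funext e
    simp
  rw [h0] at h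
  change propKernel Ω m (y.2.2 l) (R (y.1 l) - G.route e₀ T 0 (fun l => R (y.1 l))
    (fun l => R (y.2.1 l)) l) (G.route e₀ T 0 (fun l => R (y.1 l)) (fun l => R (y.2.1 l)) l) = _
  rw [h, ← map_sub, propKernel_eq, propKernel_eq, ← map_add, ← map_sub, R.norm_map, R.norm_map]

theorem route_leg_rotate (hT : G.IsSpanningTree T)
    (R : EuclideanSpace ℝ (Fin D) ≃ₗᵢ[ℝ] EuclideanSpace ℝ (Fin D))
    (k : {e : G.X // e ≠ e₀} → EuclideanSpace ℝ (Fin D)) (l : G.L) :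
    G.route e₀ T (fun e => R (k e)) 0 0 l = R (G.route e₀ T k 0 0 l) := by
  have h := route_rotate (e₀ := e₀) hT R k 0 0 l
  simp only [Pi.zero_apply, map_zero] at h
  exact h

theorem expQuad_rotate (hT : G.IsSpanningTree T)
    (R : EuclideanSpace ℝ (Fin D) ≃ₗᵢ[ℝ] EuclideanSpace ℝ (Fin D))
    (k k' : {e : G.X // e ≠ e₀} → EuclideanSpace ℝ (Fin D)) (τ : G.L → ℝ) :
    expQuad Ω e₀ T (fun e => R (k e)) (fun e => R (k' e)) τ = expQuad Ω e₀ T k k' τ := by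
  unfold expQuad
  simp_rw [route_leg_rotate hT, LinearIsometryEquiv.inner_map_map]

theorem expLin_rotate (hT : G.IsSpanningTree T)
    (R : EuclideanSpace ℝ (Fin D) ≃ₗᵢ[ℝ] EuclideanSpace ℝ (Fin D))
    (k : {e : G.X // e ≠ e₀} → EuclideanSpace ℝ (Fin D))
    (y : (G.L → EuclideanSpace ℝ (Fin D)) ×
      (({l : G.L // l ∉ T} → EuclideanSpace ℝ (Fin D)) × (G.L → ℝ))) :
    expLin Ω e₀ T (fun e => R (k e)) (rotate R y) = expLin Ω e₀ T k y := by
  unfold expLin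
  refine Finset.sum_congr rfl fun l _ => ?_
  have h := route_rotate (e₀ := e₀) hT R 0 y.1 y.2.1 l
  have h0 : (fun e : {e : G.X // e ≠ e₀} => R ((0 : {e : G.X // e ≠ e₀} →
      EuclideanSpace ℝ (Fin D)) e)) = 0 := by
    funext e
    simp
  rw [h0] at h
  change propLong Ω (y.2.2 l) * (2 * inner ℝ (R (y.1 l) - (2 : ℝ) • G.route e₀ T 0
    (fun l => R (y.1 l)) (fun l => R (y.2.1 l)) l) (G.route e₀ T (fun e => R (k e)) 0 0 l)) = _
  rw [h, route_leg_rotate hT, ← map_smul, ← map_sub, LinearIsometryEquiv.inner_map_map]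

theorem kernelProd_zero_eq (m : ℝ) (hT : G.IsSpanningTree T)
    (y : (G.L → EuclideanSpace ℝ (Fin D)) ×
      (({l : G.L // l ∉ T} → EuclideanSpace ℝ (Fin D)) × (G.L → ℝ))) :
    kernelProd Ω m e₀ T 0 y = outerFactor Ω m T y * Real.exp (-expZero Ω e₀ T y) := by
  have h := kernelProd_smul_eq Ω m e₀ hT (0 : {e : G.X // e ≠ e₀} → EuclideanSpace ℝ (Fin D)) y 0
  rw [zero_smul] at h
  rw [h]
  simp

/-- The bound of `exists_outerFactor_bound` leaves room: half of the loop decay and powers of Λ|u|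
are to spare. An observable is integrable once, multiplied by exp(-`expZero`), it stays within this
reserve. -/
theorem integrable_kernelProd_mul (hΩ : 0 < Ω) (hM : 1 < M) (m : ℝ) (hD : Nonempty G.L → 1 ≤ D)
    (hT : G.IsSpanningTree T) (μ : G.L → ℕ)
    {g : (G.L → EuclideanSpace ℝ (Fin D)) ×
      (({l : G.L // l ∉ T} → EuclideanSpace ℝ (Fin D)) × (G.L → ℝ)) → ℝ} (hg : Measurable g)
    (K : ℝ) (r : ℕ) (hgK : ∀ y, (∀ l, y.2.2 l ∈ sliceSet M (μ l)) →
      Real.exp (-expZero Ω e₀ T y) * |g y| ≤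
        K * ((∏ l, (1 + M ^ μ l * ‖y.1 l‖) ^ r) * Real.exp (-(1 / 2 * expLoop Ω T y)))) :
    Integrable (fun y => kernelProd Ω m e₀ T 0 y * g y) (innerMeasure D M μ T) := by
  obtain ⟨c, hc, hout⟩ := exists_outerFactor_bound hΩ hM D G
  obtain ⟨E, hE, hout⟩ := hout r
  obtain ⟨C, -, hdom⟩ := exists_dominant_bound (D := D) m hD hΩ hM hc T
  refine (((hdom μ).1.const_mul E).const_mul |K|).mono'
    ((((measurable_kernelProd Ω m e₀ hT).comp measurable_prodMk_left)).mul hg).aestronglyMeasurable ?_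
  filter_upwards [ae_innerMeasure M μ T] with y hy
  have hof : 0 ≤ outerFactor Ω m T y := mul_nonneg
    (Finset.prod_nonneg fun l _ => (propFactor_pos D m hΩ (sliceSet_pos hM (hy l))).le)
    (Real.exp_pos _).le
  rw [norm_mul, Real.norm_of_nonneg (kernelProd_nonneg hΩ hM m e₀ 0 hy), Real.norm_eq_abs,
    kernelProd_zero_eq m hT, mul_assoc]
  have h1 := hout m T μ y hy
  have h2 : 0 ≤ (∏ l, (1 + M ^ μ l * ‖y.1 l‖) ^ r) * Real.exp (-(1 / 2 * expLoop Ω T y)) := by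
    have hM0 : 0 < M := by positivity
    exact mul_nonneg (Finset.prod_nonneg fun l _ => by positivity) (Real.exp_pos _).le
  calc _ ≤ outerFactor Ω m T y * (|K| * ((∏ l, (1 + M ^ μ l * ‖y.1 l‖) ^ r) *
        Real.exp (-(1 / 2 * expLoop Ω T y)))) :=
        mul_le_mul_of_nonneg_left ((hgK y hy).trans
          (mul_le_mul_of_nonneg_right (le_abs_self K) h2)) hof
    _ = |K| * ((∏ l, (1 + M ^ μ l * ‖y.1 l‖) ^ r) * (outerFactor Ω m T y *
        Real.exp (-(1 / 2 * expLoop Ω T y)))) := by ring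
    _ ≤ _ := mul_le_mul_of_nonneg_left h1 (abs_nonneg K)

theorem measurable_expLin (hT : G.IsSpanningTree T)
    (k : {e : G.X // e ≠ e₀} → EuclideanSpace ℝ (Fin D)) : Measurable (expLin Ω e₀ T k) := by
  have hL := measurable_propLong Ω
  have hR : ∀ l, Measurable fun y : (G.L → EuclideanSpace ℝ (Fin D)) ×
        (({l : G.L // l ∉ T} → EuclideanSpace ℝ (Fin D)) × (G.L → ℝ)) =>
      G.route e₀ T 0 y.1 y.2.1 l := fun l =>
    (((continuous_apply l).comp (continuous_route e₀ hT)).comp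
      (continuous_const.prodMk (continuous_fst.prodMk continuous_snd.fst))).measurable
  unfold expLin
  fun_prop

theorem measurable_expQuad (k k' : {e : G.X // e ≠ e₀} → EuclideanSpace ℝ (Fin D)) :
    Measurable fun y : (G.L → EuclideanSpace ℝ (Fin D)) ×
        (({l : G.L // l ∉ T} → EuclideanSpace ℝ (Fin D)) × (G.L → ℝ)) =>
      expQuad Ω e₀ T k k' y.2.2 := by
  have hL := measurable_propLong Ω
  unfold expQuad
  fun_prop

theorem expLoop_nonneg (hΩ : 0 < Ω) (hM : 1 < M) {μ : G.L → ℕ}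
    {y : (G.L → EuclideanSpace ℝ (Fin D)) ×
        (({l : G.L // l ∉ T} → EuclideanSpace ℝ (Fin D)) × (G.L → ℝ))}
    (hy : ∀ l, y.2.2 l ∈ sliceSet M (μ l)) : 0 ≤ expLoop Ω T y :=
  Finset.sum_nonneg fun l _ =>
    mul_nonneg (propLong_nonneg hΩ (sliceSet_pos hM (hy l))) (sq_nonneg _)

theorem expLoop_le_expZero (hΩ : 0 < Ω) (hM : 1 < M) (hT : G.IsSpanningTree T) {μ : G.L → ℕ}
    {y : (G.L → EuclideanSpace ℝ (Fin D)) ×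
        (({l : G.L // l ∉ T} → EuclideanSpace ℝ (Fin D)) × (G.L → ℝ))}
    (hy : ∀ l, y.2.2 l ∈ sliceSet M (μ l)) : expLoop Ω T y ≤ expZero Ω e₀ T y := by
  have := expLoop_le e₀ hT 0 y (fun l => propLong_nonneg hΩ (sliceSet_pos hM (hy l))) 0
  simpa using this

theorem exists_expQuad_bound (hΩ : 0 < Ω) (hM : 1 < M) (hT : G.IsSpanningTree T) (μ : G.L → ℕ)
    (k : {e : G.X // e ≠ e₀} → EuclideanSpace ℝ (Fin D)) :
    ∃ K : ℝ, 0 ≤ K ∧ ∀ τ : G.L → ℝ, (∀ l, τ l ∈ sliceSet M (μ l)) →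
      expQuad Ω e₀ T k k τ ≤ K := by
  obtain ⟨C, hC, h⟩ := exists_sqrt_expQuad_bound hΩ hM D e₀ hT
  refine ⟨(C * ‖k‖) ^ 2, sq_nonneg _, fun τ hτ => ?_⟩
  have h1 := h μ 0 (fun l => Nat.zero_le _) k τ hτ
  rw [pow_zero, inv_one, one_mul] at h1
  exact (Real.sqrt_le_left (by positivity)).1 h1

/-- The linear form is unbounded in the momenta, but its square is at most `expQuad` times x =
`expZero` - `expLoop`. As x ≤ e^x, it costs only the part of the Gaussian that does not come from
the loop lines. -/
theorem integrable_expLin_sq (hΩ : 0 < Ω) (hM : 1 < M) (m : ℝ) (hD : Nonempty G.L → 1 ≤ D)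
    (hT : G.IsSpanningTree T) (μ : G.L → ℕ)
    (k : {e : G.X // e ≠ e₀} → EuclideanSpace ℝ (Fin D)) :
    Integrable (fun y => kernelProd Ω m e₀ T 0 y * expLin Ω e₀ T k y ^ 2)
      (innerMeasure D M μ T) := by
  obtain ⟨K, hK, hKb⟩ := exists_expQuad_bound (e₀ := e₀) hΩ hM hT μ k
  refine integrable_kernelProd_mul hΩ hM m hD hT μ ((measurable_expLin hT k).pow_const 2) K 0
    fun y hy => ?_
  have hlong : ∀ l, 0 ≤ propLong Ω (y.2.2 l) := fun l =>
    propLong_nonneg hΩ (sliceSet_pos hM (hy l))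
  have h1 := expLin_sq_le e₀ hT k y hlong
  have h2 := expLoop_nonneg hΩ hM hy
  have h3 := expLoop_le_expZero (e₀ := e₀) hΩ hM hT hy
  simp only [pow_zero, Finset.prod_const_one, one_mul]
  rw [abs_of_nonneg (sq_nonneg _)]
  set x := expZero Ω e₀ T y - expLoop Ω T y with hx
  have h4 : x ≤ Real.exp x := by linarith [Real.add_one_le_exp x]
  have h5 : expLin Ω e₀ T k y ^ 2 ≤ K * Real.exp x :=
    h1.trans (mul_le_mul (hKb _ hy) h4 (by linarith) hK)
  calc _ ≤ Real.exp (-expZero Ω e₀ T y) * (K * Real.exp x) :=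
        mul_le_mul_of_nonneg_left h5 (Real.exp_pos _).le
    _ = K * Real.exp (-expLoop Ω T y) := by
        rw [mul_left_comm, ← Real.exp_add]
        congr 2
        rw [hx]
        ring
    _ ≤ _ := mul_le_mul_of_nonneg_left (Real.exp_le_exp.2 (by linarith)) hK

theorem integrable_expQuad (hΩ : 0 < Ω) (hM : 1 < M) (m : ℝ) (hD : Nonempty G.L → 1 ≤ D)
    (hT : G.IsSpanningTree T) (μ : G.L → ℕ)
    (k k' : {e : G.X // e ≠ e₀} → EuclideanSpace ℝ (Fin D)) :
    Integrable (fun y => kernelProd Ω m e₀ T 0 y * expQuad Ω e₀ T k k' y.2.2)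
      (innerMeasure D M μ T) := by
  obtain ⟨K, hK, hKb⟩ := exists_expQuad_bound (e₀ := e₀) hΩ hM hT μ k
  obtain ⟨K', hK', hKb'⟩ := exists_expQuad_bound (e₀ := e₀) hΩ hM hT μ k'
  refine integrable_kernelProd_mul hΩ hM m hD hT μ (measurable_expQuad k k') (K + K') 0
    fun y hy => ?_
  have h2 := expLoop_nonneg hΩ hM hy
  have h3 := expLoop_le_expZero (e₀ := e₀) hΩ hM hT hy
  simp only [pow_zero, Finset.prod_const_one, one_mul]
  rw [mul_comm]
  refine mul_le_mul ?_ (Real.exp_le_exp.2 (by linarith)) (Real.exp_pos _).le (by positivity)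
  refine le_trans ?_ (add_le_add (hKb _ hy) (hKb' _ hy))
  unfold expQuad
  rw [← Finset.sum_add_distrib]
  refine (Finset.abs_sum_le_sum_abs _ _).trans (Finset.sum_le_sum fun l _ => ?_)
  have hl := propLong_nonneg hΩ (sliceSet_pos hM (hy l))
  rw [abs_mul, abs_of_nonneg hl, ← mul_add]
  refine mul_le_mul_of_nonneg_left ?_ hl
  rw [abs_mul, real_inner_self_eq_norm_sq, real_inner_self_eq_norm_sq]
  have h4 := abs_real_inner_le_norm (G.route e₀ T k 0 0 l) (G.route e₀ T k' 0 0 l)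
  rw [abs_of_pos (by norm_num : (0 : ℝ) < 4)]
  nlinarith [sq_nonneg (‖G.route e₀ T k 0 0 l‖ - ‖G.route e₀ T k' 0 0 l‖),
    sq_nonneg ‖G.route e₀ T k 0 0 l‖, sq_nonneg ‖G.route e₀ T k' 0 0 l‖]

theorem integrable_inner_sum_sq (hΩ : 0 < Ω) (hM : 1 < M) (m : ℝ) (hD : Nonempty G.L → 1 ≤ D)
    (hT : G.IsSpanningTree T) (μ : G.L → ℕ) (v : EuclideanSpace ℝ (Fin D)) :
    Integrable (fun y => kernelProd Ω m e₀ T 0 y * (inner ℝ (∑ l, y.1 l) v) ^ 2)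
      (innerMeasure D M μ T) := by
  refine integrable_kernelProd_mul hΩ hM m hD hT μ (by fun_prop) (‖v‖ ^ 2) 2 fun y hy => ?_
  have h2 := expLoop_nonneg hΩ hM hy
  have h3 := expLoop_le_expZero (e₀ := e₀) hΩ hM hT hy
  have h4 := abs_real_inner_le_norm (∑ l, y.1 l) v
  have h5 := norm_sum_le_prod hM (μ := μ) (fun l => Nat.zero_le _) y.1
  rw [pow_zero, inv_one, one_mul] at h5
  rw [Finset.prod_pow, mul_comm, abs_of_nonneg (sq_nonneg _), ← mul_assoc]
  refine mul_le_mul ?_ (Real.exp_le_exp.2 (by linarith)) (Real.exp_pos _).le (by positivity)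
  rw [← sq_abs, ← mul_pow]
  refine pow_le_pow_left₀ (abs_nonneg _) (h4.trans ?_) 2
  rw [mul_comm]
  exact mul_le_mul_of_nonneg_left h5 (norm_nonneg _)

/-- Products of functions which are square integrable with the weight `kernelProd`. -/
theorem integrable_kernelProd_mul_mul (hΩ : 0 < Ω) (hM : 1 < M) (m : ℝ)
    (hT : G.IsSpanningTree T) {μ : G.L → ℕ}
    {g h : (G.L → EuclideanSpace ℝ (Fin D)) ×
      (({l : G.L // l ∉ T} → EuclideanSpace ℝ (Fin D)) × (G.L → ℝ)) → ℝ}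
    (hg : Measurable g) (hh : Measurable h)
    (hgi : Integrable (fun y => kernelProd Ω m e₀ T 0 y * g y ^ 2) (innerMeasure D M μ T))
    (hhi : Integrable (fun y => kernelProd Ω m e₀ T 0 y * h y ^ 2) (innerMeasure D M μ T)) :
    Integrable (fun y => kernelProd Ω m e₀ T 0 y * (g y * h y)) (innerMeasure D M μ T) := by
  refine (hgi.add hhi).mono' (((measurable_kernelProd Ω m e₀ hT).comp
    measurable_prodMk_left).mul (hg.mul hh)).aestronglyMeasurable ?_
  filter_upwards [ae_innerMeasure M μ T] with y hy
  have hk := kernelProd_nonneg hΩ hM m e₀ 0 hy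
  rw [norm_mul, Real.norm_of_nonneg hk, Real.norm_eq_abs, Pi.add_apply, ← mul_add, abs_mul]
  refine mul_le_mul_of_nonneg_left ?_ hk
  nlinarith [sq_nonneg (|g y| - |h y|), sq_abs (g y), sq_abs (h y), sq_nonneg (g y),
    sq_nonneg (h y)]

/-- The integrals with the weight `kernelProd` are invariant under isometries. -/
theorem integral_kernelProd_mul_rotate (m : ℝ) (hT : G.IsSpanningTree T) (μ : G.L → ℕ)
    (R : EuclideanSpace ℝ (Fin D) ≃ₗᵢ[ℝ] EuclideanSpace ℝ (Fin D))
    {g : (G.L → EuclideanSpace ℝ (Fin D)) ×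
      (({l : G.L // l ∉ T} → EuclideanSpace ℝ (Fin D)) × (G.L → ℝ)) → ℝ} (hg : Measurable g) :
    ∫ y, kernelProd Ω m e₀ T 0 y * g (rotate R y) ∂(innerMeasure D M μ T) =
      ∫ y, kernelProd Ω m e₀ T 0 y * g y ∂(innerMeasure D M μ T) := by
  have h := measurePreserving_rotate (D := D) M μ T R
  conv_rhs => rw [← h.map_eq]
  rw [integral_map h.measurable.aemeasurable]
  · simp_rw [kernelProd_rotate m hT]
  · exact (((measurable_kernelProd Ω m e₀ hT).comp measurable_prodMk_left).mul
      hg).aestronglyMeasurable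

end moments

end FeynmanGraph

/-! ### Pairings of Fourier transforms -/

section pairing

open LineDeriv

variable {D : ℕ} {ι : Type*} [Fintype ι] [Unique ι]

theorem integrable_hat_mul_hat (f g : 𝓢(EuclideanSpace ℝ (Fin D), ℂ)) :
    Integrable fun k : ι → EuclideanSpace ℝ (Fin D) =>
      hat f (k default) * hat g (-k default) := by
  have h1 : Integrable fun k : ι → EuclideanSpace ℝ (Fin D) => hat f (k default) := by
    have := Integrable.fintype_prod (ι := ι) (μ := fun _ => volume) (f := fun _ => hat f)
      fun _ => (hat f).integrable
    simp only [Fintype.prod_unique] at this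
    exact this
  have hg := continuous_hat g
  refine h1.mul_bdd (c := SchwartzMap.seminorm ℝ 0 0 (hat g))
    (Continuous.aestronglyMeasurable (by fun_prop)) (Filter.Eventually.of_forall fun k => ?_)
  exact norm_le_seminorm ℝ _ _

theorem integral_hat_mul_hat (f g : 𝓢(EuclideanSpace ℝ (Fin D), ℂ)) :
    ∫ k : ι → EuclideanSpace ℝ (Fin D), hat f (k default) * hat g (-k default) =
      ((2 * Real.pi) ^ D : ℝ) * ∫ x, f x * g x := by
  have := integral_prod_hat (ι := ι) (fun _ => f) g
  simpa using this

theorem integrable_schwartz_mul (f g : 𝓢(EuclideanSpace ℝ (Fin D), ℂ)) :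
    Integrable fun x => f x * g x :=
  (SchwartzMap.pairing (ContinuousLinearMap.mul ℝ ℂ) f g).integrable

/-- Integration by parts. -/
theorem integral_lineDeriv_mul_coordMul (f : 𝓢(EuclideanSpace ℝ (Fin D), ℂ)) (a b : Fin D) :
    ∫ x, (∂_{EuclideanSpace.single b (1 : ℝ)} f) x * coordMul a f x =
      -(1 / 2) * if a = b then ∫ x, f x * f x else 0 := by
  have h1 := integral_mul_lineDerivOp_right_eq_neg_left (μ := volume) (coordMul a f) f
    (EuclideanSpace.single b (1 : ℝ))
  have h2 : ∀ x, (∂_{EuclideanSpace.single b (1 : ℝ)} (coordMul a f)) x =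
      (if a = b then 1 else 0) * f x + (x a : ℂ) * (∂_{EuclideanSpace.single b (1 : ℝ)} f) x := by
    intro x
    rw [lineDerivOp_apply_eq_fderiv, lineDerivOp_apply_eq_fderiv]
    have e : (coordMul a f : EuclideanSpace ℝ (Fin D) → ℂ) = fun x => (x a : ℂ) * f x :=
      funext (coordMul_apply a f)
    have hx : HasFDerivAt (fun x : EuclideanSpace ℝ (Fin D) => (x a : ℂ))
        (Complex.ofRealCLM.comp (EuclideanSpace.proj a)) x :=
      (Complex.ofRealCLM.comp (EuclideanSpace.proj a)).hasFDerivAt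
    rw [e, (hx.fun_mul (f.hasFDerivAt x)).fderiv]
    simp only [_root_.add_apply, _root_.smul_apply, ContinuousLinearMap.comp_apply, smul_eq_mul,
      PiLp.proj_apply, PiLp.single_apply, Complex.ofRealCLM_apply]
    split_ifs <;> push_cast <;> ring
  have h3 : ∫ x, (∂_{EuclideanSpace.single b (1 : ℝ)} (coordMul a f)) x * f x =
      (if a = b then ∫ x, f x * f x else 0) +
        ∫ x, (∂_{EuclideanSpace.single b (1 : ℝ)} f) x * coordMul a f x := by
    have e : ∀ x, (∂_{EuclideanSpace.single b (1 : ℝ)} (coordMul a f)) x * f x =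
        (if a = b then 1 else 0) * (f x * f x) +
          (∂_{EuclideanSpace.single b (1 : ℝ)} f) x * coordMul a f x := by
      intro x
      rw [h2, coordMul_apply]
      ring
    simp_rw [e]
    rw [integral_add ((integrable_schwartz_mul f f).const_mul _) (integrable_schwartz_mul _ _),
      integral_const_mul]
    split_ifs <;> simp
  have h4 : ∫ x, coordMul a f x * (∂_{EuclideanSpace.single b (1 : ℝ)} f) x =
      ∫ x, (∂_{EuclideanSpace.single b (1 : ℝ)} f) x * coordMul a f x := by
    simp_rw [mul_comm]
  rw [h3, h4] at h1
  -- The integral sought occurs on both sides with opposite signs, whence the factor 1/2.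
  linear_combination (1 / 2 : ℂ) * h1

end pairing

theorem iteratedDeriv_two_eq {f f' : ℝ → ℂ} {f'' : ℂ} {x : ℝ} (h : ∀ t, HasDerivAt f (f' t) t)
    (h' : HasDerivAt f' f'' x) : iteratedDeriv 2 f x = f'' := by
  rw [iteratedDeriv_succ, iteratedDeriv_one, show deriv f = f' from funext fun t => (h t).deriv,
    h'.deriv]

/-! ### The second Taylor coefficient for two external legs -/

namespace FeynmanGraph

section secondDerivative

open LineDeriv

variable {D : ℕ} {G : FeynmanGraph} {Ω M : ℝ} {e₀ : G.X} {T : Finset G.L}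

/-- The second derivative of the integrand. -/
theorem iteratedDeriv_two_fullIntegrand (m : ℝ) (hT : G.IsSpanningTree T)
    (φ : 𝓢(EuclideanSpace ℝ (Fin D), ℝ))
    (z : ({e : G.X // e ≠ e₀} → EuclideanSpace ℝ (Fin D)) × ((G.L → EuclideanSpace ℝ (Fin D)) ×
      (({l : G.L // l ∉ T} → EuclideanSpace ℝ (Fin D)) × (G.L → ℝ)))) :
    iteratedDeriv 2 (fun t => fullIntegrand Ω m e₀ T φ t z) 0 =
      (kernelProd Ω m e₀ T 0 z.2 : ℂ) * (∏ e, hat φ.toComplex (z.1 e)) *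
      (((4 * (expLin Ω e₀ T z.1 z.2 * expLin Ω e₀ T z.1 z.2) -
          2 * expQuad Ω e₀ T z.1 z.1 z.2.2.2 : ℝ) : ℂ) * hat φ.toComplex (-∑ e, z.1 e) +
        4 * (expLin Ω e₀ T z.1 z.2 : ℂ) * (-Complex.I * ∑ a, (((∑ l, z.2.1 l) a : ℝ) : ℂ) *
          hat (coordMul a φ.toComplex) (-∑ e, z.1 e)) -
        ∑ a, (((∑ l, z.2.1 l) a : ℝ) : ℂ) * ∑ b, (((∑ l, z.2.1 l) b : ℝ) : ℂ) *
          hat (coordMul b (coordMul a φ.toComplex)) (-∑ e, z.1 e)) := by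
  set α := expQuad Ω e₀ T z.1 z.1 z.2.2.2
  set β := expLin Ω e₀ T z.1 z.2
  set γ := expZero Ω e₀ T z.2
  set σ := ∑ l, z.2.1 l
  set s := ∑ e, z.1 e
  set f := φ.toComplex
  set A : ℂ := (outerFactor Ω m T z.2 : ℂ) * ∏ e, hat f (z.1 e)
  set g : ℝ → ℂ := fun t => ((Real.exp (-(α * t ^ 2 - 2 * β * t + γ)) : ℝ) : ℂ) with hgdef
  set h : ℝ → ℂ := fun t => hat f (t • σ - s) with hhdef
  set h₁ : ℝ → ℂ := fun t => -Complex.I * ∑ a, (σ a : ℂ) * hat (coordMul a f) (t • σ - s) with hh₁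
  have e : (fun t => fullIntegrand Ω m e₀ T φ t z) = fun t => A * (g t * h t) := by
    funext t
    rw [fullIntegrand, kernelProd_smul_eq Ω m e₀ hT, Complex.ofReal_mul]
    ring
  have hg : ∀ t, HasDerivAt g (((2 * β - 2 * α * t : ℝ) : ℂ) * g t) t := by
    intro t
    have h1 : HasDerivAt (fun t : ℝ => -(α * t ^ 2 - 2 * β * t + γ)) (2 * β - 2 * α * t) t := by
      have h2 := ((((hasDerivAt_pow 2 t).const_mul α).sub
        ((hasDerivAt_id t).const_mul (2 * β))).add_const γ).neg
      refine h2.congr_deriv ?_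
      push_cast
      ring
    have h2 := h1.exp.ofReal_comp
    refine h2.congr_deriv ?_
    rw [hgdef]
    push_cast
    ring
  have hh : ∀ t, HasDerivAt h (h₁ t) t := fun t => hasDerivAt_hat_line f σ s t
  have hh' : HasDerivAt h₁ (-∑ a, (σ a : ℂ) * ∑ b, (σ b : ℂ) *
      hat (coordMul b (coordMul a f)) (-s)) 0 := by
    have h3 := (HasDerivAt.fun_sum (u := (Finset.univ : Finset (Fin D))) fun a _ =>
      (hasDerivAt_hat_line (coordMul a f) σ s 0).const_mul (σ a : ℂ)).const_mul (-Complex.I)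
    refine h3.congr_deriv ?_
    simp only [zero_smul, zero_sub, Finset.mul_sum, ← Finset.sum_neg_distrib]
    refine Finset.sum_congr rfl fun a _ => Finset.sum_congr rfl fun b _ => ?_
    linear_combination (σ a : ℂ) * ((σ b : ℂ) * hat (coordMul b (coordMul a f)) (-s)) *
      Complex.I_mul_I
  have hl : HasDerivAt (fun t : ℝ => ((2 * β - 2 * α * t : ℝ) : ℂ)) ((-(2 * α) : ℝ) : ℂ) 0 := by
    have h4 := ((hasDerivAt_id (0 : ℝ)).const_mul (2 * α)).const_sub (2 * β)
    rw [mul_one] at h4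
    exact h4.ofReal_comp
  have h5 : HasDerivAt (fun t => A * (((2 * β - 2 * α * t : ℝ) : ℂ) * g t * h t + g t * h₁ t)) _ 0 :=
    (((hl.fun_mul (hg 0)).fun_mul (hh 0)).fun_add ((hg 0).fun_mul hh')).const_mul A
  rw [e, iteratedDeriv_two_eq (f := fun t => A * (g t * h t))
    (fun t => ((hg t).mul (hh t)).const_mul A) h5]
  have hg0 : g 0 = ((Real.exp (-γ) : ℝ) : ℂ) := by
    rw [hgdef]
    simp
  have hh0 : h 0 = hat f (-s) := by
    rw [hhdef]
    simp
  have hh10 : h₁ 0 = -Complex.I * ∑ a, (σ a : ℂ) * hat (coordMul a f) (-s) := by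
    rw [hh₁]
    simp
  rw [kernelProd_zero_eq m hT, hg0, hh0, hh10]
  simp only [A, γ]
  push_cast
  ring

/-- With two legs a single external momentum is free. Its expansion in the standard basis separates
it from the internal moments, which become matrices on which rotations act. -/
theorem route_const_eq_sum (hT : G.IsSpanningTree T) (p : EuclideanSpace ℝ (Fin D)) (l : G.L) :
    G.route e₀ T (fun _ => p) 0 0 l =
      ∑ a, p a • G.route e₀ T (fun _ => EuclideanSpace.single a (1 : ℝ)) 0 0 l := by
  let K : EuclideanSpace ℝ (Fin D) →ₗ[ℝ] EuclideanSpace ℝ (Fin D) :=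
    { toFun := fun p => G.route e₀ T (fun _ => p) 0 0 l
      map_add' := fun p q => by
        have := congrFun (route_add e₀ hT (fun _ => p) (fun _ => q) 0 0 0 0) l
        simp only [add_zero] at this
        exact this
      map_smul' := fun c p => by
        have := congrFun (route_smul e₀ hT c (fun _ => p) 0 0) l
        simp only [smul_zero] at this
        exact this }
  have hp : p = ∑ a, p a • EuclideanSpace.single a (1 : ℝ) := by
    ext b
    simp [Pi.single_apply]
  have h := congrArg K hp
  rw [map_sum] at h
  simp_rw [map_smul] at h
  exact h

theorem expLin_const_eq_sum (hT : G.IsSpanningTree T) (p : EuclideanSpace ℝ (Fin D))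
    (y : (G.L → EuclideanSpace ℝ (Fin D)) ×
      (({l : G.L // l ∉ T} → EuclideanSpace ℝ (Fin D)) × (G.L → ℝ))) :
    expLin Ω e₀ T (fun _ => p) y =
      ∑ a, p a * expLin Ω e₀ T (fun _ => EuclideanSpace.single a (1 : ℝ)) y := by
  unfold expLin
  simp_rw [route_const_eq_sum hT p, inner_sum, real_inner_smul_right, Finset.mul_sum]
  rw [Finset.sum_comm]
  refine Finset.sum_congr rfl fun a _ => Finset.sum_congr rfl fun l _ => ?_
  ring

theorem expQuad_const_eq_sum (hT : G.IsSpanningTree T) (p : EuclideanSpace ℝ (Fin D))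
    (τ : G.L → ℝ) :
    expQuad Ω e₀ T (fun _ => p) (fun _ => p) τ =
      ∑ a, ∑ b, p a * p b * expQuad Ω e₀ T (fun _ => EuclideanSpace.single a (1 : ℝ))
        (fun _ => EuclideanSpace.single b (1 : ℝ)) τ := by
  unfold expQuad
  simp_rw [route_const_eq_sum hT p, sum_inner, inner_sum, real_inner_smul_right,
    real_inner_smul_left, Finset.mul_sum]
  rw [Finset.sum_comm]
  refine Finset.sum_congr rfl fun a _ => ?_
  rw [Finset.sum_comm]
  refine Finset.sum_congr rfl fun b _ => Finset.sum_congr rfl fun l _ => ?_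
  ring

end secondDerivative

end FeynmanGraph

theorem integral_add_add {Z : Type*} [MeasurableSpace Z] {ν : Measure Z} {f g h : Z → ℂ}
    (hf : Integrable f ν) (hg : Integrable g ν) (hh : Integrable h ν) :
    ∫ z, f z + g z + h z ∂ν = ∫ z, f z ∂ν + ∫ z, g z ∂ν + ∫ z, h z ∂ν := by
  exact (integral_add (hf.add hg) hh).trans (congrArg (· + _) (integral_add hf hg))

namespace FeynmanGraph

section form

open LineDeriv

variable {D : ℕ} {G : FeynmanGraph} {Ω M : ℝ} {e₀ : G.X} {T : Finset G.L}

/-- The integral of a finite sum of products of functions of the external and of the internal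
momenta. -/
theorem integral_sum_hat_mul_kernelProd [Unique {e : G.X // e ≠ e₀}] {J : Type*} [Fintype J]
    (m : ℝ) (μ : G.L → ℕ) (f g : J → 𝓢(EuclideanSpace ℝ (Fin D), ℂ))
    (c : J → (G.L → EuclideanSpace ℝ (Fin D)) ×
      (({l : G.L // l ∉ T} → EuclideanSpace ℝ (Fin D)) × (G.L → ℝ)) → ℝ)
    (hc : ∀ j, Integrable (fun y => kernelProd Ω m e₀ T 0 y * c j y) (innerMeasure D M μ T)) :
    Integrable (fun z => ∑ j, (hat (f j) (z.1 default) * hat (g j) (-z.1 default)) *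
      ((kernelProd Ω m e₀ T 0 z.2 * c j z.2 : ℝ) : ℂ)) (fullMeasure D M μ e₀ T) ∧
    ∫ z, ∑ j, (hat (f j) (z.1 default) * hat (g j) (-z.1 default)) *
      ((kernelProd Ω m e₀ T 0 z.2 * c j z.2 : ℝ) : ℂ) ∂(fullMeasure D M μ e₀ T) =
    ((2 * Real.pi) ^ D : ℝ) * ∑ j, (∫ x, f j x * g j x) *
      ((∫ y, kernelProd Ω m e₀ T 0 y * c j y ∂(innerMeasure D M μ T) : ℝ) : ℂ) := by
  have h : ∀ j, Integrable (fun z : ({e : G.X // e ≠ e₀} → EuclideanSpace ℝ (Fin D)) ×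
      ((G.L → EuclideanSpace ℝ (Fin D)) ×
      (({l : G.L // l ∉ T} → EuclideanSpace ℝ (Fin D)) × (G.L → ℝ))) =>
      (hat (f j) (z.1 default) * hat (g j) (-z.1 default)) *
      ((kernelProd Ω m e₀ T 0 z.2 * c j z.2 : ℝ) : ℂ)) (fullMeasure D M μ e₀ T) := fun j =>
    (integrable_hat_mul_hat (f j) (g j)).mul_prod (hc j).ofReal
  refine ⟨integrable_finsetSum _ fun j _ => h j, ?_⟩
  rw [integral_finsetSum _ fun j _ => h j, Finset.mul_sum]
  refine Finset.sum_congr rfl fun j _ => ?_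
  rw [fullMeasure, integral_prod_mul (fun k : {e : G.X // e ≠ e₀} → EuclideanSpace ℝ (Fin D) =>
    hat (f j) (k default) * hat (g j) (-k default))
    (fun y => ((kernelProd Ω m e₀ T 0 y * c j y : ℝ) : ℂ)), integral_hat_mul_hat,
    integral_complex_ofReal, mul_assoc]

/-- The coefficients of the quadratic form in the derivatives of the field. -/
noncomputable def derivCoeff (Ω : ℝ) (e₀ : G.X) (T : Finset G.L) (v w : EuclideanSpace ℝ (Fin D))
    (y : (G.L → EuclideanSpace ℝ (Fin D)) ×
      (({l : G.L // l ∉ T} → EuclideanSpace ℝ (Fin D)) × (G.L → ℝ))) : ℝ :=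
  4 * (expLin Ω e₀ T (fun _ => v) y * expLin Ω e₀ T (fun _ => w) y) -
    2 * expQuad Ω e₀ T (fun _ => v) (fun _ => w) y.2.2

/-- The second derivative of the integrand for two external legs, as a sum of products. -/
theorem iteratedDeriv_two_eq_sum [Unique {e : G.X // e ≠ e₀}] (m : ℝ) (hT : G.IsSpanningTree T)
    (φ : 𝓢(EuclideanSpace ℝ (Fin D), ℝ))
    (z : ({e : G.X // e ≠ e₀} → EuclideanSpace ℝ (Fin D)) × ((G.L → EuclideanSpace ℝ (Fin D)) ×
      (({l : G.L // l ∉ T} → EuclideanSpace ℝ (Fin D)) × (G.L → ℝ)))) :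
    iteratedDeriv 2 (fun t => fullIntegrand Ω m e₀ T φ t z) 0 =
      ∑ j : Fin D × Fin D, (hat (∂_{EuclideanSpace.single j.1 (1 : ℝ)} φ.toComplex) (z.1 default) *
          hat (∂_{EuclideanSpace.single j.2 (1 : ℝ)} φ.toComplex) (-z.1 default)) *
        ((kernelProd Ω m e₀ T 0 z.2 * derivCoeff Ω e₀ T (EuclideanSpace.single j.1 1)
          (EuclideanSpace.single j.2 1) z.2 : ℝ) : ℂ) +
      ∑ j : Fin D × Fin D, (hat (∂_{EuclideanSpace.single j.2 (1 : ℝ)} φ.toComplex) (z.1 default) *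
          hat (coordMul j.1 φ.toComplex) (-z.1 default)) *
        ((kernelProd Ω m e₀ T 0 z.2 * (-4 * (inner ℝ (∑ l, z.2.1 l) (EuclideanSpace.single j.1 1) *
          expLin Ω e₀ T (fun _ => EuclideanSpace.single j.2 1) z.2)) : ℝ) : ℂ) +
      ∑ j : Fin D × Fin D, (hat φ.toComplex (z.1 default) *
          hat (coordMul j.2 (coordMul j.1 φ.toComplex)) (-z.1 default)) *
        ((kernelProd Ω m e₀ T 0 z.2 * (-(inner ℝ (∑ l, z.2.1 l) (EuclideanSpace.single j.1 1) *
          inner ℝ (∑ l, z.2.1 l) (EuclideanSpace.single j.2 1))) : ℝ) : ℂ) := by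
  have hz : z.1 = fun _ => z.1 default := funext fun e => by rw [Unique.eq_default e]
  rw [iteratedDeriv_two_fullIntegrand m hT, Fintype.prod_unique, Fintype.sum_unique]
  set p := z.1 default
  set σ := ∑ l, z.2.1 l
  set f := φ.toComplex
  rw [hz, expQuad_const_eq_sum hT, expLin_const_eq_sum hT]
  simp only [Fintype.sum_prod_type, hat_lineDeriv, EuclideanSpace.inner_single_right, derivCoeff,
    conj_trivial, one_mul, PiLp.neg_apply]
  set β : Fin D → ℝ := fun a => expLin Ω e₀ T (fun _ => EuclideanSpace.single a (1 : ℝ)) z.2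
  set q : Fin D → Fin D → ℝ := fun a b => expQuad Ω e₀ T
    (fun _ => EuclideanSpace.single a (1 : ℝ)) (fun _ => EuclideanSpace.single b (1 : ℝ)) z.2.2.2
  set W := kernelProd Ω m e₀ T 0 z.2
  -- The second leg carries -p, and its sign cancels that of i²; the products p_a p_b thus become
  -- products of two derivatives of the field.
  have h1 : ∑ a, ∑ b, (Complex.I * (p a : ℂ) * hat f p) *
      (Complex.I * ((-p b : ℝ) : ℂ) * hat f (-p)) *
      ((W * (4 * (β a * β b) - 2 * q a b) : ℝ) : ℂ) = (W : ℂ) * hat f p *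
      (((4 * ((∑ a, p a * β a) * (∑ a, p a * β a)) - 2 * ∑ a, ∑ b, p a * p b * q a b : ℝ) : ℂ) *
        hat f (-p)) := by
    rw [Finset.sum_mul_sum, Finset.mul_sum, Finset.mul_sum, ← Finset.sum_sub_distrib,
      Complex.ofReal_sum, Finset.sum_mul, Finset.mul_sum]
    refine Finset.sum_congr rfl fun a _ => ?_
    rw [Finset.mul_sum, Finset.mul_sum, ← Finset.sum_sub_distrib,
      Complex.ofReal_sum, Finset.sum_mul, Finset.mul_sum]
    refine Finset.sum_congr rfl fun b _ => ?_
    push_cast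
    linear_combination (-(p a : ℂ) * p b * hat f p * hat f (-p) * W * (4 * (β a * β b) - 2 * q a b)) *
      Complex.I_mul_I
  have h2 : ∑ a, ∑ b, (Complex.I * (p b : ℂ) * hat f p) * hat (coordMul a f) (-p) *
      ((W * (-4 * (σ a * β b)) : ℝ) : ℂ) = (W : ℂ) * hat f p *
      (4 * ((∑ a, p a * β a : ℝ) : ℂ) * (-Complex.I * ∑ a, (σ a : ℂ) *
        hat (coordMul a f) (-p))) := by
    simp only [Complex.ofReal_sum, Finset.mul_sum, Finset.sum_mul]
    refine Finset.sum_congr rfl fun a _ => Finset.sum_congr rfl fun b _ => ?_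
    push_cast
    ring
  have h3 : ∑ a, ∑ b, hat f p * hat (coordMul b (coordMul a f)) (-p) *
      ((W * (-(σ a * σ b)) : ℝ) : ℂ) = -((W : ℂ) * hat f p * ∑ a, (σ a : ℂ) * ∑ b, (σ b : ℂ) *
        hat (coordMul b (coordMul a f)) (-p)) := by
    simp only [Finset.mul_sum, ← Finset.sum_neg_distrib]
    refine Finset.sum_congr rfl fun a _ => Finset.sum_congr rfl fun b _ => ?_
    push_cast
    ring
  rw [h1, h2, h3]
  ring

/-- The second derivative at zero of the scaled amplitude with two external legs. -/
theorem exists_iteratedDeriv_two_scaledAmp [Unique {e : G.X // e ≠ e₀}] (hΩ : 0 < Ω) (hM : 1 < M)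
    (m : ℝ) (hD : Nonempty G.L → 1 ≤ D) (hT : G.IsSpanningTree T) (μ : G.L → ℕ) :
    ∃ q y s : ℝ, (∀ a, s = ∫ y, kernelProd Ω m e₀ T 0 y * ((∑ l, y.1 l) a) ^ 2
        ∂(innerMeasure D M μ T)) ∧
      ∀ φ : 𝓢(EuclideanSpace ℝ (Fin D), ℝ),
        iteratedDeriv 2 (scaledAmp Ω m M G μ e₀ T φ) 0 =
          ((lineConst D Ω G * (2 * Real.pi) ^ D * (q * (∑ a, ∫ x, (fderiv ℝ φ x
            (EuclideanSpace.single a 1)) ^ 2) + y * (∫ x, φ x ^ 2) - s * ∑ a, ∫ x,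
              (x a) ^ 2 * φ x ^ 2) : ℝ) : ℂ) := by
  have hmL := fun v : EuclideanSpace ℝ (Fin D) => measurable_expLin (Ω := Ω) (e₀ := e₀) hT
    (fun _ => v)
  have hmS : ∀ v : EuclideanSpace ℝ (Fin D), Measurable
      fun y : (G.L → EuclideanSpace ℝ (Fin D)) × (({l : G.L // l ∉ T} → EuclideanSpace ℝ (Fin D)) ×
        (G.L → ℝ)) => inner ℝ (∑ l, y.1 l) v := fun v => by fun_prop
  have hmSS : ∀ v w : EuclideanSpace ℝ (Fin D), Measurable
      fun y : (G.L → EuclideanSpace ℝ (Fin D)) × (({l : G.L // l ∉ T} → EuclideanSpace ℝ (Fin D)) ×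
        (G.L → ℝ)) => -(inner ℝ (∑ l, y.1 l) v * inner ℝ (∑ l, y.1 l) w) := fun v w => by fun_prop
  have hmC : ∀ v w : EuclideanSpace ℝ (Fin D), Measurable (derivCoeff Ω e₀ T v w) := fun v w =>
    (((hmL v).mul (hmL w)).const_mul 4).sub ((measurable_expQuad _ _).const_mul 2)
  have hiL := fun v : EuclideanSpace ℝ (Fin D) => integrable_expLin_sq (e₀ := e₀) hΩ hM m hD hT μ
    (fun _ => v)
  have hiS := fun v : EuclideanSpace ℝ (Fin D) =>
    integrable_inner_sum_sq (e₀ := e₀) hΩ hM m hD hT μ v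
  have hC : ∀ v w, Integrable (fun y => kernelProd Ω m e₀ T 0 y * derivCoeff Ω e₀ T v w y)
      (innerMeasure D M μ T) := fun v w => by
    have h := ((integrable_kernelProd_mul_mul hΩ hM m hT (hmL v) (hmL w) (hiL v) (hiL w)).const_mul
      4).sub ((integrable_expQuad (e₀ := e₀) hΩ hM m hD hT μ (fun _ => v) (fun _ => w)).const_mul 2)
    refine h.congr (Filter.Eventually.of_forall fun y => ?_)
    simp only [derivCoeff, Pi.sub_apply]
    ring
  have hY : ∀ v w : EuclideanSpace ℝ (Fin D), Integrable (fun y => kernelProd Ω m e₀ T 0 y *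
      (-4 * (inner ℝ (∑ l, y.1 l) v * expLin Ω e₀ T (fun _ => w) y))) (innerMeasure D M μ T) :=
    fun v w => by
      refine ((integrable_kernelProd_mul_mul hΩ hM m hT (hmS v) (hmL w) (hiS v) (hiL w)).const_mul
        (-4)).congr (Filter.Eventually.of_forall fun y => ?_)
      beta_reduce
      ring
  have hS : ∀ v w : EuclideanSpace ℝ (Fin D), Integrable (fun y => kernelProd Ω m e₀ T 0 y *
      (-(inner ℝ (∑ l, y.1 l) v * inner ℝ (∑ l, y.1 l) w))) (innerMeasure D M μ T) :=
    fun v w => by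
      refine (integrable_kernelProd_mul_mul hΩ hM m hT (hmS v) (hmS w) (hiS v) (hiS w)).neg.congr
        (Filter.Eventually.of_forall fun y => ?_)
      simp only [Pi.neg_apply]
      ring
  -- Rotating the basis vectors amounts to rotating the internal momenta, under which the weight at
  -- zero external momentum and the measure are invariant.
  obtain ⟨q, hq⟩ := exists_isotropic (fun v w => ∫ y, kernelProd Ω m e₀ T 0 y *
    derivCoeff Ω e₀ T v w y ∂(innerMeasure D M μ T))
    (fun R v w => by
      rw [← integral_kernelProd_mul_rotate m hT μ R (hmC (R v) (R w))]
      simp only [derivCoeff]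
      congr 1
      funext y
      rw [expLin_rotate hT R (fun _ => v), expLin_rotate hT R (fun _ => w)]
      change _ * (_ - 2 * expQuad Ω e₀ T _ _ y.2.2) = _
      rw [expQuad_rotate hT R (fun _ => v) (fun _ => w)])
    (fun v w => by
      rw [← integral_neg]
      congr 1
      funext y
      have h1 : expLin Ω e₀ T (fun _ => -v) y = -expLin Ω e₀ T (fun _ => v) y := by
        rw [expLin_const_eq_sum hT, expLin_const_eq_sum hT v]
        simp
      have h2 : expQuad Ω e₀ T (fun _ => -v) (fun _ => w) y.2.2 =
          -expQuad Ω e₀ T (fun _ => v) (fun _ => w) y.2.2 := by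
        have h3 : ∀ l, G.route e₀ T (fun _ => -v) 0 0 l = -G.route e₀ T (fun _ => v) 0 0 l := by
          intro l
          rw [route_const_eq_sum hT, route_const_eq_sum hT v]
          simp
        unfold expQuad
        rw [← Finset.sum_neg_distrib]
        refine Finset.sum_congr rfl fun l _ => ?_
        rw [h3, inner_neg_left]
        ring
      simp only [derivCoeff, h1, h2]
      ring)
  obtain ⟨s, hs⟩ := exists_isotropic (fun v w => ∫ y, kernelProd Ω m e₀ T 0 y *
    (-(inner ℝ (∑ l, y.1 l) v * inner ℝ (∑ l, y.1 l) w)) ∂(innerMeasure D M μ T))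
    (fun R v w => by
      rw [← integral_kernelProd_mul_rotate m hT μ R (hmSS (R v) (R w))]
      simp only [rotate, ← map_sum, LinearIsometryEquiv.inner_map_map])
    (fun v w => by
      rw [← integral_neg]
      congr 1
      funext y
      rw [inner_neg_right]
      ring)
  -- The mixed terms need no isotropy: integration by parts kills those with two different indices
  -- and turns each of the others into -1/2 ∫ φ². The scalar obtained for the products of the sums
  -- of u was defined with a minus sign, hence `-s`.
  refine ⟨q, ∑ a, -(1 / 2) * ∫ y, kernelProd Ω m e₀ T 0 y * (-4 * (inner ℝ (∑ l, y.1 l)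
    (EuclideanSpace.single a 1) * expLin Ω e₀ T (fun _ => EuclideanSpace.single a 1) y))
    ∂(innerMeasure D M μ T), -s, fun a => ?_, fun φ => ?_⟩
  · have h := hs a a
    rw [if_pos rfl] at h
    rw [← h, ← integral_neg]
    congr 1
    funext y
    rw [EuclideanSpace.inner_single_right]
    simp only [conj_trivial, one_mul]
    ring
  rw [iteratedDeriv_scaledAmp hΩ hM m hD hT]
  simp_rw [iteratedDeriv_two_eq_sum m hT]
  obtain ⟨i1, e1⟩ := integral_sum_hat_mul_kernelProd m μ
    (fun j : Fin D × Fin D => ∂_{EuclideanSpace.single j.1 (1 : ℝ)} φ.toComplex)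
    (fun j : Fin D × Fin D => ∂_{EuclideanSpace.single j.2 (1 : ℝ)} φ.toComplex)
    (fun j => derivCoeff Ω e₀ T (EuclideanSpace.single j.1 1) (EuclideanSpace.single j.2 1))
    fun j => hC _ _
  obtain ⟨i2, e2⟩ := integral_sum_hat_mul_kernelProd m μ
    (fun j : Fin D × Fin D => ∂_{EuclideanSpace.single j.2 (1 : ℝ)} φ.toComplex)
    (fun j : Fin D × Fin D => coordMul j.1 φ.toComplex)
    (fun j y => -4 * (inner ℝ (∑ l, y.1 l) (EuclideanSpace.single j.1 1) *
          expLin Ω e₀ T (fun _ => EuclideanSpace.single j.2 1) y))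
    fun j => hY _ _
  obtain ⟨i3, e3⟩ := integral_sum_hat_mul_kernelProd m μ
    (fun j : Fin D × Fin D => φ.toComplex)
    (fun j : Fin D × Fin D => coordMul j.2 (coordMul j.1 φ.toComplex))
    (fun j y => -(inner ℝ (∑ l, y.1 l) (EuclideanSpace.single j.1 1) *
          inner ℝ (∑ l, y.1 l) (EuclideanSpace.single j.2 1)))
    fun j => hS _ _
  rw [integral_add_add i1 i2 i3, e1, e2, e3]
  simp only [Fintype.sum_prod_type, hq, hs, integral_lineDeriv_mul_coordMul]
  have hD1 : ∀ a, ∫ x, (∂_{EuclideanSpace.single a (1 : ℝ)} φ.toComplex) x *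
      (∂_{EuclideanSpace.single a (1 : ℝ)} φ.toComplex) x =
      ((∫ x, (fderiv ℝ φ x (EuclideanSpace.single a 1)) ^ 2 : ℝ) : ℂ) := by
    intro a
    rw [← integral_complex_ofReal]
    congr 1
    funext x
    have h : (∂_{EuclideanSpace.single a (1 : ℝ)} φ.toComplex) x =
        ((fderiv ℝ φ x (EuclideanSpace.single a 1) : ℝ) : ℂ) := by
      rw [lineDerivOp_apply_eq_fderiv]
      have e : (φ.toComplex : EuclideanSpace ℝ (Fin D) → ℂ) = Complex.ofRealCLM ∘ φ := rfl
      rw [e, (Complex.ofRealCLM.hasFDerivAt.comp x (φ.hasFDerivAt x)).fderiv]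
      rfl
    rw [h]
    push_cast
    ring
  have hE : ∀ a, ∫ x, φ.toComplex x * coordMul a (coordMul a φ.toComplex) x =
      ((∫ x, (x a) ^ 2 * φ x ^ 2 : ℝ) : ℂ) := by
    intro a
    rw [← integral_complex_ofReal]
    congr 1
    funext x
    rw [coordMul_apply, coordMul_apply, toComplex_apply]
    push_cast
    ring
  have hF : ∫ x, φ.toComplex x * φ.toComplex x = ((∫ x, φ x ^ 2 : ℝ) : ℂ) := by
    rw [← integral_complex_ofReal]
    congr 1
    funext x
    rw [toComplex_apply]
    push_cast
    ring
  simp only [apply_ite Complex.ofReal, Complex.ofReal_zero, mul_ite, ite_mul, mul_zero, zero_mul,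
    Finset.sum_ite_eq, Finset.mem_univ, if_true, hD1, hE, hF]
  simp only [← Finset.sum_mul, ← Complex.ofReal_sum]
  push_cast
  simp only [← Finset.mul_sum]
  ring

end form

end FeynmanGraph

/-! ### Locality and form of the counterterm -/

theorem deriv_zero_of_even {f : ℝ → ℂ} (h : ∀ t, f (-t) = f t) : deriv f 0 = 0 := by
  have h1 := deriv_comp_neg f 0
  simp only [h, neg_zero] at h1
  linear_combination (1 / 2 : ℂ) * h1

theorem integrable_mul_of_schwartz {D : ℕ} (f g : 𝓢(EuclideanSpace ℝ (Fin D), ℝ)) :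
    Integrable fun x => f x * g x :=
  (SchwartzMap.pairing (ContinuousLinearMap.mul ℝ ℝ) f g).integrable

theorem integrable_schwartz_sq {D : ℕ} (f : 𝓢(EuclideanSpace ℝ (Fin D), ℝ)) :
    Integrable fun x => f x ^ 2 := by
  simp_rw [pow_two]
  exact integrable_mul_of_schwartz f f

open LineDeriv in
theorem integrable_fderiv_sq {D : ℕ} (f : 𝓢(EuclideanSpace ℝ (Fin D), ℝ))
    (v : EuclideanSpace ℝ (Fin D)) : Integrable fun x => (fderiv ℝ f x v) ^ 2 := by
  simp_rw [← lineDerivOp_apply_eq_fderiv]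
  exact integrable_schwartz_sq (∂_{v} f)

theorem integrable_norm_sq_mul_sq {D : ℕ} (f : 𝓢(EuclideanSpace ℝ (Fin D), ℝ)) :
    Integrable fun x => ‖x‖ ^ 2 * f x ^ 2 := by
  have h := integrable_mul_of_schwartz
    (smulLeftCLM ℝ (fun x : EuclideanSpace ℝ (Fin D) => ‖x‖ ^ 2) f) f
  refine h.congr (Filter.Eventually.of_forall fun x => ?_)
  beta_reduce
  rw [smulLeftCLM_apply_apply (Function.hasTemperateGrowth_norm_sq _), smul_eq_mul]
  ring

theorem integrable_coord_sq_mul_sq {D : ℕ} (f : 𝓢(EuclideanSpace ℝ (Fin D), ℝ)) (a : Fin D) :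
    Integrable fun x : EuclideanSpace ℝ (Fin D) => x a ^ 2 * f x ^ 2 := by
  have hf := f.continuous
  refine (integrable_norm_sq_mul_sq f).mono' (Continuous.aestronglyMeasurable (by fun_prop))
    (Filter.Eventually.of_forall fun x => ?_)
  rw [Real.norm_of_nonneg (by positivity)]
  gcongr ?_ * _
  rw [← sq_abs, ← Real.norm_eq_abs]
  exact pow_le_pow_left₀ (norm_nonneg _) (PiLp.norm_apply_le x a) 2

/-- The integrals of the three local terms. -/
theorem integral_local_eq {D : ℕ} (φ : 𝓢(EuclideanSpace ℝ (Fin D), ℝ)) (c₁ c₂ c₃ : ℝ) :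
    ∫ x, (c₁ * φ x ^ 2 + c₂ * ∑ a, (fderiv ℝ φ x (EuclideanSpace.single a 1)) ^ 2
      + c₃ * (‖x‖ ^ 2 * φ x ^ 2)) =
    c₁ * (∫ x, φ x ^ 2) + c₂ * (∑ a, ∫ x, (fderiv ℝ φ x (EuclideanSpace.single a 1)) ^ 2) +
      c₃ * ∑ a, ∫ x, (x a) ^ 2 * φ x ^ 2 := by
  have h1 := (integrable_schwartz_sq φ).const_mul c₁
  have h2 := (integrable_finsetSum Finset.univ fun a _ =>
    integrable_fderiv_sq φ (EuclideanSpace.single a 1)).const_mul c₂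
  have h3 := (integrable_norm_sq_mul_sq φ).const_mul c₃
  have h4 : ∫ x, ‖x‖ ^ 2 * φ x ^ 2 = ∑ a, ∫ x, (x a) ^ 2 * φ x ^ 2 := by
    rw [← integral_finsetSum _ fun a _ => integrable_coord_sq_mul_sq φ a]
    congr 1
    funext x
    rw [EuclideanSpace.norm_sq_eq, Finset.sum_mul]
    simp only [Real.norm_eq_abs, sq_abs]
  have e := integral_add (h1.add h2) h3
  simp only [Pi.add_apply] at e
  rw [e]
  have e' := integral_add h1 h2
  rw [e', integral_const_mul, integral_const_mul, integral_const_mul, h4,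
    integral_finsetSum _ fun a _ => integrable_fderiv_sq φ (EuclideanSpace.single a 1)]

namespace FeynmanGraph

section counterterm

variable {D : ℕ} {G : FeynmanGraph} {Ω M : ℝ} {e₀ : G.X} {T : Finset G.L}

theorem card_legs_add_one (e₀ : G.X) : Fintype.card {e : G.X // e ≠ e₀} + 1 = Fintype.card G.X := by
  have := Fintype.card_pos_iff.2 ⟨e₀⟩
  simp only [ne_eq, Fintype.card_subtype_compl, Fintype.card_unique]
  omega

/-- The total weight of the local term without derivatives. -/
noncomputable def zeroMoment (D : ℕ) (Ω m M : ℝ) (μ : G.L → ℕ) (e₀ : G.X) (T : Finset G.L) : ℝ :=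
  lineConst D Ω G * ((2 * Real.pi) ^ D) ^ Fintype.card {e : G.X // e ≠ e₀} *
    ∫ y, kernelProd Ω m e₀ T 0 y ∂(innerMeasure D M μ T)

/-- The value of the scaled amplitude at zero is local. -/
theorem scaledAmp_zero (hΩ : 0 < Ω) (hM : 1 < M) (m : ℝ) (hD : Nonempty G.L → 1 ≤ D)
    (hT : G.IsSpanningTree T) (μ : G.L → ℕ) (φ : 𝓢(EuclideanSpace ℝ (Fin D), ℝ)) :
    scaledAmp Ω m M G μ e₀ T φ 0 =
      ((zeroMoment D Ω m M μ e₀ T * ∫ x, φ x ^ Fintype.card G.X : ℝ) : ℂ) := by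
  have h : ∀ z, fullIntegrand Ω m e₀ T φ 0 z = ((∏ e, hat φ.toComplex (z.1 e)) *
      hat φ.toComplex (-∑ e, z.1 e)) * ((kernelProd Ω m e₀ T 0 z.2 : ℝ) : ℂ) := by
    intro z
    rw [fullIntegrand, zero_smul, zero_smul, zero_sub]
    ring
  rw [scaledAmp_eq hΩ hM m hD hT]
  simp_rw [h]
  rw [fullMeasure, integral_prod_mul (fun k : {e : G.X // e ≠ e₀} → EuclideanSpace ℝ (Fin D) =>
    (∏ e, hat φ.toComplex (k e)) * hat φ.toComplex (-∑ e, k e))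
    (fun y => ((kernelProd Ω m e₀ T 0 y : ℝ) : ℂ)), integral_prod_hat (fun _ => φ.toComplex),
    integral_complex_ofReal]
  have h1 : ∫ x, (∏ _e : {e : G.X // e ≠ e₀}, φ.toComplex x) * φ.toComplex x =
      ((∫ x, φ x ^ Fintype.card G.X : ℝ) : ℂ) := by
    rw [← integral_complex_ofReal]
    congr 1
    funext x
    rw [Finset.prod_const, Finset.card_univ, ← pow_succ, card_legs_add_one, toComplex_apply]
    push_cast
    rfl
  rw [h1, zeroMoment]
  push_cast
  ring

theorem iteratedDeriv_one_scaledAmp (m : ℝ) (hT : G.IsSpanningTree T) (μ : G.L → ℕ)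
    (φ : 𝓢(EuclideanSpace ℝ (Fin D), ℝ)) :
    iteratedDeriv 1 (scaledAmp Ω m M G μ e₀ T φ) 0 = 0 := by
  rw [iteratedDeriv_one]
  exact deriv_zero_of_even fun t => scaledAmp_neg e₀ hT Ω m M μ φ t

/-- For a logarithmically or linearly divergent graph only the term without derivatives is left. -/
theorem counterterm_eq_zeroMoment (hΩ : 0 < Ω) (hM : 1 < M) (m : ℝ) (hD : Nonempty G.L → 1 ≤ D)
    (hT : G.IsSpanningTree T) (hω : omega D G = 0 ∨ omega D G = -1) (μ : G.L → ℕ)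
    (φ : 𝓢(EuclideanSpace ℝ (Fin D), ℝ)) :
    counterterm Ω m M G μ e₀ T φ =
      ((zeroMoment D Ω m M μ e₀ T * ∫ x, φ x ^ Fintype.card G.X : ℝ) : ℂ) := by
  rw [← scaledAmp_zero hΩ hM m hD hT, counterterm]
  rcases hω with h | h
  · rw [h]
    simp
  · rw [h]
    have := iteratedDeriv_one_scaledAmp (Ω := Ω) (M := M) (e₀ := e₀) m hT μ φ
    simp [Finset.sum_range_succ, this]

/-- For a quadratically divergent graph with two legs the counterterm has the form of the quadratic
part of the action. -/
theorem exists_counterterm_eq (hΩ : 0 < Ω) (hM : 1 < M) (m : ℝ) (hD : Nonempty G.L → 1 ≤ D)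
    (hT : G.IsSpanningTree T) (hω : omega D G = -2) (hX : Fintype.card G.X = 2) (μ : G.L → ℕ) :
    ∃ c₁ c₂ s : ℝ, (∀ a, s = ∫ y, kernelProd Ω m e₀ T 0 y * ((∑ l, y.1 l) a) ^ 2
        ∂(innerMeasure D M μ T)) ∧
      ∀ φ : 𝓢(EuclideanSpace ℝ (Fin D), ℝ), counterterm Ω m M G μ e₀ T φ =
        ((∫ x, (c₁ * φ x ^ 2 + c₂ * ∑ a, (fderiv ℝ φ x (EuclideanSpace.single a 1)) ^ 2
          + -(lineConst D Ω G * (2 * Real.pi) ^ D * (1 / 2) * s) * (‖x‖ ^ 2 * φ x ^ 2)) : ℝ) : ℂ) := by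
  have hcard : Fintype.card {e : G.X // e ≠ e₀} = 1 := by
    have := card_legs_add_one e₀
    omega
  obtain ⟨e₁, he₁⟩ := Fintype.card_eq_one_iff.1 hcard
  let inst : Unique {e : G.X // e ≠ e₀} := ⟨⟨e₁⟩, he₁⟩
  obtain ⟨q, y, s, hs, h⟩ := exists_iteratedDeriv_two_scaledAmp (e₀ := e₀) hΩ hM m hD hT μ
  -- The mass coefficient collects F(0) and the mixed part of F''(0)/2. The harmonic coefficient is
  -- kept explicit because its sign is what makes the sum over scales diverge.
  refine ⟨zeroMoment D Ω m M μ e₀ T + lineConst D Ω G * (2 * Real.pi) ^ D * (1 / 2) * y,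
    lineConst D Ω G * (2 * Real.pi) ^ D * (1 / 2) * q, s, hs, fun φ => ?_⟩
  have h1 := iteratedDeriv_one_scaledAmp (Ω := Ω) (M := M) (e₀ := e₀) m hT μ φ
  have h2 : (-(-2 : ℤ)).toNat + 1 = 3 := rfl
  rw [integral_local_eq, counterterm, hω, h2, Finset.sum_range_succ, Finset.sum_range_succ,
    Finset.sum_range_one, h1, h φ, iteratedDeriv_zero, scaledAmp_zero hΩ hM m hD hT, hX]
  norm_num
  ring

end counterterm

end FeynmanGraph

/-! ### Lower bounds on the moments at equal scales -/

/-- The integral over a ball of a nonnegative function which is homogeneous. -/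
theorem setIntegral_closedBall_homogeneous {F : Type*} [NormedAddCommGroup F] [NormedSpace ℝ F]
    [FiniteDimensional ℝ F] [MeasurableSpace F] [BorelSpace F] (ν : Measure F) [ν.IsAddHaarMeasure]
    {h : F → ℝ} {d : ℕ} (hhom : ∀ r : ℝ, 0 < r → ∀ x, h (r • x) = r ^ d * h x) {r : ℝ}
    (hr : 0 < r) : ∫ x in Metric.closedBall 0 r, h x ∂ν =
      r ^ Module.finrank ℝ F * r ^ d * ∫ x in Metric.closedBall 0 1, h x ∂ν := by
  have h1 := Measure.setIntegral_comp_smul_of_pos ν h (Metric.closedBall 0 1) hr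
  rw [smul_unitClosedBall_of_nonneg hr.le] at h1
  simp_rw [hhom r hr] at h1
  rw [integral_const_mul, smul_eq_mul, eq_comm, inv_mul_eq_iff_eq_mul₀ (by positivity)] at h1
  rw [h1]
  ring

/-- Homogeneity moves a point of the support into the open unit ball, and by continuity the support
contains a neighbourhood of it. -/
theorem setIntegral_closedBall_pos {F : Type*} [NormedAddCommGroup F] [NormedSpace ℝ F]
    [FiniteDimensional ℝ F] [MeasurableSpace F] [BorelSpace F] (ν : Measure F) [ν.IsAddHaarMeasure]
    {h : F → ℝ} {d : ℕ} (hhom : ∀ r : ℝ, 0 < r → ∀ x, h (r • x) = r ^ d * h x)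
    (hcont : Continuous h) (hnonneg : ∀ x, 0 ≤ h x) (hpos : ∃ x, h x ≠ 0) :
    0 < ∫ x in Metric.closedBall 0 1, h x ∂ν := by
  obtain ⟨x₀, hx₀⟩ := hpos
  rw [setIntegral_pos_iff_support_of_nonneg_ae (Filter.Eventually.of_forall hnonneg)
    (hcont.continuousOn.integrableOn_compact (isCompact_closedBall 0 1))]
  have hopen : IsOpen (Function.support h ∩ Metric.ball 0 1) :=
    (isOpen_ne_fun hcont continuous_const).inter Metric.isOpen_ball
  refine (hopen.measure_pos ν ⟨(‖x₀‖ + 1)⁻¹ • x₀, ?_, ?_⟩).trans_le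
    (measure_mono (Set.inter_subset_inter_right _ Metric.ball_subset_closedBall))
  · rw [Function.mem_support, hhom _ (by positivity)]
    exact mul_ne_zero (by positivity) hx₀
  · rw [mem_ball_zero_iff, norm_smul, norm_inv, Real.norm_of_nonneg (by positivity),
      inv_mul_lt_iff₀ (by positivity)]
    linarith

namespace FeynmanGraph

section lowerBound

variable {D : ℕ} {G : FeynmanGraph} {Ω M : ℝ} {e₀ : G.X} {T : Finset G.L}

/-- A lower bound on the kernels for momenta of the natural size. -/
theorem exists_kernelProd_lower_bound (hΩ : 0 < Ω) (hM : 1 < M) (m : ℝ) (hT : G.IsSpanningTree T) :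
    ∃ κ : ℝ, 0 < κ ∧ ∀ (j : ℕ) (y : (G.L → EuclideanSpace ℝ (Fin D)) ×
      (({l : G.L // l ∉ T} → EuclideanSpace ℝ (Fin D)) × (G.L → ℝ))),
      (∀ l, y.2.2 l ∈ sliceSet M j) → ‖y.1‖ ≤ (M ^ j)⁻¹ → ‖y.2.1‖ ≤ M ^ j →
        κ * factorProd D Ω m y.2.2 ≤ kernelProd Ω m e₀ T 0 y := by
  obtain ⟨c, C, hc, hC, hcoef⟩ := exists_coefficient_bounds hΩ hM
  obtain ⟨R, hR, hroute⟩ := exists_route_bound D e₀ hT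
  have hM0 : 0 < M := by positivity
  -- For |u| ≤ 1/Λ and |w| ≤ Λ every term of the exponent is bounded independently of Λ: by C for
  -- the strong part, and by C(1 + 4R)² for the weak part, the routed momenta being at most 2RΛ.
  refine ⟨Real.exp (-(Fintype.card G.L * C)) *
    Real.exp (-(Fintype.card G.L * (C * (1 + 4 * R) ^ 2))), by positivity, fun j y hy hu hw => ?_⟩
  have hfac : 0 ≤ factorProd D Ω m y.2.2 :=
    Finset.prod_nonneg fun l _ => (propFactor_pos D m hΩ (sliceSet_pos hM (hy l))).le
  set Λ := M ^ j with hΛdef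
  have hΛ : 1 ≤ Λ := one_le_pow₀ hM.le
  have hΛ0 : 0 < Λ := by positivity
  have hu' : ‖y.1‖ ≤ Λ := hu.trans ((inv_le_one_of_one_le₀ hΛ).trans hΛ)
  have h1 : ∑ l, propShort Ω (y.2.2 l) * ‖y.1 l‖ ^ 2 ≤ Fintype.card G.L * C := by
    rw [← nsmul_eq_mul, ← Finset.card_univ, ← Finset.sum_const]
    refine Finset.sum_le_sum fun l _ => ?_
    have h2 : ‖y.1 l‖ ≤ Λ⁻¹ := (norm_le_pi_norm y.1 l).trans hu
    calc _ ≤ C * Λ ^ 2 * (Λ⁻¹) ^ 2 := by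
          have := (hcoef _ _ (hy l)).2.1
          gcongr
      _ = C := by field_simp
  have h2 : ∑ l, propLong Ω (y.2.2 l) *
      ‖y.1 l - (2 : ℝ) • G.route e₀ T 0 y.1 y.2.1 l‖ ^ 2 ≤
      Fintype.card G.L * (C * (1 + 4 * R) ^ 2) := by
    rw [← nsmul_eq_mul, ← Finset.card_univ, ← Finset.sum_const]
    refine Finset.sum_le_sum fun l _ => ?_
    have h3 : ‖y.1 l‖ ≤ Λ := (norm_le_pi_norm y.1 l).trans hu'
    have h4 : ‖G.route e₀ T 0 y.1 y.2.1 l‖ ≤ R * (2 * Λ) := by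
      refine (hroute 0 y.1 y.2.1 l).trans (mul_le_mul_of_nonneg_left ?_ hR)
      rw [norm_zero]
      linarith
    have h5 : ‖y.1 l - (2 : ℝ) • G.route e₀ T 0 y.1 y.2.1 l‖ ≤ (1 + 4 * R) * Λ := by
      refine (norm_sub_le _ _).trans ?_
      rw [norm_smul, Real.norm_of_nonneg (by norm_num)]
      linarith
    calc _ ≤ C * (Λ ^ 2)⁻¹ * ((1 + 4 * R) * Λ) ^ 2 := by
          have := (hcoef _ _ (hy l)).2.2.2
          gcongr
      _ = C * (1 + 4 * R) ^ 2 := by field_simp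
  rw [kernelProd_eq, outerFactor, mul_comm, mul_assoc]
  refine mul_le_mul_of_nonneg_left ?_ hfac
  exact mul_le_mul (Real.exp_le_exp.2 (neg_le_neg h1)) (Real.exp_le_exp.2 (neg_le_neg h2))
    (Real.exp_pos _).le (Real.exp_pos _).le

/-- The moments of the weight grow at least as power counting suggests, when all the lines are at
the same scale. -/
theorem exists_moment_lower_bound (hG : G.IsPhi4) (hΩ : 0 < Ω) (hM : 1 < M) (m : ℝ)
    (hD : Nonempty G.L → 1 ≤ D) (hT : G.IsSpanningTree T)
    {h : (G.L → EuclideanSpace ℝ (Fin D)) → ℝ} {d : ℕ}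
    (hhom : ∀ r : ℝ, 0 < r → ∀ u, h (r • u) = r ^ d * h u)
    (hcont : Continuous h) (hnonneg : ∀ u, 0 ≤ h u) (hpos : ∃ u, h u ≠ 0)
    (hint : ∀ μ : G.L → ℕ, Integrable (fun y => kernelProd Ω m e₀ T 0 y * h y.1)
      (innerMeasure D M μ T)) :
    ∃ ε : ℝ, 0 < ε ∧ ∀ j : ℕ, 1 ≤ j → ε * (M ^ j) ^ (-omega D G - d) ≤
      ∫ y, kernelProd Ω m e₀ T 0 y * h y.1 ∂(innerMeasure D M (fun _ => j) T) := by
  have hM0 : 0 < M := by positivity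
  obtain ⟨κ, hκ, hker⟩ := exists_kernelProd_lower_bound (D := D) (e₀ := e₀) hΩ hM m hT
  obtain ⟨c, hc, hslice⟩ := exists_propFactor_lower_bound D m hΩ hM
  obtain ⟨C, -, hfac⟩ := exists_factorProd_bound (D := D) (G := G) m hD hΩ hM
  set H := ∫ u in Metric.closedBall 0 1, h u with hH
  have hH0 : 0 < H := setIntegral_closedBall_pos volume hhom hcont hnonneg hpos
  set V := ∫ w : {l : G.L // l ∉ T} → EuclideanSpace ℝ (Fin D) in Metric.closedBall 0 1, (1 : ℝ)
    with hV
  have hhom1 : ∀ r : ℝ, 0 < r → ∀ x : {l : G.L // l ∉ T} → EuclideanSpace ℝ (Fin D),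
      (fun _ => (1 : ℝ)) (r • x) = r ^ 0 * (fun _ => (1 : ℝ)) x := fun r _ x => by simp
  have hV0 : 0 < V := setIntegral_closedBall_pos volume hhom1 continuous_const
    (fun _ => zero_le_one) ⟨0, one_ne_zero⟩
  refine ⟨κ * (H * (V * c ^ Fintype.card G.L)), by positivity, fun j hj => ?_⟩
  set Λ := M ^ j with hΛdef
  have hΛ0 : 0 < Λ := by positivity
  have hfacle : c ^ Fintype.card G.L * (Λ ^ D / Λ ^ 2) ^ Fintype.card G.L ≤
      ∫ τ, factorProd D Ω m τ ∂(sliceMeasure M fun _ : G.L => j) := by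
    rw [sliceMeasure]
    unfold factorProd
    rw [integral_fintype_prod_eq_prod (fun _ => propFactor D Ω m), ← mul_pow, Finset.prod_const,
      Finset.card_univ]
    rcases isEmpty_or_nonempty G.L with hL | hL
    · simp
    · obtain ⟨C', -, hb⟩ := exists_propFactor_bound (hD hL) m hΩ hM
      exact pow_le_pow_left₀ (by positivity) (hslice j hj (hb j).1) _
  -- The integral is bounded below by its restriction to momenta of the natural size, expressed
  -- through indicators so that it factorises.
  have hi1 : Integrable ((Metric.closedBall 0 Λ⁻¹).indicator h) :=
    (integrable_indicator_iff Metric.isClosed_closedBall.measurableSet).2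
      (hcont.continuousOn.integrableOn_compact (isCompact_closedBall _ _))
  have hi2 : Integrable ((Metric.closedBall 0 Λ).indicator
      fun _ : {l : G.L // l ∉ T} → EuclideanSpace ℝ (Fin D) => (1 : ℝ)) :=
    (integrable_indicator_iff Metric.isClosed_closedBall.measurableSet).2
      (continuous_const.continuousOn.integrableOn_compact (isCompact_closedBall _ _))
  have hi := (hi1.mul_prod (hi2.mul_prod (hfac fun _ => j).1)).const_mul κ
  have hle := integral_mono_ae hi (hint fun _ => j) ?_
  · refine le_trans ?_ hle
    rw [integral_const_mul, integral_prod_mul ((Metric.closedBall 0 Λ⁻¹).indicator h)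
      (fun y : ({l : G.L // l ∉ T} → EuclideanSpace ℝ (Fin D)) × (G.L → ℝ) =>
        (Metric.closedBall 0 Λ).indicator (fun _ => (1 : ℝ)) y.1 * factorProd D Ω m y.2),
      integral_prod_mul ((Metric.closedBall 0 Λ).indicator
        fun _ : {l : G.L // l ∉ T} → EuclideanSpace ℝ (Fin D) => (1 : ℝ)) (factorProd D Ω m),
      integral_indicator Metric.isClosed_closedBall.measurableSet,
      integral_indicator Metric.isClosed_closedBall.measurableSet,
      setIntegral_closedBall_homogeneous volume hhom (inv_pos.2 hΛ0),
      setIntegral_closedBall_homogeneous volume hhom1 hΛ0, ← hH, ← hV, mul_assoc]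
    refine mul_le_mul_of_nonneg_left ?_ hκ.le
    refine le_trans (le_of_eq ?_) (mul_le_mul_of_nonneg_left
      (mul_le_mul_of_nonneg_left hfacle (by positivity)) (by positivity))
    have hcard : (Fintype.card {l : G.L // l ∉ T} : ℤ) = Fintype.card G.L - T.card := by
      have h1 := Fintype.card_subtype_compl fun l => l ∈ T
      have h2 := Finset.card_le_univ T
      rw [Fintype.card_coe] at h1
      rw [h1]
      omega
    have hω := omega_eq hG D
    have hT2 := hT.2
    rw [Module.finrank_pi_fintype, Module.finrank_pi_fintype]
    simp only [finrank_euclideanSpace, Fintype.card_fin, Finset.sum_const, Finset.card_univ,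
      smul_eq_mul, pow_zero, mul_one]
    -- The volume in u and the homogeneity of h, the volume in the loop momenta, and the parameters:
    -- the exponent is that of the upper bound, lowered by d.
    have key : Λ ^ (-omega D G - d) = (Λ⁻¹) ^ (Fintype.card G.L * D) * (Λ⁻¹) ^ d *
        (Λ ^ (Fintype.card {l : G.L // l ∉ T} * D)) * (Λ ^ D / Λ ^ 2) ^ Fintype.card G.L := by
      have e1 : (Λ⁻¹) ^ (Fintype.card G.L * D) = Λ ^ (-(Fintype.card G.L * D : ℤ)) := by
        rw [inv_pow, zpow_neg]
        norm_cast
      have e2 : (Λ⁻¹) ^ d = Λ ^ (-(d : ℤ)) := by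
        rw [inv_pow, zpow_neg, zpow_natCast]
      have e3 : Λ ^ (Fintype.card {l : G.L // l ∉ T} * D) =
          Λ ^ ((Fintype.card {l : G.L // l ∉ T} : ℤ) * D) := by
        norm_cast
      have e4 : (Λ ^ D / Λ ^ 2) ^ Fintype.card G.L = Λ ^ (((D : ℤ) - 2) * Fintype.card G.L) := by
        rw [zpow_mul, zpow_sub₀ hΛ0.ne', zpow_natCast, zpow_natCast]
        norm_cast
      rw [e1, e2, e3, e4, ← zpow_add₀ hΛ0.ne', ← zpow_add₀ hΛ0.ne', ← zpow_add₀ hΛ0.ne', hcard, hω]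
      congr 1
      have : (Fintype.card G.V : ℤ) = T.card + 1 := by exact_mod_cast hT2.symm
      rw [this]
      ring
    rw [key]
    ring
  · filter_upwards [ae_innerMeasure M (fun _ => j) T] with y hy
    have hk := kernelProd_nonneg hΩ hM m e₀ 0 hy
    have hf : 0 ≤ factorProd D Ω m y.2.2 :=
      Finset.prod_nonneg fun l _ => (propFactor_pos D m hΩ (sliceSet_pos hM (hy l))).le
    by_cases h1 : y.1 ∈ Metric.closedBall 0 Λ⁻¹
    · by_cases h2 : y.2.1 ∈ Metric.closedBall 0 Λ
      · rw [Set.indicator_of_mem h1, Set.indicator_of_mem h2]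
        have := mul_le_mul_of_nonneg_right (hker j y hy (mem_closedBall_zero_iff.1 h1)
          (mem_closedBall_zero_iff.1 h2)) (hnonneg y.1)
        refine le_trans (le_of_eq ?_) this
        ring
      · rw [Set.indicator_of_notMem h2]
        simpa using mul_nonneg hk (hnonneg _)
    · rw [Set.indicator_of_notMem h1]
      simpa using mul_nonneg hk (hnonneg _)

end lowerBound

end FeynmanGraph

/-! ### Divergence of sums over boxes, and second differences under translations -/

theorem exists_schwartz_integral_pow_pos (D : ℕ) {N : ℕ} (hN : N ≠ 0) :
    ∃ φ : 𝓢(EuclideanSpace ℝ (Fin D), ℝ), 0 < ∫ x, φ x ^ N := by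
  let f : ContDiffBump (0 : EuclideanSpace ℝ (Fin D)) := default
  refine ⟨f.hasCompactSupport.toSchwartzMap f.contDiff, ?_⟩
  simp only [HasCompactSupport.toSchwartzMap_toFun]
  have hc : Continuous fun x => f x ^ N := f.continuous.pow N
  refine hc.integral_pos_of_hasCompactSupport_nonneg_nonzero (x := 0) ?_
    (fun x => pow_nonneg f.nonneg N) ?_
  · exact f.hasCompactSupport.comp_left (g := fun t : ℝ => t ^ N) (zero_pow hN)
  · refine pow_ne_zero N ?_
    rw [f.one_of_mem_closedBall (Metric.mem_closedBall_self f.rIn_pos.le)]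
    exact one_ne_zero

/-- Nonnegative terms, bounded below on the diagonal, have unbounded sums over the boxes. -/
theorem not_bddAbove_sum_piFinset {L : Type*} [Fintype L] [DecidableEq L] [Nonempty L]
    {a : (L → ℕ) → ℝ} (ha : ∀ ν, 0 ≤ a ν) {ε : ℝ} (hε : 0 < ε)
    (haε : ∀ j : ℕ, 1 ≤ j → ε ≤ a fun _ => j) (i : ℕ) :
    ¬ BddAbove (Set.range fun ρ : ℕ => ∑ ν ∈ Fintype.piFinset fun _ : L => Finset.Icc i ρ, a ν) := by
  rintro ⟨B, hB⟩
  obtain ⟨n, hn⟩ := Archimedean.arch B hε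
  rw [nsmul_eq_mul] at hn
  have h1 : ∑ ν ∈ Fintype.piFinset fun _ : L => Finset.Icc i (i + (n + 1)), a ν ≤ B :=
    hB ⟨_, rfl⟩
  -- The diagonal attributions with i < j ≤ i + n + 1 already contribute n + 1 terms of size at
  -- least ε. Starting at i + 1 avoids the scale 0, at which no lower bound is assumed.
  have h2 : ∑ ν ∈ (Finset.Icc (i + 1) (i + (n + 1))).image (Function.const L), a ν ≤
      ∑ ν ∈ Fintype.piFinset fun _ : L => Finset.Icc i (i + (n + 1)), a ν := by
    refine Finset.sum_le_sum_of_subset_of_nonneg (fun ν hν => ?_) fun ν _ _ => ha ν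
    obtain ⟨j, hj, rfl⟩ := Finset.mem_image.1 hν
    rw [Finset.mem_Icc] at hj
    rw [Fintype.mem_piFinset]
    intro l
    rw [Function.const_apply, Finset.mem_Icc]
    omega
  rw [Finset.sum_image fun x _ y _ h => Function.const_injective h] at h2
  have h3 : (n + 1 : ℝ) * ε ≤ ∑ j ∈ Finset.Icc (i + 1) (i + (n + 1)), a (Function.const L j) := by
    have h4 : ∑ j ∈ Finset.Icc (i + 1) (i + (n + 1)), ε = (n + 1 : ℝ) * ε := by
      rw [Finset.sum_const, Nat.card_Icc, nsmul_eq_mul]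
      congr 1
      have : i + (n + 1) + 1 - (i + 1) = n + 1 := by omega
      rw [this]
      push_cast
      ring
    rw [← h4]
    refine Finset.sum_le_sum fun j hj => haε j ?_
    rw [Finset.mem_Icc] at hj
    omega
  nlinarith

section translation

variable {D : ℕ}

theorem integral_local_translate (φ : 𝓢(EuclideanSpace ℝ (Fin D), ℝ)) (c₁ c₂ c₃ : ℝ)
    (v : EuclideanSpace ℝ (Fin D)) :
    ∫ x, (c₁ * (φ.compSubConstCLM ℝ v) x ^ 2 + c₂ * ∑ a, (fderiv ℝ (φ.compSubConstCLM ℝ v) x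
      (EuclideanSpace.single a 1)) ^ 2 + c₃ * (‖x‖ ^ 2 * (φ.compSubConstCLM ℝ v) x ^ 2)) =
    ∫ x, (c₁ * φ x ^ 2 + c₂ * ∑ a, (fderiv ℝ φ x (EuclideanSpace.single a 1)) ^ 2
      + c₃ * (‖x + v‖ ^ 2 * φ x ^ 2)) := by
  rw [← integral_sub_right_eq_self (fun x => c₁ * φ x ^ 2 +
    c₂ * ∑ a, (fderiv ℝ φ x (EuclideanSpace.single a 1)) ^ 2 + c₃ * (‖x + v‖ ^ 2 * φ x ^ 2)) v]
  congr 1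
  funext x
  have h : (φ.compSubConstCLM ℝ v : EuclideanSpace ℝ (Fin D) → ℝ) = fun x => φ (x - v) := rfl
  rw [h, fderiv_comp_sub, sub_add_cancel]

theorem integrable_local_translate (φ : 𝓢(EuclideanSpace ℝ (Fin D), ℝ)) (c₁ c₂ c₃ : ℝ)
    (v : EuclideanSpace ℝ (Fin D)) :
    Integrable fun x => c₁ * φ x ^ 2 + c₂ * ∑ a, (fderiv ℝ φ x (EuclideanSpace.single a 1)) ^ 2
      + c₃ * (‖x + v‖ ^ 2 * φ x ^ 2) := by
  have h1 := (integrable_schwartz_sq φ).const_mul c₁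
  have h2 := (integrable_finsetSum Finset.univ fun a _ =>
    integrable_fderiv_sq φ (EuclideanSpace.single a 1)).const_mul c₂
  have h3 := (integrable_norm_sq_mul_sq (φ.compSubConstCLM ℝ v)).comp_add_right v
  simp only [compSubConstCLM_apply, add_sub_cancel_right] at h3
  exact (h1.add h2).add (h3.const_mul c₃)

/-- The integral of a quadratic local density of the form of the action. -/
noncomputable def localAction (c₁ c₂ c₃ : ℝ) (φ : 𝓢(EuclideanSpace ℝ (Fin D), ℝ)) : ℝ :=
  ∫ x, (c₁ * φ x ^ 2 + c₂ * ∑ a, (fderiv ℝ φ x (EuclideanSpace.single a 1)) ^ 2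
    + c₃ * (‖x‖ ^ 2 * φ x ^ 2))

/-- The second difference under translations isolates the term with the harmonic potential. -/
theorem localAction_second_difference (φ : 𝓢(EuclideanSpace ℝ (Fin D), ℝ)) (c₁ c₂ c₃ : ℝ)
    (v : EuclideanSpace ℝ (Fin D)) :
    localAction c₁ c₂ c₃ (φ.compSubConstCLM ℝ v) + localAction c₁ c₂ c₃ (φ.compSubConstCLM ℝ (-v))
      - 2 * localAction c₁ c₂ c₃ φ = c₃ * (2 * ‖v‖ ^ 2 * ∫ x, φ x ^ 2) := by
  have h0 := integrable_local_translate φ c₁ c₂ c₃ 0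
  simp only [add_zero] at h0
  have e1 := integral_add (integrable_local_translate φ c₁ c₂ c₃ v)
    (integrable_local_translate φ c₁ c₂ c₃ (-v))
  have e2 := integral_sub ((integrable_local_translate φ c₁ c₂ c₃ v).add
    (integrable_local_translate φ c₁ c₂ c₃ (-v))) (h0.const_mul 2)
  simp only [Pi.add_apply] at e2
  simp only [localAction]
  rw [integral_local_translate, integral_local_translate, ← e1, ← integral_const_mul, ← e2,
    ← integral_const_mul, ← integral_const_mul]
  congr 1
  funext x
  have h := parallelogram_law_with_norm ℝ x v
  rw [← sub_eq_add_neg]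
  linear_combination c₃ * φ x ^ 2 * h

end translation

/-! ### Divergence of the counterterms summed over the scales -/

namespace FeynmanGraph

section divergence

variable {D : ℕ} {G : FeynmanGraph} {Ω M : ℝ} {e₀ : G.X} {T : Finset G.L}

theorem integral_kernelProd_mul_nonneg (hΩ : 0 < Ω) (hM : 1 < M) (m : ℝ) (μ : G.L → ℕ)
    {g : (G.L → EuclideanSpace ℝ (Fin D)) ×
      (({l : G.L // l ∉ T} → EuclideanSpace ℝ (Fin D)) × (G.L → ℝ)) → ℝ} (hg : ∀ y, 0 ≤ g y) :
    0 ≤ ∫ y, kernelProd Ω m e₀ T 0 y * g y ∂(innerMeasure D M μ T) := by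
  refine integral_nonneg_of_ae ?_
  filter_upwards [ae_innerMeasure M μ T] with y hy
  exact mul_nonneg (kernelProd_nonneg hΩ hM m e₀ 0 hy) (hg y)

/-- The sums of the counterterms which contain only the term without derivatives diverge. -/
theorem not_bddAbove_counterterm_of_zeroMoment (hG : G.IsPhi4) (hΩ : 0 < Ω) (hM : 1 < M) (m : ℝ)
    (hD : Nonempty G.L → 1 ≤ D) (hT : G.IsSpanningTree T) [Nonempty G.L]
    (hω : omega D G = 0 ∨ omega D G = -1) (i : ℕ) :
    ∃ φ : 𝓢(EuclideanSpace ℝ (Fin D), ℝ), ¬ BddAbove (Set.range fun ρ : ℕ =>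
      ‖∑ ν ∈ Fintype.piFinset (fun _ : G.L => Finset.Icc i ρ),
        counterterm Ω m M G ν e₀ T φ‖) := by
  have hN : Fintype.card G.X ≠ 0 := (Fintype.card_pos_iff.2 ⟨e₀⟩).ne'
  obtain ⟨φ, hφ⟩ := exists_schwartz_integral_pow_pos D hN
  have hM0 : 0 < M := by positivity
  have hC : 0 < lineConst D Ω G * ((2 * Real.pi) ^ D) ^ Fintype.card {e : G.X // e ≠ e₀} := by
    have := lineConst_pos D hΩ G
    have := Real.pi_pos
    positivity
  obtain ⟨ε, hε, hlow⟩ := exists_moment_lower_bound (e₀ := e₀) (h := fun _ => 1) (d := 0) hG hΩ hM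
    m hD hT (by simp) continuous_const (fun _ => zero_le_one) ⟨0, one_ne_zero⟩
    (fun μ => by simpa using integrable_kernelProd hΩ hM m hD hT μ 0)
  have hz : ∀ ν : G.L → ℕ, 0 ≤ zeroMoment D Ω m M ν e₀ T := fun ν => by
    have := integral_kernelProd_mul_nonneg (D := D) (e₀ := e₀) (T := T) hΩ hM m ν
      (g := fun _ => 1) fun _ => zero_le_one
    simp only [mul_one] at this
    exact mul_nonneg hC.le this
  have hz' : ∀ j : ℕ, 1 ≤ j → lineConst D Ω G * ((2 * Real.pi) ^ D) ^
      Fintype.card {e : G.X // e ≠ e₀} * ε ≤ zeroMoment D Ω m M (fun _ => j) e₀ T := fun j hj => by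
    refine mul_le_mul_of_nonneg_left ?_ hC.le
    have h1 := hlow j hj
    simp only [mul_one] at h1
    refine le_trans (le_mul_of_one_le_right hε.le ?_) h1
    refine one_le_zpow₀ (one_le_pow₀ hM.le) ?_
    omega
  refine ⟨φ, fun ⟨B, hB⟩ => not_bddAbove_sum_piFinset hz (mul_pos hC hε) hz' i
    ⟨B / ∫ x, φ x ^ Fintype.card G.X, ?_⟩⟩
  rintro _ ⟨ρ, rfl⟩
  have h1 := hB ⟨ρ, rfl⟩
  simp only at h1
  rw [Finset.sum_congr rfl fun ν _ => counterterm_eq_zeroMoment (e₀ := e₀) hΩ hM m hD hT hω ν φ,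
    ← Complex.ofReal_sum, ← Finset.sum_mul, Complex.norm_real, Real.norm_of_nonneg
      (mul_nonneg (Finset.sum_nonneg fun ν _ => hz ν) hφ.le)] at h1
  exact (le_div_iff₀ hφ).2 h1

/-- The sums of quadratically divergent counterterms diverge: the coefficient of the harmonic term
has a sign. -/
theorem not_bddAbove_counterterm_of_quadratic (hG : G.IsPhi4) (hΩ : 0 < Ω) (hM : 1 < M) (m : ℝ)
    (hD : Nonempty G.L → 1 ≤ D) (hT : G.IsSpanningTree T) [Nonempty G.L]
    (hω : omega D G = -2) (hX : Fintype.card G.X = 2) (i : ℕ) :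
    ∃ φ : 𝓢(EuclideanSpace ℝ (Fin D), ℝ), ¬ BddAbove (Set.range fun ρ : ℕ =>
      ‖∑ ν ∈ Fintype.piFinset (fun _ : G.L => Finset.Icc i ρ),
        counterterm Ω m M G ν e₀ T φ‖) := by
  obtain ⟨φ, hφ⟩ := exists_schwartz_integral_pow_pos D two_ne_zero
  have hM0 : 0 < M := by positivity
  have hC : 0 < lineConst D Ω G * (2 * Real.pi) ^ D * (1 / 2) := by
    have := lineConst_pos D hΩ G
    have := Real.pi_pos
    positivity
  set C := lineConst D Ω G * (2 * Real.pi) ^ D * (1 / 2) with hCdef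
  choose c₁ c₂ s hs hct using fun ν => exists_counterterm_eq (e₀ := e₀) hΩ hM m hD hT hω hX ν
  let a : Fin D := ⟨0, hD inferInstance⟩
  let l₀ : G.L := Classical.arbitrary _
  -- The harmonic coefficient is a moment of degree 2 and -ω - 2 = 0, so the lower bound does not
  -- depend on the scale.
  obtain ⟨ε, hε, hlow⟩ := exists_moment_lower_bound (e₀ := e₀)
    (h := fun u => ((∑ l, u l) a) ^ 2) (d := 2) hG hΩ hM m hD hT
    (fun r _ u => by
      simp only [Pi.smul_apply, ← Finset.smul_sum, PiLp.smul_apply, smul_eq_mul, mul_pow])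
    (by fun_prop) (fun _ => sq_nonneg _)
    ⟨Pi.single l₀ (EuclideanSpace.single a 1), by simp⟩
    (fun μ => by
      have := integrable_inner_sum_sq (e₀ := e₀) hΩ hM m hD hT μ (EuclideanSpace.single a 1)
      simp only [EuclideanSpace.inner_single_right, conj_trivial, one_mul] at this
      exact this)
  have hs0 : ∀ ν, 0 ≤ s ν := fun ν => by
    rw [hs ν a]
    exact integral_kernelProd_mul_nonneg hΩ hM m ν fun _ => sq_nonneg _
  have hs1 : ∀ j : ℕ, 1 ≤ j → ε ≤ s fun _ => j := fun j hj => by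
    rw [hs _ a]
    refine le_trans (le_of_eq ?_) (hlow j hj)
    rw [hω]
    norm_num
  set v : EuclideanSpace ℝ (Fin D) := EuclideanSpace.single a 1 with hv
  have hvn : ‖v‖ = 1 := by simp [hv]
  -- For one given field the mass and derivative terms might compensate the harmonic one. If the
  -- sums were bounded for φ and for both its translates by ±v, then so would be those of the second
  -- difference, which contains only the harmonic coefficient.
  by_contra! hcon
  obtain ⟨B₁, hB₁⟩ := hcon (φ.compSubConstCLM ℝ v)
  obtain ⟨B₂, hB₂⟩ := hcon (φ.compSubConstCLM ℝ (-v))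
  obtain ⟨B₃, hB₃⟩ := hcon φ
  have hpos : 0 < C * (2 * ∫ x, φ x ^ 2) := by positivity
  refine not_bddAbove_sum_piFinset hs0 hε hs1 i
    ⟨(B₁ + B₂ + 2 * B₃) / (C * (2 * ∫ x, φ x ^ 2)), ?_⟩
  rintro _ ⟨ρ, rfl⟩
  have h1 := hB₁ ⟨ρ, rfl⟩
  have h2 := hB₂ ⟨ρ, rfl⟩
  have h3 := hB₃ ⟨ρ, rfl⟩
  have hct' : ∀ ν ψ, counterterm Ω m M G ν e₀ T ψ =
      ((localAction (c₁ ν) (c₂ ν) (-(C * s ν)) ψ : ℝ) : ℂ) := hct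
  simp only [hct', ← Complex.ofReal_sum, Complex.norm_real, Real.norm_eq_abs] at h1 h2 h3
  rw [le_div_iff₀ hpos]
  have key : ∑ ν ∈ Fintype.piFinset (fun _ : G.L => Finset.Icc i ρ),
      -(s ν * (C * (2 * ∫ x, φ x ^ 2))) =
      ∑ ν ∈ Fintype.piFinset (fun _ : G.L => Finset.Icc i ρ),
        (localAction (c₁ ν) (c₂ ν) (-(C * s ν)) (φ.compSubConstCLM ℝ v) +
          localAction (c₁ ν) (c₂ ν) (-(C * s ν)) (φ.compSubConstCLM ℝ (-v)) -
          2 * localAction (c₁ ν) (c₂ ν) (-(C * s ν)) φ) :=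
    Finset.sum_congr rfl fun ν _ => by
      rw [localAction_second_difference, hvn]
      ring
  rw [Finset.sum_neg_distrib, ← Finset.sum_mul, Finset.sum_sub_distrib, Finset.sum_add_distrib,
    ← Finset.mul_sum] at key
  have a1 := (abs_le.1 h1).1
  have a2 := (abs_le.1 h2).1
  have a3 := (abs_le.1 h3).2
  linarith

end divergence

end FeynmanGraph

/-! ### The theorem -/

theorem theorem3 (D : ℕ) (hD : D ≤ 4) (Ω m M : ℝ) (hΩ : 0 < Ω) (hM : 1 < M)
    (G : FeynmanGraph) (hG : G.IsPhi4) (hconn : G.IsConnected) (hext : Nonempty G.X)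
    (P : Finset G.L) (S : Finset G.V) (hω : FeynmanGraph.omega D (G.sub P S) ≤ 0)
    (e₀ : (G.sub P S).X) (T : Finset (G.sub P S).L) (hT : (G.sub P S).IsSpanningTree T) :
    -- the amplitudes are well defined and the counterterm has the form of the action
    (∀ (μ : G.L → ℕ) (i : ℕ), G.IsQuasilocal μ i P S →
      (G.sub P S).AmpWellDefined D Ω m M (fun l => μ l.1) e₀ T ∧
      ((Fintype.card (G.sub P S).X = 4 ∧
          ∃ c : ℝ, ∀ φ : 𝓢(EuclideanSpace ℝ (Fin D), ℝ),
            (G.sub P S).counterterm Ω m M (fun l => μ l.1) e₀ T φ =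
              ((c * ∫ x, φ x ^ 4 : ℝ) : ℂ)) ∨
       (Fintype.card (G.sub P S).X = 2 ∧
          ∃ c₁ c₂ c₃ : ℝ, ∀ φ : 𝓢(EuclideanSpace ℝ (Fin D), ℝ),
            (G.sub P S).counterterm Ω m M (fun l => μ l.1) e₀ T φ =
              ((∫ x, (c₁ * φ x ^ 2
                + c₂ * ∑ a, (fderiv ℝ φ x (EuclideanSpace.single a 1)) ^ 2
                + c₃ * (‖x‖ ^ 2 * φ x ^ 2)) : ℝ) : ℂ)))) ∧
    -- if there is a line, the counterterms summed over the scales from `i` to `ρ` diverge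
    (∀ (μ : G.L → ℕ) (i : ℕ), G.IsQuasilocal μ i P S → Nonempty (G.sub P S).L →
      ∃ φ : 𝓢(EuclideanSpace ℝ (Fin D), ℝ),
        ¬ BddAbove (Set.range fun ρ : ℕ =>
          ‖∑ ν ∈ Fintype.piFinset (fun _ : (G.sub P S).L => Finset.Icc i ρ),
            (G.sub P S).counterterm Ω m M ν e₀ T φ‖)) ∧
    -- the rest gains the factor `M ^ (-i)`, uniformly in the attribution and the scale `i`
    (∀ φ : 𝓢(EuclideanSpace ℝ (Fin D), ℝ), ∃ K : ℝ,
      ∀ (μ : G.L → ℕ) (i : ℕ), G.IsQuasilocal μ i P S →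
        ‖(G.sub P S).amp Ω m M (fun l => μ l.1) e₀ T φ
            - (G.sub P S).counterterm Ω m M (fun l => μ l.1) e₀ T φ‖
          ≤ K * M ^ (-(i : ℤ)) * (G.sub P S).innerFactor D M (fun l => μ l.1)) ∧
    -- in particular the rest tends to zero when `i → ∞`, as long as the power counting factors of
    -- the quasilocal subgraphs smaller than the given one stay bounded
    (∀ (φ : 𝓢(EuclideanSpace ℝ (Fin D), ℝ)) (μ : ℕ → G.L → ℕ) (i : ℕ → ℕ),
      (∀ s, G.IsQuasilocal (μ s) (i s) P S) → Filter.Tendsto i Filter.atTop Filter.atTop →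
      BddAbove (Set.range fun s => (G.sub P S).innerFactor D M (fun l => μ s l.1)) →
        Filter.Tendsto
          (fun s => (G.sub P S).amp Ω m M (fun l => μ s l.1) e₀ T φ
            - (G.sub P S).counterterm Ω m M (fun l => μ s l.1) e₀ T φ)
          Filter.atTop (nhds 0)) := by
  classical
  have hH : (G.sub P S).IsPhi4 := FeynmanGraph.isPhi4_sub hG P S
  have hcases := FeynmanGraph.external_cases hH hD hT ⟨e₀⟩ hω
  -- In dimension 0 a graph of degree at most 0 has no line, so that the integrability of the
  -- propagator over the unbounded slice is never needed there.
  have hD1 : Nonempty (G.sub P S).L → 1 ≤ D := by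
    rcases hcases with h | h
    · exact h.2.2
    · exact fun _ => h.2.1
  have hrest : ∀ φ : 𝓢(EuclideanSpace ℝ (Fin D), ℝ), ∃ K : ℝ, 0 ≤ K ∧
      ∀ (μ : G.L → ℕ) (i : ℕ), G.IsQuasilocal μ i P S →
        ‖(G.sub P S).amp Ω m M (fun l => μ l.1) e₀ T φ
            - (G.sub P S).counterterm Ω m M (fun l => μ l.1) e₀ T φ‖
          ≤ K * M ^ (-(i : ℤ)) * (G.sub P S).innerFactor D M (fun l => μ l.1) := fun φ => by
    obtain ⟨K, hK0, hK⟩ := FeynmanGraph.exists_rest_bound (e₀ := e₀) hH hΩ hM m hD1 hω hT φ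
    refine ⟨K, hK0, fun μ i h => ?_⟩
    rw [mul_assoc]
    exact hK _ i fun l => h.le_index l
  refine ⟨fun μ i h => ⟨FeynmanGraph.ampWellDefined hΩ hM m hD1 hT _, ?_⟩, fun μ i h hL => ?_,
    fun φ => (hrest φ).imp fun K hK => hK.2, fun φ μ i h hi ⟨B, hB⟩ => ?_⟩
  · rcases hcases with ⟨hX, h0, _⟩ | ⟨hX, _, h0⟩
    · refine Or.inl ⟨hX, FeynmanGraph.zeroMoment D Ω m M (fun l : (G.sub P S).L => μ l.1) e₀ T, fun φ => ?_⟩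
      rw [FeynmanGraph.counterterm_eq_zeroMoment hΩ hM m hD1 hT (Or.inl h0), hX]
    · refine Or.inr ⟨hX, ?_⟩
      rcases or_assoc.2 h0 with h0 | h0
      · refine ⟨FeynmanGraph.zeroMoment D Ω m M (fun l : (G.sub P S).L => μ l.1) e₀ T, 0, 0,
          fun φ => ?_⟩
        rw [FeynmanGraph.counterterm_eq_zeroMoment hΩ hM m hD1 hT h0, hX, ← integral_const_mul]
        simp only [zero_mul, add_zero]
      · obtain ⟨c₁, c₂, s, _, hs⟩ := FeynmanGraph.exists_counterterm_eq (e₀ := e₀) hΩ hM m hD1 hT h0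
          hX fun l => μ l.1
        exact ⟨c₁, c₂, _, hs⟩
  · rcases hcases with ⟨_, h0, _⟩ | ⟨hX, _, h0⟩
    · exact FeynmanGraph.not_bddAbove_counterterm_of_zeroMoment hH hΩ hM m hD1 hT (Or.inl h0) i
    · rcases or_assoc.2 h0 with h0 | h0
      · exact FeynmanGraph.not_bddAbove_counterterm_of_zeroMoment hH hΩ hM m hD1 hT h0 i
      · exact FeynmanGraph.not_bddAbove_counterterm_of_quadratic hH hΩ hM m hD1 hT h0 hX i
  · obtain ⟨K, hK0, hK⟩ := hrest φ
    refine squeeze_zero_norm (a := fun s => K * M ^ (-(i s : ℤ)) * B) (fun s => ?_) ?_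
    · refine (hK _ _ (h s)).trans (mul_le_mul_of_nonneg_left (hB ⟨s, rfl⟩) ?_)
      have : 0 < M := by positivity
      positivity
    · have h1 : Filter.Tendsto (fun s => (M ^ i s)⁻¹) Filter.atTop (nhds 0) :=
        tendsto_inv_atTop_zero.comp ((tendsto_pow_atTop_atTop_of_one_lt hM).comp hi)
      have h2 := (h1.const_mul K).mul_const B
      simpa only [zpow_neg, zpow_natCast, mul_zero, zero_mul] using h2
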